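/- Lemma 1.1. Let $m\ge 5$ be an integer and let $I_2(m)=\langle a,b\mid w_m(a,b)=w_m(b,a)\rangle$ be the dihedral Artin group, where $w_m(s,t)=stst\cdots$ is the alternating word of length $m$. There exist a compact, locally $\mathrm{CAT}(0)$, $3$-dimensional piecewise Euclidean complex $X_m$ (with finitely many cells), a point $x_0\in X_m$, an isomorphism $\pi_1(X_m,x_0)\simeq I_2(m)$, and two oriented, simple, locally geodesic closed loops $X_m^a$, $X_m^b$ of length $1$ based at $x_0$, which represent $a$ and $b$ respectively, such that the inclusions identify $\pi_1(X_m^a,x_0)$ with $\langle a\rangle$ and $\pi_1(X_m^b,x_0)$ with $\langle b\rangle$. Let $a^+,a^-$ (resp. $b^+,b^-$) denote the directions at $x_0$, that is the points of the link of $x_0$ in $X_m$, defined by the positive and the negative side of the loop $X_m^a$ (resp. $X_m^b$), and let $\angle_{x_0}$ denote the Alexandrov angle between directions at $x_0$. Then: - $X_m^a\cap X_m^b=\{x_0\}$; - $\angle_{x_0}(a^+,b^+)=\angle_{x_0}(a^-,b^-)>\frac{4\pi}{5}$; - $\angle_{x_0}(a^+,b^-)=\angle_{x_0}(a^-,b^+)>\frac{3\pi}{5}$;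 - if $m\ge 6$, moreover $\angle_{x_0}(a^+,b^-)=\angle_{x_0}(a^-,b^+)>\frac{2\pi}{3}$. -/

import Mathlib

open Set Filter Topology

/-- The alternating word `w_n(x, y) = x y x y ⋯` of length `n`. -/
def altWord {G : Type*} [Monoid G] (x y : G) : ℕ → G
  | 0 => 1
  | n + 1 => x * altWord y x n

/-- The dihedral Artin group `I₂(m) = ⟨a, b ∣ w_m(a, b) = w_m(b, a)⟩`. -/
abbrev DihedralArtinGroup (m : ℕ) : Type :=
  PresentedGroup
    ({altWord (FreeGroup.of 0) (FreeGroup.of 1) m *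
      (altWord (FreeGroup.of 1) (FreeGroup.of 0) m)⁻¹} : Set (FreeGroup (Fin 2)))

namespace DihedralArtinGroup

/-- The standard generator `a` of `I₂(m)`. -/
def a (m : ℕ) : DihedralArtinGroup m := PresentedGroup.of 0

/-- The standard generator `b` of `I₂(m)`. -/
def b (m : ℕ) : DihedralArtinGroup m := PresentedGroup.of 1

end DihedralArtinGroup

section Metric

variable {X : Type*} [MetricSpace X]

/-- `c`, restricted to `[0, 1]`, is a geodesic segment from `p` to `q`, parametrized
proportionally to arc length. -/
def IsGeodesicFromTo (c : ℝ → X) (p q : X) : Prop :=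
  c 0 = p ∧ c 1 = q ∧
    ∀ s ∈ Icc (0 : ℝ) 1, ∀ t ∈ Icc (0 : ℝ) 1, dist (c s) (c t) = |s - t| * dist p q

/-- CAT(0) spaces: geodesic metric spaces in which geodesic triangles are not thicker than their
comparison triangles in the Euclidean plane. A triangle has vertices `p`, `q`, `r` and sides
`c₁`, `c₂`, `c₃`. Since the three vertices play symmetric roles, it is enough to compare the points
of the two sides that issue from `p`. -/
def IsCAT0 (X : Type*) [MetricSpace X] : Prop :=
  (∀ p q : X, ∃ c : ℝ → X, IsGeodesicFromTo c p q) ∧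
  ∀ (p q r : X) (c₁ c₂ c₃ : ℝ → X),
    IsGeodesicFromTo c₁ p q → IsGeodesicFromTo c₂ p r → IsGeodesicFromTo c₃ q r →
    ∀ p' q' r' : EuclideanSpace ℝ (Fin 2),
      dist p' q' = dist p q → dist p' r' = dist p r → dist q' r' = dist q r →
      ∀ s ∈ Icc (0 : ℝ) 1, ∀ t ∈ Icc (0 : ℝ) 1,
        dist (c₁ s) (c₂ t) ≤ dist (AffineMap.lineMap p' q' s) (AffineMap.lineMap p' r' t)

/-- Locally CAT(0) (nonpositively curved) spaces: every point is the center of a ball of positive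
radius which is a CAT(0) space for the induced metric. -/
def IsLocallyCAT0 (X : Type*) [MetricSpace X] : Prop :=
  ∀ x : X, ∃ r > 0, IsCAT0 (Metric.ball x r)

/-- The comparison angle at `x` between `y` and `z`: the angle at the vertex corresponding to `x`
in a Euclidean triangle with the same side lengths as `x`, `y`, `z` (for `y ≠ x ≠ z`). -/
noncomputable def comparisonAngle (x y z : X) : ℝ :=
  Real.arccos ((dist x y ^ 2 + dist x z ^ 2 - dist y z ^ 2) / (2 * dist x y * dist x z))

/-- The Alexandrov angle at `x` between two paths `c`, `c'` issuing from `x` at time `0` exists (in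
the strict sense, as a limit of comparison angles) and equals `θ`. For geodesic germs, this is the
angle between the directions that they define in the link of `x`. -/
def HasAngle (x : X) (c c' : ℝ → X) (θ : ℝ) : Prop :=
  Tendsto (fun st : ℝ × ℝ => comparisonAngle x (c st.1) (c' st.2))
    ((𝓝[>] 0) ×ˢ (𝓝[>] 0)) (𝓝 θ)

/-- The `1`-periodic map `ℝ → X` which runs along the loop `γ` again and again. -/
noncomputable def Path.around {x : X} (γ : Path x x) (t : ℝ) : X := γ.extend (Int.fract t)

/-- The path `t ↦ γ (t)` leaving `x` on the positive side of the loop `γ` (`t ≥ 0` small). -/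
noncomputable def Path.posSide {x : X} (γ : Path x x) (t : ℝ) : X := γ.around t

/-- The path `t ↦ γ (-t)` leaving `x` on the negative side of the loop `γ` (`t ≥ 0` small). -/
noncomputable def Path.negSide {x : X} (γ : Path x x) (t : ℝ) : X := γ.around (-t)

/-- `γ`, parametrized by arc length on `[0, 1]`, is a simple closed local geodesic of length `1`
(it is locally geodesic at its base point too). -/
structure Path.IsSimpleLocalGeodesicLoop {x : X} (γ : Path x x) : Prop where
  locallyGeodesic : ∀ t : ℝ, ∃ ε > 0, ∀ s ∈ Ioo (t - ε) (t + ε), ∀ s' ∈ Ioo (t - ε) (t + ε),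
    dist (γ.around s) (γ.around s') = |s - s'|
  simple : InjOn γ.around (Ico 0 1)

/-- The homomorphism `π₁(S, x) → π₁(X, x)` induced by the inclusion of a subspace `S` of `X`. -/
noncomputable def fundamentalGroupInclusion (S : Set X) (x : X) (hx : x ∈ S) :
    FundamentalGroup S ⟨x, hx⟩ →* FundamentalGroup X x :=
  FundamentalGroup.map (⟨Subtype.val, continuous_subtype_val⟩ : C(S, X)) ⟨x, hx⟩

end Metric

/-- The combinatorial data of a piecewise Euclidean (`M₀`-polyhedral) complex with underlying set
`X`: a family of convex Euclidean polytopes, and a map from each of them to `X`. -/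
structure CellData (X : Type*) where
  /-- The index set of the family of cells. -/
  ι : Type
  /-- The `i`-th cell is given in a Euclidean space of dimension `ambient i`. -/
  ambient : ι → ℕ
  /-- The `i`-th cell is the convex hull of this nonempty finite set. -/
  vertices : ∀ i, Finset (EuclideanSpace ℝ (Fin (ambient i)))
  vertices_nonempty : ∀ i, (vertices i).Nonempty
  /-- The characteristic map of the `i`-th cell; only its values on the cell matter. -/
  chart : ∀ i, EuclideanSpace ℝ (Fin (ambient i)) → X

namespace CellData

variable {X : Type*} (K : CellData X)

/-- The `i`-th cell, a convex polytope. -/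
def cell (i : K.ι) : Set (EuclideanSpace ℝ (Fin (K.ambient i))) :=
  convexHull ℝ (K.vertices i : Set (EuclideanSpace ℝ (Fin (K.ambient i))))

/-- The dimension of the `i`-th cell. -/
noncomputable def cellDim (i : K.ι) : ℕ := Module.finrank ℝ (vectorSpan ℝ (K.cell i))

/-- `F` is the support of the point `u` of the `i`-th cell, that is the face of this cell (a
polytope, so that its nonempty faces are its nonempty exposed subsets, and itself) which contains
`u` in its relative interior. -/
def IsSupport (i : K.ι) (u : EuclideanSpace ℝ (Fin (K.ambient i)))
    (F : Set (EuclideanSpace ℝ (Fin (K.ambient i)))) : Prop :=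
  IsExposed ℝ (K.cell i) F ∧ u ∈ intrinsicInterior ℝ F

/-- `K.IsString x y L`: there is a string of points `x = x₀, x₁, …, x_n = y`, any two consecutive
ones lying in a common cell, whose total length, measured in these Euclidean cells, is `L`. -/
inductive IsString : X → X → ℝ → Prop
  | nil (x : X) : IsString x x 0
  | cons (i : K.ι) (u v : EuclideanSpace ℝ (Fin (K.ambient i))) (hu : u ∈ K.cell i)
      (hv : v ∈ K.cell i) (y : X) (L : ℝ) (h : IsString (K.chart i v) y L) :
      IsString (K.chart i u) y (dist u v + L)

/-- `K` is `n`-dimensional: its cells have dimension at most `n`, and some cell has dimension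
exactly `n`. -/
def HasDimension (n : ℕ) : Prop := (∀ i, K.cellDim i ≤ n) ∧ ∃ i, K.cellDim i = n

end CellData

/-- A structure of piecewise Euclidean complex on the metric space `X`: the space `X` is the
quotient of a disjoint union of convex Euclidean polytopes, glued along isometries between faces,
and its metric is the quotient (length) metric. -/
structure PiecewiseEuclideanComplex (X : Type*) [MetricSpace X] extends CellData X where
  /-- The cells cover `X`. -/
  covers : ∀ x : X, ∃ i, ∃ u ∈ toCellData.cell i, chart i u = x
  /-- Each characteristic map is injective on the relative interior of each face. -/
  injOn_face : ∀ i F, IsExposed ℝ (toCellData.cell i) F → InjOn (chart i) (intrinsicInterior ℝ F)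
  /-- If two points are identified, then so are their supports, by an isometry. -/
  glue : ∀ i j, ∀ u ∈ toCellData.cell i, ∀ v ∈ toCellData.cell j, chart i u = chart j v →
    ∀ F G, toCellData.IsSupport i u F → toCellData.IsSupport j v G →
      ∃ h : F ≃ᵢ G, ∀ z : F, chart i z = chart j (h z)
  /-- The distance of two points is the infimum of the lengths of the strings joining them. -/
  isGLB_dist : ∀ x y : X, IsGLB {L : ℝ | toCellData.IsString x y L} (dist x y)

/-! Let P be the regular m-gon with side 24/25. Glue two copies of P (the sheets) along their
vertices, multiply by a line, and divide this tower by the screw motion that turns P by one step,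
exchanges the sheets and climbs 7/25. The quotient is made of two prisms. Because 7² + 24² = 25²,
the diagonal of a side face, from a vertex at height 0 to the next vertex at height 7/25, has length
1. The screw motion identifies its ends, so each sheet yields one loop; these two loops represent
`a` and `b`.

Curvature. Near a point of the tower, the two sheets look like a convex set or like two convex sets
joined at one point, and the tower is the product of this with a line. The CN inequality holds in
each factor and passes to products and balls, and it implies CAT(0) (`IsCNOn.isCAT0`). Non-trivial
screws move points by at least the pitch, so small balls of the quotient are isometric to balls of
the tower.

Angles. On leaving the vertex, `a⁺` and `b⁺` lie in different sheets and both climb, so the cosine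
of their angle is -(24/25)² + (7/25)². A loop changes sheet at the base point, so `a⁺` and `b⁻` lie
in one sheet. Their horizontal parts make the interior angle of P and their vertical parts are
opposite, which makes the angle larger than the interior angle.

Fundamental group. A staircase of m edges around one prism ends over its initial vertex. Prisms
being contractible, it is homotopic to a vertical segment, which belongs to both sheets; the two
staircases spell the two sides of the Artin relation (`nodeClass_period`). This gives a homomorphism
from the Artin group. It is surjective because a loop lifts to the tower and is cut there into short
paths, each homotopic to straight paths in prisms (`isGenerated`).

For injectivity, copies of the sheets indexed by the Artin group are glued into a covering of the
tower: passing from sheet 0 to sheet 1 at vertex i multiplies by c_i, where c_0 = b, c_1 = a and c_i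
c_{i+1} = ba. The relation says exactly that c_i depends on i modulo m only (`conjugate_add`). By
induction on words, the loop of an element g lifts to a path whose end determines g
(`exists_reaches`). If the loop is trivial, unique lifting forces g = 1
(`Gluing.eq_of_reaches_one`). -/

/-! ### The CN inequality of Bruhat and Tits -/

/-- On the set `S`, the map `g` is a choice of geodesics, parametrized proportionally to arc
length, which satisfy the CN inequality of Bruhat and Tits. -/
structure IsCNOn {N : Type*} [PseudoMetricSpace N] (S : Set N) (g : N → N → ℝ → N) : Prop where
  zero : ∀ q ∈ S, ∀ r ∈ S, dist (g q r 0) q = 0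
  one : ∀ q ∈ S, ∀ r ∈ S, dist (g q r 1) r = 0
  mem : ∀ q ∈ S, ∀ r ∈ S, ∀ t ∈ Icc (0 : ℝ) 1, g q r t ∈ S
  dist_eq : ∀ q ∈ S, ∀ r ∈ S, ∀ s ∈ Icc (0 : ℝ) 1, ∀ t ∈ Icc (0 : ℝ) 1,
    dist (g q r s) (g q r t) = |s - t| * dist q r
  cn : ∀ q ∈ S, ∀ r ∈ S, ∀ p ∈ S, ∀ t ∈ Icc (0 : ℝ) 1,
    dist p (g q r t) ^ 2 ≤ (1 - t) * dist p q ^ 2 + t * dist p r ^ 2 - t * (1 - t) * dist q r ^ 2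

theorem dist_eq_sqrt_prod {N N' : Type*} [PseudoMetricSpace N] [PseudoMetricSpace N']
    (x y : WithLp 2 (N × N')) :
    dist x y = √(dist x.fst y.fst ^ 2 + dist x.snd y.snd ^ 2) := by
  rw [WithLp.prod_dist_eq_add (by norm_num), Real.sqrt_eq_rpow]
  norm_num

theorem dist_sq_lineMap {E : Type*} [NormedAddCommGroup E] [InnerProductSpace ℝ E]
    (p q r : E) (t : ℝ) :
    dist p (AffineMap.lineMap q r t) ^ 2 =
      (1 - t) * dist p q ^ 2 + t * dist p r ^ 2 - t * (1 - t) * dist q r ^ 2 := by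
  have h1 : p - AffineMap.lineMap q r t = (p - q) - t • (r - q) := by
    rw [AffineMap.lineMap_apply_module]; module
  rw [dist_eq_norm, dist_eq_norm, dist_eq_norm, dist_eq_norm, h1, ← sub_sub_sub_cancel_right p r q,
    ← norm_neg (q - r), neg_sub, norm_sub_sq_real, norm_sub_sq_real (p - q) (r - q), norm_smul, inner_smul_right,
    mul_pow, Real.norm_eq_abs,
    sq_abs]
  ring

namespace IsCNOn

variable {N : Type*} [PseudoMetricSpace N] {S : Set N} {g : N → N → ℝ → N}

/-- The inequality at the centre bounds the squared distance to a point of a geodesic by a convex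
combination of the squared distances to its ends, so balls are convex. -/
theorem inter_ball (h : IsCNOn S g) {x : N} (hx : x ∈ S) (r : ℝ) :
    IsCNOn (S ∩ Metric.ball x r) g where
  zero q hq r hr := h.zero q hq.1 r hr.1
  one q hq r hr := h.one q hq.1 r hr.1
  mem q hq q' hq' t ht := by
    refine ⟨h.mem q hq.1 q' hq'.1 t ht, ?_⟩
    have h1 := h.cn q hq.1 q' hq'.1 x hx t ht
    have h2 := Metric.mem_ball'.1 hq.2
    have h3 := Metric.mem_ball'.1 hq'.2
    have hr : 0 < r := dist_nonneg.trans_lt h2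
    rw [Metric.mem_ball']
    refine lt_of_pow_lt_pow_left₀ 2 hr.le (h1.trans_lt ?_)
    have h4 : dist x q ^ 2 < r ^ 2 := by gcongr
    have h5 : dist x q' ^ 2 < r ^ 2 := by gcongr
    obtain ⟨ht0, ht1⟩ := ht
    have h6 : 0 ≤ t * (1 - t) * dist q q' ^ 2 := by
      have : 0 ≤ 1 - t := by linarith
      positivity
    rcases eq_or_lt_of_le ht0 with rfl | ht0
    · simpa using h4
    · nlinarith
  dist_eq q hq r hr := h.dist_eq q hq.1 r hr.1
  cn q hq r hr p hp := h.cn q hq.1 r hr.1 p hp.1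

/-- The inequality is linear in squared distances, and these add in an ℓ² product. -/
theorem prod {N' : Type*} [PseudoMetricSpace N'] {S' : Set N'} {g' : N' → N' → ℝ → N'}
    (h : IsCNOn S g) (h' : IsCNOn S' g') :
    IsCNOn {x : WithLp 2 (N × N') | x.fst ∈ S ∧ x.snd ∈ S'}
      (fun q r t => WithLp.toLp 2 (g q.fst r.fst t, g' q.snd r.snd t)) where
  zero q hq r hr := by
    rw [dist_eq_sqrt_prod]
    simp [h.zero q.fst hq.1 r.fst hr.1, h'.zero q.snd hq.2 r.snd hr.2]
  one q hq r hr := by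
    rw [dist_eq_sqrt_prod]
    simp [h.one q.fst hq.1 r.fst hr.1, h'.one q.snd hq.2 r.snd hr.2]
  mem q hq r hr t ht := ⟨h.mem _ hq.1 _ hr.1 t ht, h'.mem _ hq.2 _ hr.2 t ht⟩
  dist_eq q hq r hr s hs t ht := by
    rw [dist_eq_sqrt_prod, dist_eq_sqrt_prod]
    simp only [WithLp.toLp_fst, WithLp.toLp_snd, h.dist_eq _ hq.1 _ hr.1 s hs t ht,
      h'.dist_eq _ hq.2 _ hr.2 s hs t ht]
    rw [mul_pow, mul_pow, ← mul_add, Real.sqrt_mul (by positivity), Real.sqrt_sq (abs_nonneg _)]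
  cn q hq r hr p hp t ht := by
    rw [dist_eq_sqrt_prod, dist_eq_sqrt_prod, dist_eq_sqrt_prod,
      dist_eq_sqrt_prod, Real.sq_sqrt (by positivity), Real.sq_sqrt (by positivity),
      Real.sq_sqrt (by positivity), Real.sq_sqrt (by positivity)]
    simp only [WithLp.toLp_fst, WithLp.toLp_snd]
    have h1 := h.cn _ hq.1 _ hr.1 _ hp.1 t ht
    have h2 := h'.cn _ hq.2 _ hr.2 _ hp.2 t ht
    linarith

/-- In an inner product space the inequality is an equality, namely Stewart's theorem. -/
theorem of_convex {E : Type*} [NormedAddCommGroup E] [InnerProductSpace ℝ E] {S : Set E}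
    (hS : Convex ℝ S) : IsCNOn S (fun q r t => AffineMap.lineMap q r t) where
  zero q _ r _ := by simp
  one q _ r _ := by simp
  mem q hq r hr t ht := hS.lineMap_mem hq hr ht
  dist_eq q _ r _ s _ t _ := by rw [dist_lineMap_lineMap, Real.dist_eq]
  cn q _ r _ p _ t _ := (dist_sq_lineMap p q r t).le

/-- A metric space which is a metric quotient of a set with the CN property is CAT(0). -/
theorem isCAT0 {B : Type*} [MetricSpace B] (h : IsCNOn S g) (F : N → B)
    (hsurj : ∀ b, ∃ x ∈ S, F x = b) (hF : ∀ x ∈ S, ∀ y ∈ S, dist (F x) (F y) = dist x y) :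
    IsCAT0 B := by
  have key : ∀ q r : B, ∃ c : ℝ → B, IsGeodesicFromTo c q r ∧ ∀ p : B, ∀ t ∈ Icc (0 : ℝ) 1,
      dist p (c t) ^ 2 ≤ (1 - t) * dist p q ^ 2 + t * dist p r ^ 2
        - t * (1 - t) * dist q r ^ 2 := by
    intro q r
    obtain ⟨q, hq, rfl⟩ := hsurj q
    obtain ⟨r, hr, rfl⟩ := hsurj r
    have h0 : (0 : ℝ) ∈ Icc (0 : ℝ) 1 := ⟨le_rfl, zero_le_one⟩
    have h1 : (1 : ℝ) ∈ Icc (0 : ℝ) 1 := ⟨zero_le_one, le_rfl⟩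
    refine ⟨fun t => F (g q r t), ⟨?_, ?_, fun s hs t ht => ?_⟩, fun p t ht => ?_⟩
    · rw [← dist_eq_zero, hF _ (h.mem q hq r hr 0 h0) _ hq, h.zero q hq r hr]
    · rw [← dist_eq_zero, hF _ (h.mem q hq r hr 1 h1) _ hr, h.one q hq r hr]
    · rw [hF _ (h.mem q hq r hr s hs) _ (h.mem q hq r hr t ht), hF _ hq _ hr,
        h.dist_eq q hq r hr s hs t ht]
    · obtain ⟨p, hp, rfl⟩ := hsurj p
      rw [hF _ hp _ (h.mem q hq r hr t ht), hF _ hp _ hq, hF _ hp _ hr, hF _ hq _ hr]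
      exact h.cn q hq r hr p hp t ht
  -- Geodesics are unique: the inequality for the chosen geodesic, tested at the point `c t` of any
  -- other one, has right-hand side 0. Hence it holds for every geodesic.
  have cn : ∀ (q r : B) (c : ℝ → B), IsGeodesicFromTo c q r → ∀ p : B, ∀ t ∈ Icc (0 : ℝ) 1,
      dist p (c t) ^ 2 ≤ (1 - t) * dist p q ^ 2 + t * dist p r ^ 2
        - t * (1 - t) * dist q r ^ 2 := by
    rintro q r c ⟨hc0, hc1, hc⟩ p t ht
    obtain ⟨c', -, hcn⟩ := key q r
    have e1 : dist (c t) q = t * dist q r := by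
      rw [← hc0, hc t ht 0 ⟨le_rfl, zero_le_one⟩, hc0, sub_zero, abs_of_nonneg ht.1]
    have e2 : dist (c t) r = (1 - t) * dist q r := by
      rw [← hc1, hc t ht 1 ⟨zero_le_one, le_rfl⟩, hc1, abs_sub_comm, abs_of_nonneg]
      linarith [ht.2]
    have h2 := hcn (c t) t ht
    rw [e1, e2] at h2
    have h3 : dist (c t) (c' t) ^ 2 ≤ 0 := h2.trans_eq (by ring)
    have h4 : c t = c' t := by
      rw [← dist_eq_zero]
      exact pow_eq_zero_iff two_ne_zero |>.1 (le_antisymm h3 (sq_nonneg _))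
    rw [h4]
    exact hcn p t ht
  refine ⟨fun p q => (key p q).imp fun c hc => hc.1, ?_⟩
  intro p q r c₁ c₂ _ h₁ h₂ _ p' q' r' hpq hpr hqr s hs t ht
  refine (pow_le_pow_iff_left₀ dist_nonneg dist_nonneg two_ne_zero).1 ?_
  -- The inequality is used once for each side issuing from `p`; the comparison triangle satisfies
  -- the same two relations as equalities.
  have a1 := cn p r c₂ h₂ (c₁ s) t ht
  have a2 := cn p q c₁ h₁ r s hs
  have e1 : dist (c₁ s) p = s * dist p q := by
    rw [← h₁.1, h₁.2.2 s hs 0 ⟨le_rfl, zero_le_one⟩, h₁.1, sub_zero, abs_of_nonneg hs.1]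
  have e2 : dist (AffineMap.lineMap p' q' s) p' = s * dist p q := by
    rw [dist_lineMap_left, hpq, Real.norm_eq_abs, abs_of_nonneg hs.1]
  rw [dist_sq_lineMap, e2, dist_comm _ r', dist_sq_lineMap, dist_comm r' p', dist_comm r' q', hpq,
    hpr, hqr]
  rw [e1, dist_comm (c₁ s) r] at a1
  rw [dist_comm r p, dist_comm r q] at a2
  have := mul_le_mul_of_nonneg_left a2 ht.1
  linarith

end IsCNOn

/-! ### Quotients of metric spaces by a screw motion -/

/-- A metric space with an isometric action of `ℤ` which translates a `1`-Lipschitz height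
function. -/
class ScrewSpace (E : Type*) [MetricSpace E] extends AddAction ℤ E where
  dist_vadd : ∀ (n : ℤ) (x y : E), dist (n +ᵥ x) (n +ᵥ y) = dist x y
  height : E → ℝ
  pitch : ℝ
  pitch_pos : 0 < pitch
  abs_height_sub_le : ∀ x y : E, |height x - height y| ≤ dist x y
  height_vadd : ∀ (n : ℤ) (x : E), height (n +ᵥ x) = height x + n * pitch

namespace ScrewSpace

variable (E : Type*) [MetricSpace E] [ScrewSpace E]

/-- The space of orbits. -/
def Orbits : Type _ := Quotient (AddAction.orbitRel ℤ E)

variable {E}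

/-- The orbit of a point. -/
def orbit (x : E) : Orbits E := Quotient.mk (AddAction.orbitRel ℤ E) x

theorem orbit_surjective : Function.Surjective (orbit : E → Orbits E) := Quotient.mk_surjective

theorem orbit_eq_orbit_iff {x y : E} : orbit x = orbit y ↔ ∃ n : ℤ, n +ᵥ y = x :=
  Quotient.eq (r := AddAction.orbitRel ℤ E)

theorem orbit_vadd (n : ℤ) (x : E) : orbit (n +ᵥ x) = orbit x := orbit_eq_orbit_iff.2 ⟨n, rfl⟩

theorem dist_vadd_left (n : ℤ) (x y : E) : dist (n +ᵥ x) y = dist x (-n +ᵥ y) := by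
  rw [← dist_vadd (-n) (n +ᵥ x), neg_vadd_vadd]

theorem bddBelow_dist (x y : E) : BddBelow (range fun n : ℤ => dist x (n +ᵥ y)) :=
  ⟨0, by rintro _ ⟨n, rfl⟩; exact dist_nonneg⟩

theorem abs_mul_pitch_le (n : ℤ) (x : E) : |(n : ℝ)| * pitch E ≤ dist x (n +ᵥ x) := by
  have := abs_height_sub_le (n +ᵥ x) x
  rw [height_vadd, add_sub_cancel_left, abs_mul, abs_of_pos (pitch_pos (E := E))] at this
  rwa [dist_comm]

theorem pitch_le_dist {n : ℤ} (hn : n ≠ 0) (x : E) : pitch E ≤ dist x (n +ᵥ x) := by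
  refine le_trans ?_ (abs_mul_pitch_le n x)
  have : (1 : ℝ) ≤ |(n : ℝ)| := by exact_mod_cast Int.one_le_abs hn
  nlinarith [pitch_pos (E := E)]

/-- Any other translate of `y` is at least the pitch away from `y`, hence farther than half the
pitch from `x`. -/
theorem iInf_dist_eq_of_dist_lt {x y : E} (h : dist x y < pitch E / 2) :
    ⨅ n : ℤ, dist x (n +ᵥ y) = dist x y := by
  refine le_antisymm ((ciInf_le (bddBelow_dist x y) 0).trans_eq (by rw [zero_vadd]))
    (le_ciInf fun n => ?_)
  rcases eq_or_ne n 0 with rfl | hn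
  · rw [zero_vadd]
  · have h1 := pitch_le_dist hn y
    have h2 := dist_triangle_left y (n +ᵥ y) x
    linarith

noncomputable instance : Dist (Orbits E) where
  dist := Quotient.lift₂ (fun x y => ⨅ n : ℤ, dist x (n +ᵥ y)) (by
    rintro x y x' y' ⟨k, rfl⟩ ⟨l, rfl⟩
    refine Equiv.iInf_congr ((Equiv.addLeft (-k)).trans (Equiv.addRight l)) fun n => ?_
    simp only [Equiv.trans_apply, Equiv.coe_addLeft, Equiv.coe_addRight]
    rw [dist_vadd_left]
    simp only [vadd_vadd]
    congr 2
    abel)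

theorem dist_orbit (x y : E) : dist (orbit x) (orbit y) = ⨅ n : ℤ, dist x (n +ᵥ y) := rfl

theorem dist_orbit_le (x y : E) : dist (orbit x) (orbit y) ≤ dist x y :=
  (ciInf_le (bddBelow_dist x y) 0).trans_eq (by rw [zero_vadd])

theorem exists_dist_lt {x y : E} {r : ℝ} (h : dist (orbit x) (orbit y) < r) :
    ∃ n : ℤ, dist x (n +ᵥ y) < r := exists_lt_of_ciInf_lt h

theorem dist_orbit_eq_of_dist_lt {x y : E} (h : dist x y < pitch E / 2) :
    dist (orbit x) (orbit y) = dist x y := iInf_dist_eq_of_dist_lt h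

noncomputable instance : MetricSpace (Orbits E) where
  dist_self x := by
    obtain ⟨x, rfl⟩ := orbit_surjective x
    refine le_antisymm ((dist_orbit_le x x).trans_eq (dist_self x))
      (Real.iInf_nonneg fun n => dist_nonneg)
  dist_comm x y := by
    obtain ⟨x, rfl⟩ := orbit_surjective x
    obtain ⟨y, rfl⟩ := orbit_surjective y
    refine Equiv.iInf_congr (Equiv.neg ℤ) fun n => ?_
    rw [Equiv.neg_apply, dist_comm, dist_vadd_left, neg_neg]
  dist_triangle x y z := by
    obtain ⟨x, rfl⟩ := orbit_surjective x
    obtain ⟨y, rfl⟩ := orbit_surjective y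
    obtain ⟨z, rfl⟩ := orbit_surjective z
    refine le_of_forall_pos_lt_add fun ε hε => ?_
    obtain ⟨n, hn⟩ := exists_dist_lt (lt_add_of_pos_right (dist (orbit x) (orbit y)) (half_pos hε))
    obtain ⟨k, hk⟩ := exists_dist_lt (lt_add_of_pos_right (dist (orbit y) (orbit z)) (half_pos hε))
    have h1 : dist (orbit x) (orbit z) ≤ dist x (n +ᵥ k +ᵥ z) := by
      rw [vadd_vadd]; exact ciInf_le (bddBelow_dist x z) (n + k)
    have h2 := dist_triangle x (n +ᵥ y) (n +ᵥ k +ᵥ z)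
    rw [dist_vadd] at h2
    linarith
  eq_of_dist_eq_zero {x y} h := by
    obtain ⟨x, rfl⟩ := orbit_surjective x
    obtain ⟨y, rfl⟩ := orbit_surjective y
    -- Some translate lies within half the pitch, where the orbit distance is the distance upstairs;
    -- so that translate is `x` itself.
    obtain ⟨n, hn⟩ := exists_dist_lt (r := pitch E / 2)
      (h.trans_lt (half_pos (pitch_pos (E := E))))
    have h1 := dist_orbit_eq_of_dist_lt hn
    rw [orbit_vadd, h] at h1
    rw [eq_of_dist_eq_zero h1.symm, orbit_vadd]

theorem continuous_orbit : Continuous (orbit : E → Orbits E) :=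
  (LipschitzWith.of_dist_le_mul (K := 1) fun x y => by
    rw [NNReal.coe_one, one_mul]; exact dist_orbit_le x y).continuous

theorem exists_orbit_eq_of_dist_lt {x : E} {y : Orbits E} {r : ℝ} (h : dist (orbit x) y < r) :
    ∃ z : E, dist x z < r ∧ orbit z = y := by
  obtain ⟨y, rfl⟩ := orbit_surjective y
  obtain ⟨n, hn⟩ := exists_dist_lt h
  exact ⟨n +ᵥ y, hn, orbit_vadd n y⟩

theorem isOpenMap_orbit : IsOpenMap (orbit : E → Orbits E) := by
  intro U hU
  rw [Metric.isOpen_iff]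
  rintro _ ⟨x, hx, rfl⟩
  obtain ⟨r, hr, hrU⟩ := Metric.isOpen_iff.1 hU x hx
  refine ⟨r, hr, fun y hy => ?_⟩
  obtain ⟨z, hz, rfl⟩ := exists_orbit_eq_of_dist_lt (Metric.mem_ball'.1 hy)
  exact ⟨z, hrU (Metric.mem_ball'.2 hz), rfl⟩

/-- A ball of radius half the pitch is disjoint from its non-trivial translates. -/
theorem isAddQuotientCoveringMap_orbit : IsAddQuotientCoveringMap (orbit : E → Orbits E) ℤ where
  toIsQuotientMap := isOpenMap_orbit.isQuotientMap continuous_orbit orbit_surjective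
  continuous_const_vadd n :=
    (Isometry.of_dist_eq (dist_vadd n) : Isometry fun x : E => n +ᵥ x).continuous
  apply_eq_iff_mem_orbit {x y} := orbit_eq_orbit_iff
  disjoint x := by
    refine ⟨Metric.ball x (pitch E / 2), Metric.ball_mem_nhds x (half_pos (pitch_pos (E := E))),
      fun n => ?_⟩
    rintro ⟨_, ⟨y, hy, rfl⟩, hy'⟩
    by_contra hn
    have h1 := pitch_le_dist hn y
    have h2 := dist_triangle_left y (n +ᵥ y) x
    rw [Metric.mem_ball'] at hy hy'
    dsimp only at hy'
    linarith

theorem isCoveringMap_orbit : IsCoveringMap (orbit : E → Orbits E) :=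
  isAddQuotientCoveringMap_orbit.isCoveringMap

/-- Small balls of the orbit space are CAT(0) if they have CN preimages. -/
theorem isCAT0_ball {N : Type*} [PseudoMetricSpace N] (f : N → E)
    (hf : ∀ x y, dist (f x) (f y) = dist x y) (hs : Function.Surjective f) (x : N) {r : ℝ}
    (hr : r ≤ pitch E / 4) {g : N → N → ℝ → N} (hg : IsCNOn (Metric.ball x r) g) :
    IsCAT0 (Metric.ball (orbit (f x)) r) := by
  classical
  have hlt : ∀ y ∈ Metric.ball x r, ∀ z ∈ Metric.ball x r, dist (f y) (f z) < pitch E / 2 := by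
    intro y hy z hz
    rw [hf]
    have := dist_triangle_right y z x
    rw [Metric.mem_ball] at hy hz
    linarith
  have hmem : ∀ y ∈ Metric.ball x r, orbit (f y) ∈ Metric.ball (orbit (f x)) r := fun y hy =>
    (dist_orbit_le _ _).trans_lt ((hf y x).trans_lt hy)
  rcases le_or_gt r 0 with hr0 | hr0
  · have : IsEmpty (Metric.ball (orbit (f x)) r) := by
      rw [Metric.ball_eq_empty.2 hr0]; infer_instance
    exact ⟨fun p => isEmptyElim p, fun p => isEmptyElim p⟩
  -- The map must be defined on all of `N`; its value outside the ball plays no role.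
  refine hg.isCAT0 (fun y => if h : y ∈ Metric.ball x r then ⟨orbit (f y), hmem y h⟩ else
    ⟨orbit (f x), Metric.mem_ball_self hr0⟩) ?_ ?_
  · rintro ⟨y, hy⟩
    obtain ⟨z, hz, rfl⟩ := exists_orbit_eq_of_dist_lt (Metric.mem_ball'.1 hy)
    obtain ⟨z, rfl⟩ := hs z
    rw [hf] at hz
    exact ⟨z, Metric.mem_ball'.2 hz, by rw [dif_pos (Metric.mem_ball'.2 hz)]⟩
  · intro y hy z hz
    rw [dif_pos hy, dif_pos hz, Subtype.dist_eq, dist_orbit_eq_of_dist_lt (hlt y hy z hz), hf]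

end ScrewSpace

/-! ### Doubles of metric spaces along families of points -/

/-- Two copies (sheets) of `P`, to be glued along the points `v i`. -/
structure Double {ι P : Type*} (v : ι → P) where
  sheet : ZMod 2
  pt : P

namespace Double

section Metric

variable {ι P : Type*} [Nonempty ι] [PseudoMetricSpace P] {v : ι → P}

/-- The length of the shortest path between points of distinct sheets. -/
noncomputable def bridge (v : ι → P) (z z' : P) : ℝ := ⨅ i, (dist z (v i) + dist (v i) z')

omit [Nonempty ι] in
theorem bridge_le (z z' : P) (i : ι) : bridge v z z' ≤ dist z (v i) + dist (v i) z' :=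
  ciInf_le ⟨0, by rintro _ ⟨i, rfl⟩; positivity⟩ i

theorem le_bridge {z z' : P} {r : ℝ} (h : ∀ i, r ≤ dist z (v i) + dist (v i) z') :
    r ≤ bridge v z z' := le_ciInf h

theorem bridge_nonneg (z z' : P) : 0 ≤ bridge v z z' := le_bridge fun i => by positivity

theorem dist_le_bridge (z z' : P) : dist z z' ≤ bridge v z z' :=
  le_bridge fun i => dist_triangle z (v i) z'

omit [Nonempty ι] in
theorem bridge_comm (z z' : P) : bridge v z z' = bridge v z' z := by
  unfold bridge
  congr 1
  ext i
  rw [add_comm, dist_comm, dist_comm z]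

theorem bridge_le_dist_add (z z' z'' : P) : bridge v z z'' ≤ dist z z' + bridge v z' z'' := by
  rw [← sub_le_iff_le_add']
  refine le_bridge fun i => ?_
  have := bridge_le (v := v) z z'' i
  have := dist_triangle z z' (v i)
  linarith

theorem zmod_two_eq {a b c : ZMod 2} (h : a ≠ b) (h' : b ≠ c) : a = c := by
  revert a b c; decide

/-- The two copies of `v i` are at distance 0, so the gluing takes place on passing to the
separation quotient. In the last case of the triangle inequality both steps change sheet, and since
there are only two sheets the ends share one. -/
noncomputable instance : PseudoMetricSpace (Double v) where
  dist x y := if x.sheet = y.sheet then dist x.pt y.pt else bridge v x.pt y.pt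
  dist_self x := by simp
  dist_comm x y := by simp only [eq_comm (a := x.sheet), dist_comm x.pt, bridge_comm x.pt]
  dist_triangle x y z := by
    by_cases h1 : x.sheet = y.sheet <;> by_cases h2 : y.sheet = z.sheet
    · simp only [h1, h2, if_true]
      exact dist_triangle _ _ _
    · simp only [h1, h2, if_true, if_false]
      exact bridge_le_dist_add _ _ _
    · simp only [← h2, h1, if_true, if_false]
      rw [bridge_comm, bridge_comm x.pt, add_comm, dist_comm]
      exact bridge_le_dist_add _ _ _
    · simp only [zmod_two_eq h1 h2, if_true, if_neg h2, if_neg fun h => h2 (Eq.symm h)]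
      exact (dist_triangle x.pt y.pt z.pt).trans
        (add_le_add (dist_le_bridge _ _) (dist_le_bridge _ _))

theorem dist_def (x y : Double v) :
    dist x y = if x.sheet = y.sheet then dist x.pt y.pt else bridge v x.pt y.pt := rfl

theorem dist_of_eq {x y : Double v} (h : x.sheet = y.sheet) : dist x y = dist x.pt y.pt := if_pos h

theorem dist_of_ne {x y : Double v} (h : x.sheet ≠ y.sheet) : dist x y = bridge v x.pt y.pt :=
  if_neg h

theorem dist_mk (k : ZMod 2) (z z' : P) : dist (⟨k, z⟩ : Double v) ⟨k, z'⟩ = dist z z' :=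
  dist_of_eq rfl

theorem dist_mk_left (x : Double v) (z : P) : dist ⟨x.sheet, z⟩ x = dist z x.pt := dist_of_eq rfl

theorem dist_pt_le (x y : Double v) : dist x.pt y.pt ≤ dist x y := by
  rw [dist_def]
  split_ifs
  exacts [le_rfl, dist_le_bridge _ _]

theorem dist_vertex (k l : ZMod 2) (i : ι) : dist (⟨k, v i⟩ : Double v) ⟨l, v i⟩ = 0 := by
  rw [dist_def]
  split_ifs
  · exact dist_self _
  · exact le_antisymm ((bridge_le _ _ i).trans_eq (by simp)) (bridge_nonneg _ _)

/-- Each of the two points is nearer to `v i` than to any other vertex, so the shortest crossing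
goes through `v i`. -/
theorem bridge_eq {i : ι} {r : ℝ} (hr : ∀ j, v j ≠ v i → 2 * r ≤ dist (v j) (v i)) {z z' : P}
    (hz : dist z (v i) < r) (hz' : dist z' (v i) < r) :
    bridge v z z' = dist z (v i) + dist z' (v i) := by
  rw [dist_comm z']
  refine le_antisymm (bridge_le z z' i) (le_bridge fun j => ?_)
  by_cases hj : v j = v i
  · rw [hj]
  · have h1 := hr j hj
    have h2 := dist_triangle_left (v j) (v i) z
    have h3 := dist_triangle_right (v j) (v i) z'
    rw [dist_comm z'] at hz'
    rw [dist_comm (v i)] at h3 hz'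
    rw [dist_comm (v i) z']
    linarith

end Metric

end Double

/-- The segment between two points of a convex set. -/
noncomputable def Convex.seg {E : Type*} [AddCommGroup E] [Module ℝ E] {C : Set E}
    (hC : Convex ℝ C) (z z' : C) (t : ℝ) : C :=
  ⟨AffineMap.lineMap (z : E) z' (projIcc (0 : ℝ) 1 zero_le_one t : ℝ),
    hC.lineMap_mem z.2 z'.2 (projIcc (0 : ℝ) 1 zero_le_one t).2⟩

namespace Convex

variable {E : Type*} [NormedAddCommGroup E] [InnerProductSpace ℝ E] {C : Set E} (hC : Convex ℝ C)
include hC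

theorem coe_seg {z z' : C} {t : ℝ} (ht : t ∈ Icc (0 : ℝ) 1) :
    (hC.seg z z' t : E) = AffineMap.lineMap (z : E) z' t := by
  simp only [seg, projIcc_of_mem zero_le_one ht]

theorem seg_zero (z z' : C) : hC.seg z z' 0 = z :=
  Subtype.ext (by rw [hC.coe_seg ⟨le_rfl, zero_le_one⟩, AffineMap.lineMap_apply_zero])

theorem seg_one (z z' : C) : hC.seg z z' 1 = z' :=
  Subtype.ext (by rw [hC.coe_seg ⟨zero_le_one, le_rfl⟩, AffineMap.lineMap_apply_one])

theorem dist_seg_seg {z z' : C} {s t : ℝ} (hs : s ∈ Icc (0 : ℝ) 1) (ht : t ∈ Icc (0 : ℝ) 1) :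
    dist (hC.seg z z' s) (hC.seg z z' t) = |s - t| * dist z z' := by
  rw [Subtype.dist_eq, hC.coe_seg hs, hC.coe_seg ht, dist_lineMap_lineMap, Real.dist_eq,
    Subtype.dist_eq]

theorem dist_sq_seg (p : C) {z z' : C} {t : ℝ} (ht : t ∈ Icc (0 : ℝ) 1) :
    dist p (hC.seg z z' t) ^ 2 =
      (1 - t) * dist p z ^ 2 + t * dist p z' ^ 2 - t * (1 - t) * dist z z' ^ 2 := by
  rw [Subtype.dist_eq, hC.coe_seg ht, dist_sq_lineMap]
  rfl

theorem dist_seg_left {z z' : C} {t : ℝ} (ht : t ∈ Icc (0 : ℝ) 1) :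
    dist (hC.seg z z' t) z = t * dist z z' := by
  have := hC.dist_seg_seg (z := z) (z' := z') ht ⟨le_rfl, zero_le_one⟩
  rwa [seg_zero, sub_zero, abs_of_nonneg ht.1] at this

theorem dist_seg_right {z z' : C} {t : ℝ} (ht : t ∈ Icc (0 : ℝ) 1) :
    dist (hC.seg z z' t) z' = (1 - t) * dist z z' := by
  have := hC.dist_seg_seg (z := z) (z' := z') ht ⟨zero_le_one, le_rfl⟩
  rwa [seg_one, abs_sub_comm, abs_of_nonneg (by linarith [ht.2])] at this

end Convex

/-- This compares CN bounds for a segment of length `a` and for its prolongation through a vertex to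
length `a + b`. Here `D` and `w` are the distances from a point to the start and to the vertex, and
`w + b` is the distance to the far end. The difference of the two sides is `t * b / a * (D ^ 2 - (w
- a) ^ 2)`, nonnegative by the triangle inequality. -/
theorem cn_of_concat {a b w D t : ℝ} (ha : 0 < a) (hb : 0 ≤ b) (ht : 0 ≤ t) (hD : |w - a| ≤ D) :
    (1 - t * (a + b) / a) * D ^ 2 + t * (a + b) / a * w ^ 2
      - t * (a + b) / a * (1 - t * (a + b) / a) * a ^ 2 ≤
    (1 - t) * D ^ 2 + t * (w + b) ^ 2 - t * (1 - t) * (a + b) ^ 2 := by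
  have h1 : (w - a) ^ 2 ≤ D ^ 2 := sq_le_sq' (by linarith [neg_abs_le (w - a)])
    (by linarith [le_abs_self (w - a)])
  have h2 : (1 - t) * D ^ 2 + t * (w + b) ^ 2 - t * (1 - t) * (a + b) ^ 2 -
      ((1 - t * (a + b) / a) * D ^ 2 + t * (a + b) / a * w ^ 2
      - t * (a + b) / a * (1 - t * (a + b) / a) * a ^ 2) =
      t * b / a * (D ^ 2 - (w - a) ^ 2) := by
    field_simp
    ring
  have h3 : 0 ≤ t * b / a * (D ^ 2 - (w - a) ^ 2) := mul_nonneg (by positivity) (by linarith)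
  linarith

/-! ### The CN inequality in a sheet and in the star of a vertex -/

namespace Double

variable {E : Type*} [NormedAddCommGroup E] [InnerProductSpace ℝ E] {C : Set E} (hC : Convex ℝ C)
  {ι : Type*} [Nonempty ι] {v : ι → C}

theorem isCNOn_sheet (k : ZMod 2) :
    IsCNOn {x : Double v | x.sheet = k} (fun q r t => ⟨k, hC.seg q.pt r.pt t⟩) where
  zero q hq r hr := by
    obtain rfl : q.sheet = k := hq
    rw [dist_mk_left, hC.seg_zero, dist_self]
  one q hq r hr := by
    obtain rfl : r.sheet = k := hr
    rw [dist_mk_left, hC.seg_one, dist_self]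
  mem q hq r hr t ht := rfl
  dist_eq q hq r hr s hs t ht := by
    have hq : q.sheet = k := hq
    have hr : r.sheet = k := hr
    rw [dist_mk, hC.dist_seg_seg hs ht, dist_of_eq (hq.trans hr.symm)]
  cn q hq r hr p hp t ht := by
    have hq : q.sheet = k := hq
    have hr : r.sheet = k := hr
    obtain rfl : p.sheet = k := hp
    rw [dist_comm p ⟨_, _⟩, dist_mk_left, dist_comm _ p.pt, hC.dist_sq_seg _ ht,
      dist_of_eq hq.symm, dist_of_eq hr.symm, dist_of_eq (hq.trans hr.symm)]

/-- The geodesics of the star of the vertex `c`. -/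
noncomputable def starGeodesic (c : C) (q r : Double v) (t : ℝ) : Double v :=
  if q.sheet = r.sheet then ⟨q.sheet, hC.seg q.pt r.pt t⟩
  else if t * (dist q.pt c + dist r.pt c) ≤ dist q.pt c then
    ⟨q.sheet, hC.seg q.pt c (t * (dist q.pt c + dist r.pt c) / dist q.pt c)⟩
  else ⟨r.sheet, hC.seg c r.pt ((t * (dist q.pt c + dist r.pt c) - dist q.pt c) / dist r.pt c)⟩

/-- Within `δ` of the vertex the space is two convex sets joined at one point, and the distance
between points of different sheets is the sum of their distances to it. The inequality is checked
according to the sheets of the two ends, of the test point and of the point on the geodesic. -/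
theorem isCNOn_star {i : ι} {δ : ℝ} (hδ : ∀ j, v j ≠ v i → 2 * δ ≤ dist (v j) (v i)) :
    IsCNOn {x : Double v | dist x.pt (v i) < δ} (starGeodesic hC (v i)) := by
  have hne : ∀ x ∈ {x : Double v | dist x.pt (v i) < δ}, ∀ y ∈ {x : Double v | dist x.pt (v i) < δ},
      x.sheet ≠ y.sheet → dist x y = dist x.pt (v i) + dist y.pt (v i) := fun x hx y hy h => by
    rw [dist_of_ne h, bridge_eq hδ hx hy]
  have near : ∀ q r : Double v, q.sheet ≠ r.sheet → ∀ t ∈ Icc (0 : ℝ) 1,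
      t * (dist q.pt (v i) + dist r.pt (v i)) ≤ dist q.pt (v i) →
      ∃ τ ∈ Icc (0 : ℝ) 1, τ * dist q.pt (v i) = t * (dist q.pt (v i) + dist r.pt (v i)) ∧
        (0 < dist q.pt (v i) →
          τ = t * (dist q.pt (v i) + dist r.pt (v i)) / dist q.pt (v i)) ∧
        starGeodesic hC (v i) q r t = ⟨q.sheet, hC.seg q.pt (v i) τ⟩ := by
    intro q r h t ht hle
    refine ⟨_, ⟨?_, ?_⟩, ?_, fun _ => rfl, ?_⟩
    · have := ht.1
      positivity
    · exact div_le_one_of_le₀ hle dist_nonneg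
    -- If `q` is at the vertex, division by zero gives the parameter 0; both sides vanish, since
    -- `hle` then bounds the right one by 0.
    · rcases eq_or_lt_of_le (dist_nonneg (x := q.pt) (y := v i)) with h0 | h0
      · rw [← h0] at hle ⊢
        have := mul_nonneg ht.1 (add_nonneg (le_refl (0 : ℝ)) (dist_nonneg (x := r.pt) (y := v i)))
        linarith
      · field_simp
    · rw [starGeodesic, if_neg h, if_pos hle]
  have far : ∀ q r : Double v, q.sheet ≠ r.sheet → ∀ t ∈ Icc (0 : ℝ) 1,
      ¬ t * (dist q.pt (v i) + dist r.pt (v i)) ≤ dist q.pt (v i) →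
      0 < dist r.pt (v i) ∧ ∃ τ ∈ Icc (0 : ℝ) 1,
        τ * dist r.pt (v i) = t * (dist q.pt (v i) + dist r.pt (v i)) - dist q.pt (v i) ∧
        1 - τ = (1 - t) * (dist r.pt (v i) + dist q.pt (v i)) / dist r.pt (v i) ∧
        starGeodesic hC (v i) q r t = ⟨r.sheet, hC.seg (v i) r.pt τ⟩ := by
    intro q r h t ht hle
    have hq := dist_nonneg (x := q.pt) (y := v i)
    have hr := dist_nonneg (x := r.pt) (y := v i)
    have h0 : 0 < dist r.pt (v i) := by
      by_contra h0
      have : dist r.pt (v i) = 0 := le_antisymm (not_lt.1 h0) hr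
      rw [this] at hle
      nlinarith [ht.2]
    refine ⟨h0, (t * (dist q.pt (v i) + dist r.pt (v i)) - dist q.pt (v i)) / dist r.pt (v i),
      ⟨?_, ?_⟩, ?_, ?_, ?_⟩
    · exact div_nonneg (by linarith) hr
    · rw [div_le_one h0]
      nlinarith [ht.2]
    · field_simp
    · field_simp
      ring
    · rw [starGeodesic, if_neg h, if_neg hle]
  have dvr : ∀ r : Double v, ∀ τ ∈ Icc (0 : ℝ) 1,
      dist (hC.seg (v i) r.pt τ) (v i) = τ * dist r.pt (v i) := fun r τ hτ => by
    rw [hC.dist_seg_left hτ, dist_comm r.pt]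
  have mem : ∀ q ∈ {x : Double v | dist x.pt (v i) < δ}, ∀ r ∈ {x : Double v | dist x.pt (v i) < δ},
      ∀ t ∈ Icc (0 : ℝ) 1, starGeodesic hC (v i) q r t ∈ {x : Double v | dist x.pt (v i) < δ} := by
    intro q hq r hr t ht
    by_cases h : q.sheet = r.sheet
    · rw [starGeodesic, if_pos h]
      have h1 := ((Double.isCNOn_sheet (v := v) hC q.sheet).inter_ball (x := ⟨q.sheet, v i⟩) rfl
        δ).mem q ⟨rfl, ?_⟩ r ⟨h.symm, ?_⟩ t ht
      · have h2 := h1.2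
        rwa [Metric.mem_ball, dist_mk] at h2
      · rw [Metric.mem_ball, dist_comm, dist_mk_left, dist_comm]; exact hq
      · rw [Metric.mem_ball, h, dist_comm, dist_mk_left, dist_comm]; exact hr
    · have hq0 := dist_nonneg (x := q.pt) (y := v i)
      have hr0 := dist_nonneg (x := r.pt) (y := v i)
      have hq : dist q.pt (v i) < δ := hq
      have hr : dist r.pt (v i) < δ := hr
      by_cases hle : t * (dist q.pt (v i) + dist r.pt (v i)) ≤ dist q.pt (v i)
      · obtain ⟨τ, hτ, h1, -, h3⟩ := near q r h t ht hle
        rw [h3, mem_ofPred_eq, hC.dist_seg_right hτ]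
        nlinarith [hτ.1]
      · obtain ⟨-, τ, hτ, h1, -, h3⟩ := far q r h t ht hle
        rw [h3, mem_ofPred_eq, dvr r τ hτ]
        nlinarith [hτ.2]
  refine ⟨fun q hq r hr => ?_, fun q hq r hr => ?_, mem,
    fun q hq r hr s hs t ht => ?_, fun q hq r hr p hp t ht => ?_⟩
  · by_cases h : q.sheet = r.sheet
    · rw [starGeodesic, if_pos h, dist_mk_left, hC.seg_zero, dist_self]
    · obtain ⟨τ, hτ, h1, -, h3⟩ := near q r h 0 ⟨le_rfl, zero_le_one⟩ (by simp)
      rw [h3, dist_mk_left, hC.dist_seg_left hτ, h1, zero_mul]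
  · by_cases h : q.sheet = r.sheet
    · rw [starGeodesic, if_pos h, h, dist_mk_left, hC.seg_one, dist_self]
    · by_cases hle : 1 * (dist q.pt (v i) + dist r.pt (v i)) ≤ dist q.pt (v i)
      · obtain ⟨τ, hτ, h1, -, h3⟩ := near q r h 1 ⟨zero_le_one, le_rfl⟩ hle
        have hr0 : dist r.pt (v i) = 0 := le_antisymm (by linarith) dist_nonneg
        have hg : dist (starGeodesic hC (v i) q r 1).pt (v i) = 0 := by
          rw [h3, hC.dist_seg_right hτ]
          linarith
        rw [hne _ (hg.trans_lt (dist_nonneg.trans_lt hr)) r hr (by rw [h3]; exact h), hg, hr0,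
          add_zero]
      · obtain ⟨-, τ, hτ, h1, -, h3⟩ := far q r h 1 ⟨zero_le_one, le_rfl⟩ hle
        rw [h3, dist_mk_left, hC.dist_seg_right hτ, dist_comm (v i)]
        linarith
  · by_cases h : q.sheet = r.sheet
    · rw [starGeodesic, starGeodesic, if_pos h, if_pos h, dist_mk, hC.dist_seg_seg hs ht,
        dist_of_eq h]
    · rw [hne q hq r hr h]
      have cross : ∀ s ∈ Icc (0 : ℝ) 1, ∀ t ∈ Icc (0 : ℝ) 1,
          s * (dist q.pt (v i) + dist r.pt (v i)) ≤ dist q.pt (v i) →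
          ¬ t * (dist q.pt (v i) + dist r.pt (v i)) ≤ dist q.pt (v i) →
          dist (starGeodesic hC (v i) q r s) (starGeodesic hC (v i) q r t) =
            |s - t| * (dist q.pt (v i) + dist r.pt (v i)) := by
        intro s hs t ht hles hlet
        obtain ⟨σ, hσ, h1, -, h3⟩ := near q r h s hs hles
        obtain ⟨-, τ, hτ, h1', -, h3'⟩ := far q r h t ht hlet
        have hst : s ≤ t := by
          by_contra hst
          have := add_nonneg (dist_nonneg (x := q.pt) (y := v i)) (dist_nonneg (x := r.pt) (y := v i))
          nlinarith
        rw [hne _ (mem q hq r hr s hs) _ (mem q hq r hr t ht) (by rw [h3, h3']; exact h), h3, h3',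
          hC.dist_seg_right hσ, dvr r τ hτ, abs_sub_comm, abs_of_nonneg (sub_nonneg.2 hst)]
        linarith
      by_cases hles : s * (dist q.pt (v i) + dist r.pt (v i)) ≤ dist q.pt (v i) <;>
      by_cases hlet : t * (dist q.pt (v i) + dist r.pt (v i)) ≤ dist q.pt (v i)
      · obtain ⟨σ, hσ, h1, -, h3⟩ := near q r h s hs hles
        obtain ⟨τ, hτ, h1', -, h3'⟩ := near q r h t ht hlet
        rw [h3, h3', dist_mk, hC.dist_seg_seg hσ hτ, ← abs_of_nonneg (dist_nonneg (x := q.pt)),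
          ← abs_mul, sub_mul, h1, h1', ← sub_mul, abs_mul,
          abs_of_nonneg (add_nonneg dist_nonneg dist_nonneg),
          abs_of_nonneg (dist_nonneg (x := q.pt))]
      · exact cross s hs t ht hles hlet
      · rw [dist_comm, cross t ht s hs hlet hles, abs_sub_comm]
      · obtain ⟨-, σ, hσ, h1, -, h3⟩ := far q r h s hs hles
        obtain ⟨-, τ, hτ, h1', -, h3'⟩ := far q r h t ht hlet
        rw [h3, h3', dist_mk, hC.dist_seg_seg hσ hτ, dist_comm (v i),
          ← abs_of_nonneg (dist_nonneg (x := r.pt)),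
          ← abs_mul, sub_mul, h1, h1', sub_sub_sub_cancel_right, ← sub_mul, abs_mul,
          abs_of_nonneg (dist_nonneg (x := r.pt)),
          abs_of_nonneg (add_nonneg dist_nonneg dist_nonneg)]
  · by_cases h : q.sheet = r.sheet
    · rw [starGeodesic, if_pos h]
      by_cases hpq : p.sheet = q.sheet
      · exact (Double.isCNOn_sheet (v := v) hC q.sheet).cn q rfl r h.symm p hpq t ht
      · have hm := mem q hq r hr t ht
        rw [starGeodesic, if_pos h] at hm
        rw [hne p hp _ hm hpq, hne p hp q hq hpq, hne p hp r hr (h ▸ hpq), dist_of_eq h]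
        have h1 := hC.dist_sq_seg (v i) (z := q.pt) (z' := r.pt) ht
        rw [dist_comm, dist_comm _ q.pt, dist_comm _ r.pt] at h1
        -- The test point is in the other sheet, so its distance to the geodesic is a sum. Squaring
        -- produces a term linear in the distance to the vertex, controlled by the convexity of that
        -- distance.
        have h2 : dist (hC.seg q.pt r.pt t) (v i) ≤
            (1 - t) * dist q.pt (v i) + t * dist r.pt (v i) := by
          have ht0 := ht.1
          have ht1 : 0 ≤ 1 - t := by linarith [ht.2]
          refine le_of_sq_le_sq ?_ (by positivity)
          rw [h1]
          have h4 := dist_triangle_right q.pt r.pt (v i)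
          have h3 := dist_triangle_left q.pt (v i) r.pt
          have h5 := dist_triangle_left r.pt (v i) q.pt
          rw [dist_comm r.pt q.pt] at h3
          have h6 : (dist q.pt (v i) - dist r.pt (v i)) ^ 2 ≤ dist q.pt r.pt ^ 2 :=
            sq_le_sq' (by linarith) (by linarith)
          nlinarith [mul_le_mul_of_nonneg_left h6 (mul_nonneg ht0 ht1)]
        have hw := dist_nonneg (x := p.pt) (y := v i)
        nlinarith [mul_le_mul_of_nonneg_left h2 hw]
    · rw [hne q hq r hr h]
      have tri : ∀ x : Double v, |dist p.pt (v i) - dist x.pt (v i)| ≤ dist p.pt x.pt := fun x =>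
        abs_dist_sub_le p.pt x.pt (v i)
      have hw := dist_nonneg (x := p.pt) (y := v i)
      have hm := mem q hq r hr t ht
      have ht0 := ht.1
      have ht1 : 0 ≤ 1 - t := by linarith [ht.2]
      by_cases hle : t * (dist q.pt (v i) + dist r.pt (v i)) ≤ dist q.pt (v i)
      · obtain ⟨τ, hτ, h1, h2, h3⟩ := near q r h t ht hle
        by_cases hpq : p.sheet = q.sheet
        · have hpr : p.sheet ≠ r.sheet := hpq ▸ h
          rw [h3, dist_of_eq (by exact hpq), dist_of_eq hpq, hne p hp r hr hpr,
            hC.dist_sq_seg _ hτ]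
          rcases eq_or_lt_of_le (dist_nonneg (x := q.pt) (y := v i)) with h0 | h0
          · have hqv : dist p.pt q.pt = dist p.pt (v i) := by
              have h4 := dist_triangle p.pt q.pt (v i)
              have h5 := tri q
              rw [← h0, sub_zero, abs_of_nonneg hw] at h5
              have h6 := dist_triangle_right p.pt q.pt (v i)
              linarith
            rw [← h0, zero_add, mul_zero] at h1
            rw [hqv, ← h0]
            rcases mul_eq_zero.1 h1.symm with h7 | h7
            · rw [h7]; ring_nf; rfl
            · rw [h7]; ring_nf; rfl
          · rw [h2 h0]
            exact cn_of_concat h0 dist_nonneg ht0 (tri q)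
        · have hpr : p.sheet = r.sheet := Double.zmod_two_eq hpq h
          rw [hne p hp _ hm (by rw [h3]; exact hpq), hne p hp q hq hpq, dist_of_eq hpr, h3,
            hC.dist_seg_right hτ]
          -- The point on the geodesic and the test point are separated by the vertex, as on a line.
          -- Equality would hold if `p` and `r` were aligned with the vertex on the same side of it;
          -- in general the triangle inequality only increases the right-hand side.
          have h4 := mul_le_mul_of_nonneg_left (sq_le_sq.2 ((tri r).trans (le_abs_self _))) ht0
          have h5 : (1 - τ) * dist q.pt (v i) =
            dist q.pt (v i) - t * (dist q.pt (v i) + dist r.pt (v i)) := by linarith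
          rw [h5]
          linarith
      · obtain ⟨h0, τ, hτ, h1, h2, h3⟩ := far q r h t ht hle
        by_cases hpr : p.sheet = r.sheet
        · have hpq : p.sheet ≠ q.sheet := fun h' => h (h'.symm.trans hpr)
          rw [h3, dist_of_eq (by exact hpr), dist_of_eq hpr, hne p hp q hq hpq,
            hC.dist_sq_seg _ hτ, dist_comm (v i)]
          have h4 := cn_of_concat h0 (dist_nonneg (x := q.pt) (y := v i)) ht1 (tri r)
          rw [← h2] at h4
          linarith
        · have hpq : p.sheet = q.sheet := Double.zmod_two_eq hpr (Ne.symm h)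
          rw [hne p hp _ hm (by rw [h3]; exact hpr), hne p hp r hr hpr, dist_of_eq hpq, h3, dvr r τ hτ]
          have h4 := mul_le_mul_of_nonneg_left (sq_le_sq.2 ((tri q).trans (le_abs_self _))) ht1
          rw [h1]
          linarith

end Double

/-! ### Regular polygons -/

namespace RegularPolygon

variable (m : ℕ)

/-- The primitive root of unity `exp (2πi / m)`. -/
noncomputable def root : ℂ := Complex.exp (2 * Real.pi * Complex.I / m)

/-- The radius of the regular `m`-gon with sides of length `24 / 25`. -/
noncomputable def radius : ℝ := 24 / 25 / ‖root m - 1‖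

/-- The vertices of the regular `m`-gon with sides of length `24 / 25`, centered at the origin. -/
noncomputable def vertex (i : ℤ) : ℂ := radius m * root m ^ i

/-- The regular `m`-gon with sides of length `24 / 25`. -/
def polygon : Set ℂ := convexHull ℝ (range (vertex m))

theorem convex_polygon : Convex ℝ (polygon m) := convex_convexHull ℝ _

theorem vertex_mem (i : ℤ) : vertex m i ∈ polygon m := subset_convexHull ℝ _ ⟨i, rfl⟩

/-- The vertices, as points of the polygon. -/
noncomputable def corner (i : ℤ) : polygon m := ⟨vertex m i, vertex_mem m i⟩

theorem norm_root : ‖root m‖ = 1 := by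
  have : root m = Complex.exp ((2 * Real.pi / m : ℝ) * Complex.I) := by
    rw [root]; congr 1; push_cast; ring
  rw [this, Complex.norm_exp_ofReal_mul_I]

theorem root_ne_zero : root m ≠ 0 := Complex.exp_ne_zero _

variable {m}

theorem root_pow_mul_vertex (n i : ℤ) : root m ^ n * vertex m i = vertex m (n + i) := by
  rw [vertex, vertex, zpow_add₀ (root_ne_zero m)]
  ring

theorem root_pow_mul_mem (n : ℤ) {z : ℂ} (hz : z ∈ polygon m) : root m ^ n * z ∈ polygon m := by
  have h : (LinearMap.mulLeft ℝ (root m ^ n)) '' polygon m ⊆ polygon m := by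
    rw [polygon, LinearMap.image_convexHull]
    refine convexHull_mono ?_
    rintro _ ⟨_, ⟨i, rfl⟩, rfl⟩
    exact ⟨n + i, (root_pow_mul_vertex n i).symm⟩
  exact h ⟨z, hz, rfl⟩

/-- The rotation of the polygon through `n` steps. -/
noncomputable def rotate (n : ℤ) (z : polygon m) : polygon m :=
  ⟨root m ^ n * z, root_pow_mul_mem n z.2⟩

theorem rotate_corner (n i : ℤ) : rotate n (corner m i) = corner m (n + i) :=
  Subtype.ext (root_pow_mul_vertex n i)

theorem dist_rotate (n : ℤ) (z z' : polygon m) : dist (rotate n z) (rotate n z') = dist z z' := by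
  rw [Subtype.dist_eq, Subtype.dist_eq, Complex.dist_eq, Complex.dist_eq]
  simp only [rotate]
  rw [← mul_sub, norm_mul, norm_zpow, norm_root, one_zpow, one_mul]

theorem rotate_zero (z : polygon m) : rotate 0 z = z := Subtype.ext (by simp [rotate])

theorem rotate_rotate (n k : ℤ) (z : polygon m) : rotate n (rotate k z) = rotate (n + k) z :=
  Subtype.ext (by simp [rotate, zpow_add₀ (root_ne_zero m), mul_assoc])

theorem rotate_neg_rotate (n : ℤ) (z : polygon m) : rotate (-n) (rotate n z) = z := by
  rw [rotate_rotate, neg_add_cancel, rotate_zero]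

variable [hm : Fact (5 ≤ m)]

theorem isPrimitiveRoot_root : IsPrimitiveRoot (root m) m :=
  Complex.isPrimitiveRoot_exp m (by have := hm.out; omega)

theorem norm_root_sub_one_pos : 0 < ‖root m - 1‖ :=
  norm_pos_iff.2 (sub_ne_zero.2 (isPrimitiveRoot_root.ne_one (by have := hm.out; omega)))

theorem radius_pos : 0 < radius m := div_pos (by norm_num) norm_root_sub_one_pos

theorem norm_vertex (i : ℤ) : ‖vertex m i‖ = radius m := by
  rw [vertex, norm_mul, norm_zpow, norm_root, one_zpow, mul_one, Complex.norm_real,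
    Real.norm_of_nonneg radius_pos.le]

theorem vertex_eq_iff {i j : ℤ} : vertex m i = vertex m j ↔ (m : ℤ) ∣ i - j := by
  rw [← isPrimitiveRoot_root.zpow_eq_one_iff_dvd, zpow_sub₀ (root_ne_zero m),
    div_eq_one_iff_eq (zpow_ne_zero _ (root_ne_zero m)), vertex, vertex]
  exact mul_right_inj' (by exact_mod_cast radius_pos.ne')

theorem corner_eq_iff {i j : ℤ} : corner m i = corner m j ↔ (m : ℤ) ∣ i - j :=
  Subtype.ext_iff.trans vertex_eq_iff

theorem corner_add_m (i : ℤ) : corner m (i + m) = corner m i :=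
  corner_eq_iff.2 ⟨1, by ring⟩

theorem corner_emod (i : ℤ) : corner m (i % m) = corner m i :=
  corner_eq_iff.2 ⟨-(i / m), by rw [Int.emod_def]; ring⟩

theorem dist_corner_succ (i : ℤ) : dist (corner m i) (corner m (i + 1)) = 24 / 25 := by
  rw [Subtype.dist_eq, dist_comm, Complex.dist_eq]
  simp only [corner, vertex]
  rw [zpow_add_one₀ (root_ne_zero m), ← mul_sub, ← mul_sub_one, norm_mul, norm_mul, norm_zpow,
    norm_root, one_zpow, one_mul, Complex.norm_real, Real.norm_of_nonneg radius_pos.le, radius]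
  exact div_mul_cancel₀ _ norm_root_sub_one_pos.ne'

theorem finite_range_corner : (range (corner m)).Finite := by
  have : range (corner m) ⊆ corner m '' (Icc 0 (m : ℤ)) := by
    rintro _ ⟨i, rfl⟩
    have h : (0 : ℤ) < m := by have := hm.out; omega
    exact ⟨i % m, ⟨Int.emod_nonneg _ h.ne', (Int.emod_lt_of_pos _ h).le⟩, corner_emod i⟩
  exact ((finite_Icc _ _).image _).subset this

theorem finite_range_vertex : (range (vertex m)).Finite := by
  have : range (vertex m) = Subtype.val '' range (corner m) := by
    rw [← range_comp]; rfl
  rw [this]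
  exact finite_range_corner.image _

theorem isCompact_polygon : IsCompact (polygon m) := finite_range_vertex.isCompact_convexHull (𝕜 := ℝ)

instance : CompactSpace (polygon m) := isCompact_iff_compactSpace.1 isCompact_polygon

/-- A point which is not a vertex has positive distance to the vertices. -/
theorem exists_le_dist_corner (z : polygon m) :
    ∃ ε > 0, ∀ i, corner m i ≠ z → ε ≤ dist z (corner m i) := by
  have hf : (range (corner m) \ {z}).Finite := finite_range_corner.sdiff
  have hz : z ∈ (range (corner m) \ {z})ᶜ := fun h => h.2 rfl
  obtain ⟨ε, hε, h⟩ := Metric.isOpen_iff.1 hf.isClosed.isOpen_compl z hz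
  refine ⟨ε, hε, fun i hi => ?_⟩
  by_contra hlt
  exact h (Metric.mem_ball'.2 (not_le.1 hlt)) ⟨⟨i, rfl⟩, hi⟩

/-- Rotations act transitively on the vertices, so the bound at one vertex holds at all of them. -/
theorem exists_separation : ∃ δ > 0, ∀ i j, corner m j ≠ corner m i →
    2 * δ ≤ dist (corner m j) (corner m i) := by
  obtain ⟨ε, hε, h⟩ := exists_le_dist_corner (corner m 0)
  refine ⟨ε / 2, half_pos hε, fun i j hij => ?_⟩
  rw [mul_div_cancel₀ _ two_ne_zero, ← dist_rotate (-i), rotate_corner, rotate_corner,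
    neg_add_cancel, dist_comm]
  refine h _ fun h' => hij ?_
  rw [corner_eq_iff] at h' ⊢
  simpa [sub_eq_neg_add] using h'

theorem norm_le_radius {z : ℂ} (hz : z ∈ polygon m) : ‖z‖ ≤ radius m := by
  have : polygon m ⊆ Metric.closedBall 0 (radius m) := by
    refine convexHull_min ?_ (convex_closedBall 0 _)
    rintro _ ⟨i, rfl⟩
    rw [mem_closedBall_zero_iff, norm_vertex]
  exact mem_closedBall_zero_iff.1 (this hz)

/-- The vertices are extreme points. -/
theorem eq_of_lineMap_eq_corner {z z' : polygon m} {t : ℝ} (ht : t ∈ Ioo (0 : ℝ) 1) {i : ℤ}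
    (h : (AffineMap.lineMap (z : ℂ) z' t : ℂ) = vertex m i) : z = corner m i ∧ z' = corner m i := by
  -- The vertices lie on the circumscribed circle; by strict convexity of the norm a proper convex
  -- combination of distinct points of the disc lies strictly inside.
  have key : (z : ℂ) = z' := by
    by_contra hne
    have h1 := norm_combo_lt_of_ne (norm_le_radius z.2) (norm_le_radius z'.2) hne
      (sub_pos.2 ht.2) ht.1 (by ring)
    rw [AffineMap.lineMap_apply_module] at h
    rw [h, norm_vertex] at h1
    exact h1.false
  rw [key, AffineMap.lineMap_same_apply] at h
  exact ⟨Subtype.ext (key.trans h), Subtype.ext h⟩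

omit hm in
theorem re_root : (root m).re = Real.cos (2 * Real.pi / m) := by
  have : root m = Complex.exp ((2 * Real.pi / m : ℝ) * Complex.I) := by
    rw [root]; congr 1; push_cast; ring
  rw [this, Complex.exp_ofReal_mul_I_re]

/-- The interior angle of the polygon. -/
theorem inner_sides (i : ℤ) :
    inner ℝ (vertex m (i + 1) - vertex m i) (vertex m (i - 1) - vertex m i) =
      -((24 / 25) ^ 2 * Real.cos (2 * Real.pi / m)) := by
  have h0 := root_ne_zero m
  have hn : ‖root m‖ = 1 := norm_root m
  have hs := dist_corner_succ (m := m) i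
  rw [Subtype.dist_eq, dist_comm, Complex.dist_eq] at hs
  change ‖vertex m (i + 1) - vertex m i‖ = _ at hs
  -- Consecutive sides are obtained from each other by the rotation through one step, so the inner
  -- product reduces to the real part of the root of unity.
  have h1 : vertex m (i - 1) - vertex m i = -(root m)⁻¹ * (vertex m (i + 1) - vertex m i) := by
    simp only [vertex, zpow_add_one₀ h0, zpow_sub_one₀ h0]
    field_simp
    ring
  rw [h1, Complex.inner, ← re_root, ← hs]
  have h2 : (root m)⁻¹ = (starRingEnd ℂ) (root m) := by
    rw [Complex.inv_def, Complex.normSq_eq_norm_sq, hn]; simp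
  rw [h2]
  generalize vertex m (i + 1) - vertex m i = w
  rw [← Complex.normSq_eq_norm_sq, Complex.normSq_apply]
  simp
  ring

end RegularPolygon

/-! ### The complex -/

namespace RegularPolygon

variable {m : ℕ}

/-- Two copies of the polygon, glued along the vertices, as a pseudometric space. -/
abbrev DoublePolygon (m : ℕ) := Double (corner m)

/-- The product of the two glued polygons and of a line, as a pseudometric space. -/
abbrev PreTower (m : ℕ) := WithLp 2 (DoublePolygon m × ℝ)

/-- The product of the two glued polygons and of a line. -/
abbrev Tower (m : ℕ) := SeparationQuotient (PreTower m)

/-- The point of height `t` over the point `z` of the sheet `k`. -/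
noncomputable def pt (k : ZMod 2) (z : polygon m) (t : ℝ) : Tower m :=
  SeparationQuotient.mk (WithLp.toLp 2 (⟨k, z⟩, t))

theorem exists_pt (x : Tower m) : ∃ k z t, x = pt k z t := by
  obtain ⟨x, rfl⟩ := SeparationQuotient.surjective_mk x
  exact ⟨x.fst.sheet, x.fst.pt, x.snd, rfl⟩

theorem dist_pt (k k' : ZMod 2) (z z' : polygon m) (t t' : ℝ) :
    dist (pt k z t) (pt k' z' t') =
      √(dist (⟨k, z⟩ : DoublePolygon m) ⟨k', z'⟩ ^ 2 + (t - t') ^ 2) := by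
  rw [pt, pt, SeparationQuotient.dist_mk, dist_eq_sqrt_prod]
  simp [Real.dist_eq, sq_abs]

theorem dist_pt_same (k : ZMod 2) (z z' : polygon m) (t t' : ℝ) :
    dist (pt k z t) (pt k z' t') = √(dist z z' ^ 2 + (t - t') ^ 2) := by
  rw [dist_pt, Double.dist_mk]

theorem dist_pt_ne {k k' : ZMod 2} (h : k ≠ k') (z z' : polygon m) (t t' : ℝ) :
    dist (pt k z t) (pt k' z' t') =
      √(Double.bridge (corner m) z z' ^ 2 + (t - t') ^ 2) := by
  rw [dist_pt, Double.dist_of_ne (by exact h)]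

theorem dist_pt_le_dist (k k' : ZMod 2) (z z' : polygon m) (t t' : ℝ) :
    dist z z' ≤ dist (pt k z t) (pt k' z' t') := by
  rw [dist_pt]
  refine Real.le_sqrt_of_sq_le ?_
  have h := Double.dist_pt_le (⟨k, z⟩ : DoublePolygon m) ⟨k', z'⟩
  have := pow_le_pow_left₀ dist_nonneg h 2
  have := sq_nonneg (t - t')
  dsimp only at *
  linarith

theorem abs_sub_le_dist_pt (k k' : ZMod 2) (z z' : polygon m) (t t' : ℝ) :
    |t - t'| ≤ dist (pt k z t) (pt k' z' t') := by
  rw [dist_pt]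
  refine Real.le_sqrt_of_sq_le ?_
  rw [sq_abs]
  exact le_add_of_nonneg_left (sq_nonneg _)

theorem pt_corner (k k' : ZMod 2) (i : ℤ) (t : ℝ) :
    pt k (corner m i) t = pt k' (corner m i) t := by
  rw [← dist_eq_zero, dist_pt, Double.dist_vertex]
  simp

/-- The screw motion on the pseudometric space. -/
noncomputable def screw (n : ℤ) (x : PreTower m) : PreTower m :=
  WithLp.toLp 2 (⟨x.fst.sheet + n, rotate n x.fst.pt⟩, x.snd + n * (7 / 25))

theorem bridge_rotate (n : ℤ) (z z' : polygon m) :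
    Double.bridge (corner m) (rotate n z) (rotate n z') = Double.bridge (corner m) z z' := by
  refine Equiv.iInf_congr (Equiv.addLeft (-n)) fun i => ?_
  rw [Equiv.coe_addLeft, ← dist_rotate n z, ← dist_rotate n _ z', rotate_corner,
    add_neg_cancel_left]

theorem dist_screw (n : ℤ) (x y : PreTower m) : dist (screw n x) (screw n y) = dist x y := by
  rw [dist_eq_sqrt_prod, dist_eq_sqrt_prod]
  simp only [screw, WithLp.toLp_fst, WithLp.toLp_snd, dist_add_right, Double.dist_def, dist_rotate,
    bridge_rotate, add_left_inj]

/-- The generator carries the lower end of a diagonal of a side face to its upper end, so that the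
diagonals become loops. Exchanging the sheets at each step is what will make the generators
alternate along a staircase. -/
noncomputable instance : ScrewSpace (Tower m) where
  vadd n := SeparationQuotient.lift (SeparationQuotient.mk ∘ screw n) fun _ _ h =>
    SeparationQuotient.mk_eq_mk.2 (h.map (Isometry.of_dist_eq (dist_screw n)).continuous)
  zero_vadd x := by
    obtain ⟨x, rfl⟩ := SeparationQuotient.surjective_mk x
    change SeparationQuotient.mk (screw 0 x) = _
    have : screw 0 x = x := by
      simp only [screw, rotate_zero, Int.cast_zero, add_zero, zero_mul]
      rfl
    rw [this]
  add_vadd n k x := by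
    obtain ⟨x, rfl⟩ := SeparationQuotient.surjective_mk x
    change SeparationQuotient.mk (screw (n + k) x) = SeparationQuotient.mk (screw n (screw k x))
    have : screw (n + k) x = screw n (screw k x) := by
      simp only [screw, rotate_rotate, WithLp.toLp_fst, WithLp.toLp_snd, Int.cast_add, add_mul,
        add_assoc, add_comm (n : ZMod 2), add_comm (n * (7 / 25) : ℝ)]
    rw [this]
  dist_vadd n x y := by
    obtain ⟨x, rfl⟩ := SeparationQuotient.surjective_mk x
    obtain ⟨y, rfl⟩ := SeparationQuotient.surjective_mk y
    exact dist_screw n x y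
  height := SeparationQuotient.lift (fun x => x.snd) fun x y h =>
    dist_le_zero.1 (by
      have := Metric.inseparable_iff.1 h
      rw [dist_eq_sqrt_prod, Real.sqrt_eq_zero (by positivity)] at this
      nlinarith [sq_nonneg (dist x.fst y.fst), sq_nonneg (dist x.snd y.snd)])
  pitch := 7 / 25
  pitch_pos := by norm_num
  abs_height_sub_le x y := by
    obtain ⟨x, rfl⟩ := SeparationQuotient.surjective_mk x
    obtain ⟨y, rfl⟩ := SeparationQuotient.surjective_mk y
    exact abs_sub_le_dist_pt x.fst.sheet y.fst.sheet x.fst.pt y.fst.pt x.snd y.snd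
  height_vadd n x := by
    obtain ⟨x, rfl⟩ := SeparationQuotient.surjective_mk x
    rfl

theorem pitch_eq : ScrewSpace.pitch (Tower m) = 7 / 25 := rfl

theorem vadd_pt (n : ℤ) (k : ZMod 2) (z : polygon m) (t : ℝ) :
    n +ᵥ pt k z t = pt (k + n) (rotate n z) (t + n * (7 / 25)) := rfl

/-- The three-dimensional complex with fundamental group the dihedral Artin group. -/
abbrev ArtinComplex (m : ℕ) := ScrewSpace.Orbits (Tower m)

/-- The image of the point `pt k z t` in the quotient. -/
noncomputable def cpt (k : ZMod 2) (z : polygon m) (t : ℝ) : ArtinComplex m :=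
  ScrewSpace.orbit (pt k z t)

theorem exists_cpt (x : ArtinComplex m) : ∃ k z t, x = cpt k z t := by
  obtain ⟨x, rfl⟩ := ScrewSpace.orbit_surjective x
  obtain ⟨k, z, t, rfl⟩ := exists_pt x
  exact ⟨k, z, t, rfl⟩

theorem cpt_screw (n : ℤ) (k : ZMod 2) (z : polygon m) (t : ℝ) :
    cpt (k + n) (rotate n z) (t + n * (7 / 25)) = cpt k z t := by
  rw [cpt, ← vadd_pt, ScrewSpace.orbit_vadd, cpt]

theorem cpt_corner (k k' : ZMod 2) (i : ℤ) (t : ℝ) :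
    cpt k (corner m i) t = cpt k' (corner m i) t := by
  rw [cpt, pt_corner k k', cpt]

theorem cpt_corner_add (n : ℤ) (k k' : ZMod 2) (i : ℤ) (t : ℝ) :
    cpt k (corner m (i + n)) (t + n * (7 / 25)) = cpt k' (corner m i) t := by
  rw [cpt_corner _ (k' + n), add_comm i, ← rotate_corner, cpt_screw]

theorem continuous_pt (k : ZMod 2) : Continuous fun x : polygon m × ℝ => pt k x.1 x.2 := by
  refine SeparationQuotient.continuous_mk.comp ?_
  refine (WithLp.prod_continuous_toLp 2 _ _).comp (Continuous.prodMk ?_ continuous_snd)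
  exact (Isometry.of_dist_eq fun z z' => Double.dist_mk k z z' :
    Isometry fun z : polygon m => (⟨k, z⟩ : DoublePolygon m)).continuous.comp continuous_fst

theorem continuous_cpt (k : ZMod 2) : Continuous fun x : polygon m × ℝ => cpt k x.1 x.2 :=
  ScrewSpace.continuous_orbit.comp (continuous_pt k)

/-! ### Identifications, the local CAT(0) property and compactness -/

section

variable [hm : Fact (5 ≤ m)]

theorem pt_eq_pt_iff {k k' : ZMod 2} {z z' : polygon m} {t t' : ℝ} :
    pt k z t = pt k' z' t' ↔ t = t' ∧ z = z' ∧ (k = k' ∨ ∃ i, z = corner m i) := by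
  constructor
  · intro h
    have h1 := dist_eq_zero.2 h
    have h2 := dist_pt_le_dist k k' z z' t t'
    have h3 := abs_sub_le_dist_pt k k' z z' t t'
    rw [h1] at h2 h3
    have ht : t = t' := sub_eq_zero.1 (abs_nonpos_iff.1 h3)
    have hz : z = z' := dist_le_zero.1 h2
    refine ⟨ht, hz, ?_⟩
    by_contra! h4
    obtain ⟨ε, hε, h5⟩ := exists_le_dist_corner z
    rw [dist_pt_ne h4.1, Real.sqrt_eq_zero (by positivity)] at h1
    have h6 : ε ≤ Double.bridge (corner m) z z' := Double.le_bridge fun i =>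
      (h5 i (h4.2 i).symm).trans (le_add_of_nonneg_right dist_nonneg)
    nlinarith [sq_nonneg (t - t')]
  · rintro ⟨rfl, rfl, rfl | ⟨i, rfl⟩⟩
    · rfl
    · exact pt_corner _ _ _ _

theorem cpt_eq_cpt_iff {k k' : ZMod 2} {z z' : polygon m} {t t' : ℝ} :
    cpt k z t = cpt k' z' t' ↔ ∃ n : ℤ, t' + n * (7 / 25) = t ∧ rotate n z' = z ∧
      (k' + n = k ∨ ∃ i, z = corner m i) := by
  rw [cpt, cpt, ScrewSpace.orbit_eq_orbit_iff]
  refine exists_congr fun n => ?_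
  rw [vadd_pt, pt_eq_pt_iff]
  constructor
  · rintro ⟨h1, h2, h3⟩
    exact ⟨h1, h2, h2 ▸ h3⟩
  · rintro ⟨h1, h2, h3⟩
    exact ⟨h1, h2, h2.symm ▸ h3⟩

/-- Over a vertex the ball lies in the star; any other point keeps a positive distance from the
vertices, so its small balls stay in one sheet. The last clause records this dichotomy for the later
topological arguments. -/
theorem exists_isCNOn_ball (k : ZMod 2) (z : polygon m) (t : ℝ) : ∃ r > 0,
    (∀ r' ≤ r, ∃ g, IsCNOn (Metric.ball (WithLp.toLp 2 (⟨k, z⟩, t) : PreTower m) r') g) ∧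
    ∀ k' z' t', dist (pt k' z' t') (pt k z t) < r → k' = k ∨ ∃ i, z = corner m i := by
  have hline : IsCNOn (univ : Set ℝ) (fun q r t => AffineMap.lineMap q r t) :=
    IsCNOn.of_convex convex_univ
  have key : ∀ r : ℝ, 0 < r → ∀ (S : Set (DoublePolygon m)) (g), IsCNOn S g →
      Metric.ball ⟨k, z⟩ r ⊆ S → ∀ r' ≤ r, ∃ g,
      IsCNOn (Metric.ball (WithLp.toLp 2 (⟨k, z⟩, t) : PreTower m) r') g := by
    intro r hr S g hg hS r' hr'
    have h1 := hg.prod hline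
    have h2 := h1.inter_ball (x := (WithLp.toLp 2 (⟨k, z⟩, t) : PreTower m))
      ⟨hS (Metric.mem_ball_self hr), mem_univ _⟩ r'
    rw [inter_eq_self_of_subset_right] at h2
    · exact ⟨_, h2⟩
    · intro x hx
      refine ⟨hS ?_, mem_univ _⟩
      have h3 := Metric.mem_ball.1 hx
      rw [Metric.mem_ball]
      refine lt_of_le_of_lt ?_ (h3.trans_le hr')
      rw [dist_eq_sqrt_prod]
      exact Real.le_sqrt_of_sq_le (le_add_of_nonneg_right (sq_nonneg _))
  by_cases hz : ∃ i, z = corner m i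
  · obtain ⟨i, rfl⟩ := hz
    obtain ⟨δ, hδ, h⟩ := exists_separation (m := m)
    exact ⟨δ, hδ, key δ hδ _ _ (Double.isCNOn_star (convex_polygon m) (h i)) fun x hx =>
      (Double.dist_pt_le x ⟨k, corner m i⟩).trans_lt hx, fun _ _ _ _ => Or.inr ⟨i, rfl⟩⟩
  · push Not at hz
    obtain ⟨ε, hε, h⟩ := exists_le_dist_corner z
    have hne : ∀ k' z', k' ≠ k → ε ≤ dist (⟨k', z'⟩ : DoublePolygon m) ⟨k, z⟩ := by
      intro k' z' hk
      rw [Double.dist_of_ne (by exact hk)]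
      refine Double.le_bridge fun i => ?_
      have := h i (hz i).symm
      rw [dist_comm] at this
      exact this.trans (le_add_of_nonneg_left dist_nonneg)
    refine ⟨ε, hε, key ε hε _ _ (Double.isCNOn_sheet (convex_polygon m) k) fun x hx => ?_,
      fun k' z' t' hd => Or.inl ?_⟩
    · by_contra hk
      exact absurd (Metric.mem_ball.1 hx) (not_lt.2 (hne x.sheet x.pt hk))
    · by_contra hk
      refine absurd hd (not_lt.2 ((hne k' z' hk).trans ?_))
      rw [dist_pt]
      exact Real.le_sqrt_of_sq_le (le_add_of_nonneg_right (sq_nonneg _))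

theorem isLocallyCAT0 : IsLocallyCAT0 (ArtinComplex m) := by
  intro x
  obtain ⟨k, z, t, rfl⟩ := exists_cpt x
  obtain ⟨r, hr, h, -⟩ := exists_isCNOn_ball k z t
  -- 7/100 is a quarter of the pitch, so any two points of the ball are closer than half the pitch
  -- and the orbit map preserves their distance.
  obtain ⟨g, hg⟩ := h (min r (7 / 100)) (min_le_left _ _)
  refine ⟨min r (7 / 100), lt_min hr (by norm_num), ?_⟩
  have h3 : min r (7 / 100) ≤ ScrewSpace.pitch (Tower m) / 4 := by
    rw [pitch_eq]
    exact (min_le_right _ _).trans (by norm_num)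
  exact ScrewSpace.isCAT0_ball SeparationQuotient.mk SeparationQuotient.dist_mk
    SeparationQuotient.surjective_mk _ h3 hg

omit hm in
theorem exists_cpt_mem_Ico (x : ArtinComplex m) :
    ∃ k z, ∃ t ∈ Ico (0 : ℝ) (7 / 25), x = cpt k z t := by
  obtain ⟨k, z, t, rfl⟩ := exists_cpt x
  refine ⟨_, _, _, ?_, (cpt_screw (-⌊t / (7 / 25)⌋) k z t).symm⟩
  have h := Int.sub_floor_div_mul_nonneg t (show (0 : ℝ) < 7 / 25 by norm_num)
  have h' := Int.sub_floor_div_mul_lt t (show (0 : ℝ) < 7 / 25 by norm_num)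
  push_cast
  constructor <;> linarith

theorem compactSpace_artinComplex : CompactSpace (ArtinComplex m) := by
  have hc : IsCompact ((univ : Set (polygon m)) ×ˢ Icc (0 : ℝ) (7 / 25)) :=
    isCompact_univ.prod isCompact_Icc
  refine ⟨((hc.image (continuous_cpt 0)).union (hc.image (continuous_cpt 1))).of_isClosed_subset
    isClosed_univ fun x _ => ?_⟩
  obtain ⟨k, z, t, ht, rfl⟩ := exists_cpt_mem_Ico x
  rcases (by decide : ∀ k : ZMod 2, k = 0 ∨ k = 1) k with rfl | rfl
  · exact Or.inl ⟨(z, t), ⟨mem_univ _, Ico_subset_Icc_self ht⟩, rfl⟩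
  · exact Or.inr ⟨(z, t), ⟨mem_univ _, Ico_subset_Icc_self ht⟩, rfl⟩

end

end RegularPolygon

/-! ### The two loops, and their angles -/

theorem arccos_eq_comparisonAngle {X : Type*} [MetricSpace X] {x y z : X} {s t κ : ℝ} (hs : 0 < s)
    (ht : 0 < t) (hy : dist x y = s) (hz : dist x z = t)
    (h : dist y z ^ 2 = s ^ 2 + t ^ 2 - 2 * s * t * κ) :
    comparisonAngle x y z = Real.arccos κ := by
  rw [comparisonAngle, hy, hz, h]
  congr 1
  field_simp
  ring

theorem hasAngle_of_dist {X : Type*} [MetricSpace X] {x : X} {c c' : ℝ → X} {κ δ : ℝ} (hδ : 0 < δ)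
    (hc : ∀ t ∈ Ioo 0 δ, dist x (c t) = t) (hc' : ∀ t ∈ Ioo 0 δ, dist x (c' t) = t)
    (h : ∀ s ∈ Ioo 0 δ, ∀ t ∈ Ioo 0 δ,
      dist (c s) (c' t) ^ 2 = s ^ 2 + t ^ 2 - 2 * s * t * κ) :
    HasAngle x c c' (Real.arccos κ) := by
  refine tendsto_const_nhds.congr' ?_
  have hmem : Ioo 0 δ ∈ 𝓝[>] (0 : ℝ) := Ioo_mem_nhdsGT hδ
  filter_upwards [prod_mem_prod hmem hmem] with st hst
  exact (arccos_eq_comparisonAngle hst.1.1 hst.2.1 (hc _ hst.1) (hc' _ hst.2)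
    (h _ hst.1 _ hst.2)).symm

theorem around_add_intCast {X : Type*} [MetricSpace X] {x : X} (γ : Path x x) (t : ℝ) (n : ℤ) :
    γ.around (t + n) = γ.around t := by
  rw [Path.around, Int.fract_add_intCast, Path.around]

theorem around_eq {X : Type*} [MetricSpace X] {x : X} (γ : Path x x) {t : ℝ}
    (ht : t ∈ Icc (0 : ℝ) 1) : γ.around t = γ.extend t := by
  rcases ht.2.eq_or_lt with rfl | h
  · rw [Path.around, Int.fract_one, Path.extend_zero, Path.extend_one]
  · rw [Path.around, Int.fract_eq_self.2 ⟨ht.1, h⟩]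

namespace RegularPolygon

variable {m : ℕ}

/-- The segment between two vertices of the polygon. -/
noncomputable def side (i j : ℤ) (t : ℝ) : polygon m :=
  (convex_polygon m).seg (corner m i) (corner m j) t

theorem side_zero (i j : ℤ) : side i j 0 = corner m i := (convex_polygon m).seg_zero _ _

theorem side_one (i j : ℤ) : side i j 1 = corner m j := (convex_polygon m).seg_one _ _

theorem coe_side {i j : ℤ} {t : ℝ} (ht : t ∈ Icc (0 : ℝ) 1) :
    (side i j t : polygon m).1 = AffineMap.lineMap (vertex m i) (vertex m j) t :=
  (convex_polygon m).coe_seg ht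

theorem coe_side' {i j : ℤ} {t : ℝ} (ht : t ∈ Icc (0 : ℝ) 1) :
    (side i j t : polygon m).1 = vertex m i + t * (vertex m j - vertex m i) := by
  rw [coe_side ht, AffineMap.lineMap_apply_module', Complex.real_smul, add_comm]

theorem continuous_side (i j : ℤ) : Continuous (side (m := m) i j) := by
  refine Continuous.subtype_mk ?_ _
  exact AffineMap.lineMap_continuous.comp (continuous_subtype_val.comp continuous_projIcc)

theorem rotate_side (n i j : ℤ) {t : ℝ} (ht : t ∈ Icc (0 : ℝ) 1) :
    rotate n (side i j t) = (side (n + i) (n + j) t : polygon m) := by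
  refine Subtype.ext ?_
  change root m ^ n * (side i j t).1 = _
  rw [coe_side' ht, coe_side' ht, mul_add, ← mul_assoc, mul_comm _ (t : ℂ), mul_assoc,
    mul_sub, root_pow_mul_vertex, root_pow_mul_vertex]

theorem side_swap (i j : ℤ) {t : ℝ} (ht : t ∈ Icc (0 : ℝ) 1) :
    side i j (1 - t) = (side j i t : polygon m) := by
  refine Subtype.ext ?_
  rw [coe_side' ht, coe_side' ⟨by linarith [ht.2], by linarith [ht.1]⟩]
  push_cast
  ring

/-- The base point, which is the only vertex. -/
noncomputable def basePoint (m : ℕ) : ArtinComplex m := cpt 0 (corner m 0) 0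

theorem cpt_corner_eq_basePoint (k : ZMod 2) (i : ℤ) :
    cpt k (corner m i) (i * (7 / 25)) = basePoint m := by
  have := cpt_corner_add (m := m) i k 0 0 0
  rwa [zero_add, zero_add] at this

/-- The loop which goes once along an edge of the sheet `k`. -/
noncomputable def edgeLoop (k : ZMod 2) : Path (basePoint m) (basePoint m) where
  toFun t := cpt k (side 0 1 t) (t * (7 / 25))
  continuous_toFun := (continuous_cpt k).comp (((continuous_side 0 1).comp
    continuous_subtype_val).prodMk (continuous_subtype_val.mul continuous_const))
  source' := by
    simpa [side_zero] using cpt_corner_eq_basePoint (m := m) k 0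
  target' := by
    simpa [side_one] using cpt_corner_eq_basePoint (m := m) k 1

theorem edgeLoop_apply (k : ZMod 2) (t : unitInterval) :
    edgeLoop (m := m) k t = cpt k (side 0 1 t) (t * (7 / 25)) := rfl

theorem around_edgeLoop_of_nonneg (k : ZMod 2) {t : ℝ} (ht : t ∈ Icc (0 : ℝ) 1) :
    (edgeLoop (m := m) k).around t = cpt k (side 0 1 t) (t * (7 / 25)) := by
  rw [around_eq _ ht, Path.extend_apply _ ht]
  rfl

/-- Applying the inverse screw to the final part of the edge brings it back to the base vertex, in
the other sheet and pointing to the previous vertex. Hence a loop changes sheet when it passes its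
base point, and the incoming part of one loop shares its sheet with the outgoing part of the other.
-/
theorem around_edgeLoop_neg (k : ZMod 2) {t : ℝ} (ht : t ∈ Icc (0 : ℝ) 1) :
    (edgeLoop (m := m) k).around (-t) = cpt (k + 1) (side 0 (-1) t) (-t * (7 / 25)) := by
  have ht' : 1 - t ∈ Icc (0 : ℝ) 1 := ⟨by linarith [ht.2], by linarith [ht.1]⟩
  rw [← around_add_intCast _ _ 1, Int.cast_one, neg_add_eq_sub, around_edgeLoop_of_nonneg k ht',
    side_swap 0 1 ht, ← cpt_screw (-1), rotate_side _ _ _ ht]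
  have h2 : (k + (-1 : ℤ) : ZMod 2) = k + 1 := by revert k; decide
  rw [h2, neg_add_cancel, add_zero]
  congr 1
  push_cast
  ring

/-- The straight path which leaves the base point along an edge, upwards or downwards. -/
noncomputable def ray (k : ZMod 2) (ε : ℤ) (t : ℝ) : Tower m :=
  pt k (side 0 ε t) (ε * t * (7 / 25))

theorem posSide_edgeLoop (k : ZMod 2) {t : ℝ} (ht : t ∈ Icc (0 : ℝ) 1) :
    (edgeLoop (m := m) k).posSide t = ScrewSpace.orbit (ray k 1 t) := by
  rw [Path.posSide, around_edgeLoop_of_nonneg k ht, cpt, ray, Int.cast_one, one_mul]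

theorem negSide_edgeLoop (k : ZMod 2) {t : ℝ} (ht : t ∈ Icc (0 : ℝ) 1) :
    (edgeLoop (m := m) k).negSide t = ScrewSpace.orbit (ray (k + 1) (-1) t) := by
  rw [Path.negSide, around_edgeLoop_neg k ht, cpt, ray, Int.cast_neg, Int.cast_one, neg_one_mul]

section

variable [hm : Fact (5 ≤ m)]

theorem dist_corner_pred (i : ℤ) : dist (corner m i) (corner m (i - 1)) = 24 / 25 := by
  rw [dist_comm]
  simpa using dist_corner_succ (m := m) (i - 1)

theorem dist_corner_zero {ε : ℤ} (hε : ε = 1 ∨ ε = -1) :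
    dist (corner m 0) (corner m ε) = 24 / 25 := by
  rcases hε with rfl | rfl
  · exact dist_corner_succ 0
  · exact dist_corner_pred 0

theorem dist_ray_self {k : ZMod 2} {ε : ℤ} (hε : ε = 1 ∨ ε = -1) {s t : ℝ}
    (hs : s ∈ Icc (0 : ℝ) 1) (ht : t ∈ Icc (0 : ℝ) 1) :
    dist (ray (m := m) k ε s) (ray k ε t) = |s - t| := by
  have hε2 : (ε : ℝ) ^ 2 = 1 := by rcases hε with rfl | rfl <;> norm_num
  rw [ray, ray, dist_pt_same, side, side, Convex.dist_seg_seg _ hs ht, dist_corner_zero hε,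
    mul_pow, sq_abs, ← Real.sqrt_sq_eq_abs]
  congr 1
  linear_combination (s - t) ^ 2 * (7 / 25) ^ 2 * hε2

/-- The distance along two paths in the same sheet. -/
theorem dist_sq_ray_same (k : ZMod 2) {ε : ℤ} (hε : ε = 1 ∨ ε = -1) {s t : ℝ}
    (hs : s ∈ Icc (0 : ℝ) 1) (ht : t ∈ Icc (0 : ℝ) 1) :
    dist (ray (m := m) k ε s) (ray k (-ε) t) ^ 2 = s ^ 2 + t ^ 2 - 2 * s * t *
      -((24 / 25) ^ 2 * Real.cos (2 * Real.pi / m) + (7 / 25) ^ 2) := by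
  have hε2 : (ε : ℝ) ^ 2 = 1 := by rcases hε with rfl | rfl <;> norm_num
  have h1 : dist (corner m 0) (corner m ε) = 24 / 25 := dist_corner_zero hε
  have h2 : dist (corner m 0) (corner m (-ε)) = 24 / 25 := dist_corner_zero (by omega)
  have h3 : inner ℝ (vertex m ε - vertex m 0) (vertex m (-ε) - vertex m 0) =
      -((24 / 25) ^ 2 * Real.cos (2 * Real.pi / m)) := by
    have := inner_sides (m := m) 0
    rcases hε with rfl | rfl
    · exact this
    · rw [real_inner_comm]; exact this
  rw [Subtype.dist_eq, dist_comm, dist_eq_norm] at h1 h2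
  simp only [corner] at h1 h2
  rw [ray, ray, dist_pt_same, Real.sq_sqrt (by positivity), Subtype.dist_eq, coe_side hs,
    coe_side ht, AffineMap.lineMap_apply_module', AffineMap.lineMap_apply_module', dist_eq_norm,
    add_sub_add_right_eq_sub, norm_sub_sq_real, norm_smul, norm_smul, h1, h2, real_inner_smul_left,
    real_inner_smul_right, h3, mul_pow, mul_pow, Real.norm_eq_abs, Real.norm_eq_abs, sq_abs, sq_abs]
  push_cast
  linear_combination (s + t) ^ 2 * (7 / 25) ^ 2 * hε2

/-- Near the vertex the shortest crossing between the sheets goes through it, so horizontal lengths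
add, while heights are subtracted with their signs. -/
theorem exists_dist_ray : ∃ δ > 0, δ ≤ 1 ∧ ∀ (k k' : ZMod 2) (ε ε' : ℤ), k ≠ k' →
    (ε = 1 ∨ ε = -1) → (ε' = 1 ∨ ε' = -1) → ∀ s ∈ Ico (0 : ℝ) δ, ∀ t ∈ Ico (0 : ℝ) δ,
    dist (ray (m := m) k ε s) (ray k' ε' t) ^ 2 =
      ((s + t) * (24 / 25)) ^ 2 + ((ε * s - ε' * t) * (7 / 25)) ^ 2 := by
  obtain ⟨δ, hδ, h⟩ := exists_separation (m := m)
  refine ⟨min δ 1, lt_min hδ one_pos, min_le_right _ _, fun k k' ε ε' hk hε hε' s hs t ht => ?_⟩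
  have hs' : s ∈ Icc (0 : ℝ) 1 := ⟨hs.1, hs.2.le.trans (min_le_right _ _)⟩
  have ht' : t ∈ Icc (0 : ℝ) 1 := ⟨ht.1, ht.2.le.trans (min_le_right _ _)⟩
  have h1 : dist (side 0 ε s) (corner m 0) = s * (24 / 25) := by
    rw [side, Convex.dist_seg_left _ hs', dist_corner_zero hε]
  have h2 : dist (side 0 ε' t) (corner m 0) = t * (24 / 25) := by
    rw [side, Convex.dist_seg_left _ ht', dist_corner_zero hε']
  have hsδ := hs.2.trans_le (min_le_left _ _)
  have htδ := ht.2.trans_le (min_le_left _ _)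
  rw [ray, ray, dist_pt_ne hk, Double.bridge_eq (h 0) (by rw [h1]; linarith [hs.1])
    (by rw [h2]; linarith [ht.1]), h1, h2, Real.sq_sqrt (by positivity)]
  ring

omit hm in
theorem orbit_ray_zero (k : ZMod 2) (ε : ℤ) :
    ScrewSpace.orbit (ray k ε 0) = basePoint m := by
  have := cpt_corner_eq_basePoint (m := m) k 0
  rw [ray, side_zero, mul_zero, zero_mul]
  simpa [cpt] using this

theorem dist_orbit_ray {k k' : ZMod 2} {ε ε' : ℤ} (hε : ε = 1 ∨ ε = -1) (hε' : ε' = 1 ∨ ε' = -1)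
    {s t : ℝ} (hs : s ∈ Ico (0 : ℝ) (7 / 100)) (ht : t ∈ Ico (0 : ℝ) (7 / 100)) :
    dist (ScrewSpace.orbit (ray (m := m) k ε s)) (ScrewSpace.orbit (ray k' ε' t)) =
      dist (ray (m := m) k ε s) (ray k' ε' t) := by
  have key : ∀ (k : ZMod 2) {ε : ℤ}, (ε = 1 ∨ ε = -1) → ∀ {s : ℝ}, s ∈ Ico (0 : ℝ) (7 / 100) →
      dist (ray (m := m) k ε s) (pt 0 (corner m 0) 0) < 7 / 100 := by
    intro k ε hε s hs
    have h0 : pt 0 (corner m 0) 0 = ray (m := m) k ε 0 := by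
      rw [ray, side_zero, mul_zero, zero_mul, pt_corner]
    rw [h0, dist_ray_self hε ⟨hs.1, by linarith [hs.2]⟩ ⟨le_rfl, zero_le_one⟩, sub_zero,
      abs_of_nonneg hs.1]
    exact hs.2
  refine ScrewSpace.dist_orbit_eq_of_dist_lt ?_
  have h1 := key k hε hs
  have h2 := key k' hε' ht
  have h3 := dist_triangle_right (ray (m := m) k ε s) (ray k' ε' t) (pt 0 (corner m 0) 0)
  rw [pitch_eq]
  linarith

theorem hasAngle_of_dist_ray {k k' : ZMod 2} {ε ε' : ℤ} (hε : ε = 1 ∨ ε = -1)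
    (hε' : ε' = 1 ∨ ε' = -1) {c c' : ℝ → ArtinComplex m}
    (hc : ∀ t ∈ Icc (0 : ℝ) 1, c t = ScrewSpace.orbit (ray k ε t))
    (hc' : ∀ t ∈ Icc (0 : ℝ) 1, c' t = ScrewSpace.orbit (ray k' ε' t)) {δ κ : ℝ} (hδ : 0 < δ)
    (hδ1 : δ ≤ 1) (h : ∀ s ∈ Ioo 0 δ, ∀ t ∈ Ioo 0 δ,
      dist (ray (m := m) k ε s) (ray k' ε' t) ^ 2 = s ^ 2 + t ^ 2 - 2 * s * t * κ) :
    HasAngle (basePoint m) c c' (Real.arccos κ) := by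
  have h0 : (0 : ℝ) ∈ Ico (0 : ℝ) (7 / 100) := ⟨le_rfl, by norm_num⟩
  have h01 : (0 : ℝ) ∈ Icc (0 : ℝ) 1 := ⟨le_rfl, zero_le_one⟩
  have key : ∀ (k : ZMod 2) {ε : ℤ}, (ε = 1 ∨ ε = -1) → ∀ t ∈ Ioo (0 : ℝ) (min δ (7 / 100)),
      dist (basePoint m) (ScrewSpace.orbit (ray k ε t)) = t := by
    intro k ε hε t ht
    have ht' := ht.2.trans_le (min_le_right _ _)
    rw [← orbit_ray_zero k ε, dist_orbit_ray hε hε h0 ⟨ht.1.le, ht'⟩,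
      dist_ray_self hε h01 ⟨ht.1.le, by linarith⟩, zero_sub, abs_neg, abs_of_pos ht.1]
  have hmem : ∀ t ∈ Ioo (0 : ℝ) (min δ (7 / 100)), t ∈ Icc (0 : ℝ) 1 := fun t ht =>
    ⟨ht.1.le, (ht.2.trans_le (min_le_left _ _)).le.trans hδ1⟩
  refine hasAngle_of_dist (δ := min δ (7 / 100)) (lt_min hδ (by norm_num)) ?_ ?_ ?_
  · intro t ht
    rw [hc t (hmem t ht), key k hε t ht]
  · intro t ht
    rw [hc' t (hmem t ht), key k' hε' t ht]
  · intro s hs t ht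
    rw [hc s (hmem s hs), hc' t (hmem t ht), dist_orbit_ray hε hε'
      ⟨hs.1.le, hs.2.trans_le (min_le_right _ _)⟩ ⟨ht.1.le, ht.2.trans_le (min_le_right _ _)⟩,
      h s ⟨hs.1, hs.2.trans_le (min_le_left _ _)⟩ t ⟨ht.1, ht.2.trans_le (min_le_left _ _)⟩]

/-- The horizontal components behave as opposite vectors of length 24/25 and the vertical ones are
equal of length 7/25. -/
theorem hasAngle_ray_of_ne {k k' : ZMod 2} (hk : k ≠ k') {ε : ℤ} (hε : ε = 1 ∨ ε = -1)
    {c c' : ℝ → ArtinComplex m}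
    (hc : ∀ t ∈ Icc (0 : ℝ) 1, c t = ScrewSpace.orbit (ray k ε t))
    (hc' : ∀ t ∈ Icc (0 : ℝ) 1, c' t = ScrewSpace.orbit (ray k' ε t)) :
    HasAngle (basePoint m) c c' (Real.arccos (-((24 / 25) ^ 2 - (7 / 25) ^ 2))) := by
  have hε2 : (ε : ℝ) ^ 2 = 1 := by rcases hε with rfl | rfl <;> norm_num
  obtain ⟨δ, hδ, hδ1, h⟩ := exists_dist_ray (m := m)
  refine hasAngle_of_dist_ray hε hε hc hc' hδ hδ1 fun s hs t ht => ?_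
  rw [h k k' ε ε hk hε hε s ⟨hs.1.le, hs.2⟩ t ⟨ht.1.le, ht.2⟩]
  linear_combination (s - t) ^ 2 * (7 / 25) ^ 2 * hε2

/-- Both rays lie in one Euclidean prism: the horizontal components make the interior angle of the
polygon and the vertical ones are opposite. -/
theorem hasAngle_ray_of_eq (k : ZMod 2) {ε : ℤ} (hε : ε = 1 ∨ ε = -1)
    {c c' : ℝ → ArtinComplex m}
    (hc : ∀ t ∈ Icc (0 : ℝ) 1, c t = ScrewSpace.orbit (ray k ε t))
    (hc' : ∀ t ∈ Icc (0 : ℝ) 1, c' t = ScrewSpace.orbit (ray k (-ε) t)) :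
    HasAngle (basePoint m) c c'
      (Real.arccos (-((24 / 25) ^ 2 * Real.cos (2 * Real.pi / m) + (7 / 25) ^ 2))) :=
  hasAngle_of_dist_ray hε (by omega) hc hc' one_pos le_rfl fun _ hs _ ht =>
    dist_sq_ray_same k hε (Ioo_subset_Icc_self hs) (Ioo_subset_Icc_self ht)

omit hm in
theorem four_pi_div_five_lt_arccos :
    4 * Real.pi / 5 < Real.arccos (-((24 / 25) ^ 2 - (7 / 25) ^ 2)) := by
  have hpi := Real.pi_pos
  have h : Real.arccos (-Real.cos (Real.pi / 5)) = 4 * Real.pi / 5 := by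
    rw [Real.arccos_neg, Real.arccos_cos (by positivity) (by linarith)]
    ring
  rw [← h]
  refine Real.arccos_lt_arccos (by norm_num) (neg_lt_neg ?_) (by
    linarith [Real.neg_one_le_cos (Real.pi / 5)])
  rw [Real.cos_pi_div_five]
  -- This gives cos (π/5) = (1 + √5)/4 < 0.81, whereas (24/25)² - (7/25)² = 527/625 = 0.8432.
  have : √5 < 2.24 := (Real.sqrt_lt' (by norm_num)).2 (by norm_num)
  norm_num at this ⊢
  linarith

-- The number (24/25)² c + (7/25)² is a weighted mean of c and 1, because the weights sum to 1; so
-- it exceeds cos θ.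
omit hm in
theorem lt_arccos_of_cos_le {θ c : ℝ} (hθ : 0 < θ) (hθ' : θ ≤ Real.pi) (hc : Real.cos θ ≤ c)
    (hc1 : c ≤ 1) :
    Real.pi - θ < Real.arccos (-((24 / 25) ^ 2 * c + (7 / 25) ^ 2)) := by
  have h : Real.arccos (-Real.cos θ) = Real.pi - θ := by
    rw [Real.arccos_neg, Real.arccos_cos hθ.le hθ']
  rw [← h]
  have h1 : Real.cos θ < 1 := by
    rw [← Real.cos_zero]
    exact Real.cos_lt_cos_of_nonneg_of_le_pi le_rfl hθ' hθ
  refine Real.arccos_lt_arccos (by norm_num at *; linarith) (neg_lt_neg ?_)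
    (by linarith [Real.neg_one_le_cos θ])
  norm_num
  linarith

-- The left side is the interior angle of the regular `N`-gon; the values 5 and 6 of `N` give the
-- two required bounds.
omit hm in
theorem lt_arccos_interior_angle {N : ℕ} (hN : 5 ≤ N) (hNm : N ≤ m) : Real.pi - 2 * Real.pi / N <
    Real.arccos (-((24 / 25) ^ 2 * Real.cos (2 * Real.pi / m) + (7 / 25) ^ 2)) := by
  have hpi := Real.pi_pos
  have h5 : (5 : ℝ) ≤ N := by exact_mod_cast hN
  have h6 : (N : ℝ) ≤ m := by exact_mod_cast hNm
  have h7 : 2 * Real.pi / N ≤ Real.pi := by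
    rw [div_le_iff₀ (by linarith)]
    nlinarith
  refine lt_arccos_of_cos_le (by positivity) h7 ?_ (Real.cos_le_one _)
  exact Real.cos_le_cos_of_nonneg_of_le_pi (by positivity) h7
    (div_le_div_of_nonneg_left (by positivity) (by linarith) h6)

/-- Away from the base point the loop is a straight segment in a prism. At the base point its two
sides lie in different sheets and have opposite vertical components, so the squared distance is (s +
t)² ((24/25)² + (7/25)²) = (s + t)². -/
theorem dist_around_edgeLoop (k : ZMod 2) (t : ℝ) : ∃ ε > 0, ∀ s ∈ Ioo (t - ε) (t + ε),
    ∀ s' ∈ Ioo (t - ε) (t + ε), dist ((edgeLoop (m := m) k).around s)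
      ((edgeLoop (m := m) k).around s') = |s - s'| := by
  wlog ht : t ∈ Ico (0 : ℝ) 1 generalizing t
  · obtain ⟨ε, hε, h⟩ := this (Int.fract t) ⟨Int.fract_nonneg t, Int.fract_lt_one t⟩
    refine ⟨ε, hε, fun s hs s' hs' => ?_⟩
    have h1 := h (s + (-⌊t⌋ : ℤ)) ⟨by push_cast; linarith [hs.1, Int.self_sub_floor t],
      by push_cast; linarith [hs.2, Int.self_sub_floor t]⟩ (s' + (-⌊t⌋ : ℤ))
      ⟨by push_cast; linarith [hs'.1, Int.self_sub_floor t],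
      by push_cast; linarith [hs'.2, Int.self_sub_floor t]⟩
    rw [around_add_intCast, around_add_intCast] at h1
    rw [h1]
    congr 1
    ring
  have hpos : ∀ s ∈ Icc (0 : ℝ) 1, ∀ s' ∈ Icc (0 : ℝ) 1, |s - s'| < 7 / 50 →
      dist ((edgeLoop (m := m) k).around s) ((edgeLoop (m := m) k).around s') = |s - s'| := by
    intro s hs s' hs' h
    have h1 := dist_ray_self (m := m) (k := k) (Or.inl rfl) hs hs'
    have h2 := posSide_edgeLoop (m := m) k hs
    have h3 := posSide_edgeLoop (m := m) k hs'
    rw [Path.posSide] at h2 h3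
    rw [h2, h3, ScrewSpace.dist_orbit_eq_of_dist_lt (by rw [h1, pitch_eq]; linarith), h1]
  rcases ht.1.eq_or_lt with rfl | ht0
  · obtain ⟨δ, hδ, hδ1, h⟩ := exists_dist_ray (m := m)
    have hmix : ∀ s ∈ Ico 0 (min δ (7 / 100)), ∀ s' ∈ Ico 0 (min δ (7 / 100)),
        dist ((edgeLoop (m := m) k).around s) ((edgeLoop (m := m) k).around (-s')) = s + s' := by
      intro s hs s' hs'
      have hsδ := hs.2.trans_le (min_le_left _ _)
      have hsδ' := hs'.2.trans_le (min_le_left _ _)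
      have h1 := posSide_edgeLoop (m := m) k ⟨hs.1, by linarith⟩
      have h2 := negSide_edgeLoop (m := m) k ⟨hs'.1, by linarith⟩
      rw [Path.posSide] at h1
      rw [Path.negSide] at h2
      rw [h1, h2, dist_orbit_ray (Or.inl rfl) (Or.inr rfl) ⟨hs.1, hs.2.trans_le (min_le_right _ _)⟩
        ⟨hs'.1, hs'.2.trans_le (min_le_right _ _)⟩,
        ← sq_eq_sq₀ dist_nonneg (by linarith [hs.1, hs'.1]), h k (k + 1) 1 (-1) (by simp)
        (Or.inl rfl) (Or.inr rfl) s ⟨hs.1, hsδ⟩ s' ⟨hs'.1, hsδ'⟩]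
      push_cast
      ring
    have hneg : ∀ s ∈ Ico 0 (min δ (7 / 100)), ∀ s' ∈ Ico 0 (min δ (7 / 100)),
        dist ((edgeLoop (m := m) k).around (-s)) ((edgeLoop (m := m) k).around (-s')) =
          |s - s'| := by
      intro s hs s' hs'
      have hsδ := hs.2.trans_le (min_le_left _ _)
      have hsδ' := hs'.2.trans_le (min_le_left _ _)
      have h1 := negSide_edgeLoop (m := m) k ⟨hs.1, by linarith⟩
      have h2 := negSide_edgeLoop (m := m) k ⟨hs'.1, by linarith⟩
      rw [Path.negSide] at h1 h2
      rw [h1, h2, dist_orbit_ray (Or.inr rfl) (Or.inr rfl) ⟨hs.1, hs.2.trans_le (min_le_right _ _)⟩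
        ⟨hs'.1, hs'.2.trans_le (min_le_right _ _)⟩, dist_ray_self (Or.inr rfl)
        ⟨hs.1, by linarith⟩ ⟨hs'.1, by linarith⟩]
    refine ⟨min δ (7 / 100), lt_min hδ (by norm_num), fun s hs s' hs' => ?_⟩
    rw [zero_sub, zero_add] at hs hs'
    have h7 := min_le_right δ (7 / 100 : ℝ)
    rcases le_or_gt 0 s with h0 | h0 <;> rcases le_or_gt 0 s' with h0' | h0'
    · exact hpos s ⟨h0, by linarith [hs.2]⟩ s' ⟨h0', by linarith [hs'.2]⟩
        (abs_sub_lt_iff.2 ⟨by linarith [hs.2], by linarith [hs'.2]⟩)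
    · have := hmix s ⟨h0, hs.2⟩ (-s') ⟨by linarith, by linarith [hs'.1]⟩
      rw [neg_neg] at this
      rw [this, abs_of_nonneg (by linarith)]
      ring
    · have := hmix s' ⟨h0', hs'.2⟩ (-s) ⟨by linarith, by linarith [hs.1]⟩
      rw [neg_neg, dist_comm] at this
      rw [this, abs_of_nonpos (by linarith)]
      ring
    · have := hneg (-s) ⟨by linarith, by linarith [hs.1]⟩ (-s') ⟨by linarith, by linarith [hs'.1]⟩
      rw [neg_neg, neg_neg] at this
      rw [this, abs_sub_comm]
      congr 1
      ring
  · have hmin : 0 < min (7 / 100) (min t (1 - t)) :=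
      lt_min (by norm_num) (lt_min ht0 (by linarith [ht.2]))
    have h1 : min (7 / 100) (min t (1 - t)) ≤ 7 / 100 := min_le_left _ _
    have h2 : min (7 / 100) (min t (1 - t)) ≤ t := (min_le_right _ _).trans (min_le_left _ _)
    have h3 : min (7 / 100) (min t (1 - t)) ≤ 1 - t := (min_le_right _ _).trans (min_le_right _ _)
    refine ⟨_, hmin, fun s hs s' hs' => hpos s ⟨by linarith [hs.1], by linarith [hs.2]⟩ s'
      ⟨by linarith [hs'.1], by linarith [hs'.2]⟩ (abs_sub_lt_iff.2 ⟨?_, ?_⟩)⟩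
    · linarith [hs.2, hs'.1]
    · linarith [hs.1, hs'.2]

theorem corner_ne_corner_succ (i : ℤ) : corner m i ≠ corner m (i + 1) := by
  rw [Ne, ← dist_eq_zero, dist_corner_succ]
  norm_num

theorem eq_zero_or_one_of_side_eq_corner {t : ℝ} (ht : t ∈ Icc (0 : ℝ) 1) {i : ℤ}
    (h : side 0 1 t = corner m i) : t = 0 ∨ t = 1 := by
  by_contra! h01
  have h1 := eq_of_lineMap_eq_corner (m := m) (z := corner m 0) (z' := corner m 1) (i := i)
    ⟨lt_of_le_of_ne ht.1 h01.1.symm, lt_of_le_of_ne ht.2 h01.2⟩ (by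
      have := congrArg Subtype.val h
      rwa [coe_side ht] at this)
  exact corner_ne_corner_succ (m := m) 0 (h1.1.trans h1.2.symm)

theorem isSimpleLocalGeodesicLoop_edgeLoop (k : ZMod 2) :
    (edgeLoop (m := m) k).IsSimpleLocalGeodesicLoop where
  locallyGeodesic := dist_around_edgeLoop k
  simple := by
    intro s hs t ht h
    rw [around_edgeLoop_of_nonneg k (Ico_subset_Icc_self hs),
      around_edgeLoop_of_nonneg k (Ico_subset_Icc_self ht), cpt_eq_cpt_iff] at h
    -- Heights alone decide: identified points have heights differing by an integral multiple of
    -- 7/25, so the parameters differ by an integer.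
    obtain ⟨n, hn, -⟩ := h
    have h1 : s - t = n := by linarith
    have h2 : (n : ℝ) < 1 := by linarith [hs.2, ht.1]
    have h3 : (-1 : ℝ) < n := by linarith [hs.1, ht.2]
    have h4 : n = 0 := by
      have : n < 1 := by exact_mod_cast h2
      have : -1 < n := by exact_mod_cast h3
      omega
    rw [h4, Int.cast_zero] at h1
    linarith

/-- Heights force the two parameters to differ by an integer. If they are equal, the common point
lies over a vertex, since the sheets differ; otherwise both parameters are ends of the interval. -/
theorem range_edgeLoop_inter {k k' : ZMod 2} (hk : k ≠ k') :
    range (edgeLoop (m := m) k) ∩ range (edgeLoop (m := m) k') = {basePoint m} := by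
  refine Subset.antisymm ?_ (singleton_subset_iff.2 ⟨⟨0, Path.source _⟩, ⟨0, Path.source _⟩⟩)
  rintro _ ⟨⟨s, rfl⟩, ⟨t, h⟩⟩
  rw [mem_singleton_iff]
  have hs1 := s.2.1
  have hs2 := s.2.2
  have ht1 := t.2.1
  have ht2 := t.2.2
  suffices h01 : (s : ℝ) = 0 ∨ (s : ℝ) = 1 by
    rcases h01 with h0 | h1
    · rw [show s = 0 from Subtype.ext h0, Path.source]
    · rw [show s = 1 from Subtype.ext h1, Path.target]
  rw [edgeLoop_apply, edgeLoop_apply, eq_comm, cpt_eq_cpt_iff] at h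
  obtain ⟨n, hn, -, h3⟩ := h
  have h1 : (s : ℝ) - t = n := by linarith
  by_cases h4 : n = 0
  · rw [h4] at h3
    refine h3.elim (fun h3 => absurd (by simpa using h3.symm) hk) fun ⟨i, hi⟩ => ?_
    exact eq_zero_or_one_of_side_eq_corner s.2 hi
  · rcases lt_or_gt_of_ne h4 with h5 | h5
    · have : (n : ℝ) ≤ -1 := by exact_mod_cast Int.le_sub_one_of_lt h5
      exact Or.inl (by linarith)
    · have : (1 : ℝ) ≤ n := by exact_mod_cast h5
      exact Or.inr (by linarith)

end

end RegularPolygon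

/-! ### Contractible balls -/

namespace IsCNOn

variable {N : Type*} [PseudoMetricSpace N] {S : Set N} {g : N → N → ℝ → N}

/-- Geodesics which issue from the same point diverge at least linearly. -/
theorem dist_le (h : IsCNOn S g) {p q r : N} (hp : p ∈ S) (hq : q ∈ S) (hr : r ∈ S) {s : ℝ}
    (hs : s ∈ Icc (0 : ℝ) 1) : dist (g p q s) (g p r s) ≤ s * dist q r := by
  have hw := h.mem p hp r hr s hs
  have h0 : (0 : ℝ) ∈ Icc (0 : ℝ) 1 := ⟨le_rfl, zero_le_one⟩
  have h1 := h.cn p hp q hq _ hw s hs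
  have h2 := h.cn p hp r hr q hq s hs
  have h3 : dist (g p r s) p ≤ s * dist p r := by
    have h4 := h.dist_eq p hp r hr s hs 0 h0
    have h5 := dist_triangle (g p r s) (g p r 0) p
    rw [h.zero p hp r hr, h4, sub_zero, abs_of_nonneg hs.1, add_zero] at h5
    exact h5
  have h6 : dist (g p r s) p ^ 2 ≤ (s * dist p r) ^ 2 := pow_le_pow_left₀ dist_nonneg h3 2
  rw [dist_comm q, dist_comm q] at h2
  refine le_of_sq_le_sq ?_ (mul_nonneg hs.1 dist_nonneg)
  rw [dist_comm (g p q s)]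
  have hs1 : 0 ≤ 1 - s := by linarith [hs.2]
  have h7 := mul_le_mul_of_nonneg_left h6 hs1
  have h8 := mul_le_mul_of_nonneg_left h2 hs.1
  linarith

/-- The ball is contracted along the geodesics from its centre. This homotopy is Lipschitz: the
radius bounds the speed in time, and `dist_le` gives the constant 1 in the end point. -/
theorem contractibleSpace_ball {E : Type*} [MetricSpace E] {f : N → E}
    (hf : ∀ x y, dist (f x) (f y) = dist x y) (hs : Function.Surjective f) {x : N} {r : ℝ}
    (hr : 0 < r) (hg : IsCNOn (Metric.ball x r) g) : ContractibleSpace (Metric.ball (f x) r) := by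
  have hx := Metric.mem_ball_self (x := x) hr
  have hσ : ∀ p : Metric.ball (f x) r, Function.surjInv hs p ∈ Metric.ball x r := by
    rintro ⟨p, hp⟩
    rwa [Metric.mem_ball, ← hf, Function.surjInv_eq hs]
  have hd : ∀ p q : Metric.ball (f x) r,
      dist (Function.surjInv hs p) (Function.surjInv hs q) = dist p q := fun p q => by
    rw [← hf, Function.surjInv_eq hs, Function.surjInv_eq hs, Subtype.dist_eq]
  let F : unitInterval × Metric.ball (f x) r → Metric.ball (f x) r := fun a =>
    ⟨f (g x (Function.surjInv hs a.2) a.1), by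
      rw [Metric.mem_ball, hf]
      exact hg.mem x hx _ (hσ a.2) _ a.1.2⟩
  have hF : LipschitzWith (Real.toNNReal (r + 1)) F := by
    refine LipschitzWith.of_dist_le_mul fun a b => ?_
    rw [Real.coe_toNNReal _ (by linarith)]
    have h1 := hg.dist_eq x hx _ (hσ a.2) _ a.1.2 _ b.1.2
    have h2 := hg.dist_le hx (hσ a.2) (hσ b.2) b.1.2
    have h3 := dist_triangle (g x (Function.surjInv hs a.2) a.1)
      (g x (Function.surjInv hs a.2) b.1) (g x (Function.surjInv hs b.2) b.1)
    rw [hd] at h2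
    have h4 : |(a.1 : ℝ) - b.1| ≤ dist a b := le_max_left _ _
    have h5 : dist a.2 b.2 ≤ dist a b := le_max_right _ _
    have h6 : dist x (Function.surjInv hs a.2) ≤ r := (Metric.mem_ball'.1 (hσ a.2)).le
    have h7 := mul_le_mul h4 h6 dist_nonneg dist_nonneg
    have h8 := mul_le_mul b.1.2.2 h5 dist_nonneg zero_le_one
    rw [Subtype.dist_eq, hf]
    linarith
  refine (contractible_iff_id_nullhomotopic _).2 ⟨⟨f x, Metric.mem_ball_self hr⟩, ⟨?_⟩⟩
  refine ContinuousMap.Homotopy.symm ⟨⟨F, hF.continuous⟩, fun p => ?_, fun p => ?_⟩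
  · refine Subtype.ext ?_
    change f (g x (Function.surjInv hs p) 0) = f x
    rw [← dist_eq_zero, hf]
    exact hg.zero x hx _ (hσ p)
  · refine Subtype.ext ?_
    change f (g x (Function.surjInv hs p) 1) = p
    rw [← dist_eq_zero]
    nth_rewrite 2 [← Function.surjInv_eq hs p.1]
    rw [hf]
    exact hg.one x hx _ (hσ p)

end IsCNOn

/-! ### Homotopy classes of paths -/

namespace Path.Homotopic.Quotient

section

variable {Y Z : Type*} [TopologicalSpace Y] [TopologicalSpace Z]

theorem cast_trans {x y z x' y' z' : Y} (p : Path.Homotopic.Quotient x y)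
    (q : Path.Homotopic.Quotient y z) (hx : x' = x) (hy : y' = y) (hz : z' = z) :
    (p.cast hx hy).trans (q.cast hy hz) = (p.trans q).cast hx hz := by
  subst hx hy hz
  simp only [cast_rfl_rfl]

theorem map_trans {x y z : Y} (p : Path.Homotopic.Quotient x y)
    (q : Path.Homotopic.Quotient y z) (f : C(Y, Z)) :
    (p.trans q).map f = (p.map f).trans (q.map f) :=
  (FundamentalGroupoid.map f).map_comp (X := ⟨x⟩) (Y := ⟨y⟩) (Z := ⟨z⟩) p q

/-- To prove a property of all homotopy classes of paths, which is stable under concatenation,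
it is enough to check it for short paths. -/
theorem induction_of_local {Q : ∀ ⦃y z : Y⦄, Path.Homotopic.Quotient y z → Prop}
    (trans : ∀ ⦃x y z : Y⦄ (p : Path.Homotopic.Quotient x y) (q : Path.Homotopic.Quotient y z),
      Q p → Q q → Q (p.trans q))
    (short : ∀ x : Y, ∃ U ∈ 𝓝 x, ∀ ⦃y z : Y⦄ (p : Path y z), range p ⊆ U → Q (mk p))
    {y z : Y} (p : Path.Homotopic.Quotient y z) : Q p := by
  induction p with | mk p
  choose U hU hQ using short
  have hcast : ∀ ⦃y z y' z' : Y⦄ (q : Path.Homotopic.Quotient y z) (hy : y' = y) (hz : z' = z),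
      Q (q.cast hy hz) → Q q := by
    rintro y z _ _ q rfl rfl h
    rwa [cast_rfl_rfl] at h
  -- The path is subdivided, by compactness of the interval, into pieces contained in the given
  -- neighbourhoods.
  obtain ⟨t, ht0, htm, ⟨n, hn⟩, ht⟩ := exists_monotone_Icc_subset_open_cover_unitInterval
    (c := fun x => p ⁻¹' interior (U x)) (fun x => isOpen_interior.preimage p.continuous)
    fun s _ => mem_iUnion.2 ⟨p s, mem_interior_iff_mem_nhds.2 (hU (p s))⟩
  have key : ∀ n, Q (mk (p.subpath (t 0) (t n))) := by
    intro n
    induction n with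
    | zero =>
      obtain ⟨x, hx⟩ := ht 0
      refine hQ x _ ?_
      rw [Path.range_subpath_of_le _ _ _ le_rfl, Icc_self, image_singleton, singleton_subset_iff]
      exact interior_subset (hx (left_mem_Icc.2 (htm (Nat.le_succ 0))))
    | succ n ih =>
      obtain ⟨x, hx⟩ := ht n
      rw [← eq.2 ⟨Path.Homotopy.subpathTransSubpath p (t 0) (t n) (t (n + 1))⟩]
      refine trans _ _ ih (hQ x _ ?_)
      rw [Path.range_subpath_of_le _ _ _ (htm (Nat.le_succ n))]
      exact (image_mono hx).trans ((image_preimage_subset _ _).trans interior_subset)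
  have h1 := key n
  rw [ht0, hn n le_rfl, Path.subpath_zero_one] at h1
  exact hcast _ p.source p.target h1

end

section

variable {A B Y Z : Type*} [TopologicalSpace A] [TopologicalSpace B] [TopologicalSpace Y]
  [TopologicalSpace Z] [SimplyConnectedSpace A] [SimplyConnectedSpace B]

/-- The homotopy class of the images under `f` of the paths from `u` to `u'`. -/
noncomputable def push (f : C(A, Y)) (u u' : A) {y z : Y} (hy : y = f u) (hz : z = f u') :
    Path.Homotopic.Quotient y z :=
  ((mk (PathConnectedSpace.somePath u u')).map f).cast hy hz

/-- In a simply connected space all paths with given ends are homotopic, so the arbitrary choice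
made in `push` is immaterial. -/
theorem push_eq (f : C(A, Y)) {u u' : A} (p : Path.Homotopic.Quotient u u') {y z : Y}
    (hy : y = f u) (hz : z = f u') : push f u u' hy hz = (p.map f).cast hy hz := by
  rw [push, Subsingleton.elim p]

theorem push_eq_mk (f : C(A, Y)) {u u' : A} (p : Path u u') {y z : Y} (q : Path y z)
    (h : ∀ t, q t = f (p t)) :
    push f u u' (by simpa using h 0) (by simpa using h 1) = mk q := by
  rw [push_eq f (mk p), ← mk_map, ← mk_cast]
  congr 1
  ext t
  exact (h t).symm

theorem push_trans (f : C(A, Y)) (u u' u'' : A) {x y z : Y} (hx : x = f u) (hy : y = f u')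
    (hz : z = f u'') : (push f u u' hx hy).trans (push f u' u'' hy hz) = push f u u'' hx hz := by
  rw [push, push, cast_trans, ← map_trans, ← push_eq]

theorem push_self (f : C(A, Y)) (u : A) {x : Y} (hx : x = f u) :
    push f u u hx hx = refl x := by
  subst hx
  rw [push_eq f (refl u), cast_rfl_rfl]
  rfl

theorem map_push (f : C(A, Y)) (g : C(Y, Z)) (u u' : A) {y z : Y} (hy : y = f u) (hz : z = f u') :
    (push f u u' hy hz).map g =
      push (g.comp f) u u' (congrArg g hy) (congrArg g hz) := by
  rw [push, map_cast, push, map_comp]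

theorem push_comp (f : C(A, Y)) (e : C(B, A)) (u u' : B) {y z : Y} (hy : y = f (e u))
    (hz : z = f (e u')) : push f (e u) (e u') hy hz = push (f.comp e) u u' hy hz := by
  rw [push_eq f ((mk (PathConnectedSpace.somePath u u')).map e), push, map_comp]

theorem push_congr {f f' : C(A, Y)} (h : ∀ u, f u = f' u) (u u' : A) {y z : Y} (hy : y = f u)
    (hz : z = f u') : push f u u' hy hz = push f' u u' (hy.trans (h u)) (hz.trans (h u')) := by
  obtain rfl : f = f' := ContinuousMap.ext h
  rfl

end

end Path.Homotopic.Quotient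

/-! ### Generators of the fundamental group -/

theorem map_altWord {G H F : Type*} [Monoid G] [Monoid H] [FunLike F G H] [MonoidHomClass F G H]
    (f : F) (x y : G) (n : ℕ) : f (altWord x y n) = altWord (f x) (f y) n := by
  induction n generalizing x y with
  | zero => exact map_one f
  | succ n ih => rw [altWord, map_mul, ih, altWord]

namespace Path.Homotopic.Quotient

variable {A Y : Type*} [TopologicalSpace A] [TopologicalSpace Y] [SimplyConnectedSpace A]

theorem push_val_eq_mk {S : Set Y} [SimplyConnectedSpace S] {y z : Y} (p : Path y z)
    (h : ∀ t, p t ∈ S) (hy : y ∈ S) (hz : z ∈ S) :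
    push (⟨Subtype.val, continuous_subtype_val⟩ : C(S, Y)) ⟨y, hy⟩ ⟨z, hz⟩ rfl rfl = mk p :=
  push_eq_mk _ (⟨⟨fun t => ⟨p t, h t⟩, p.continuous.subtype_mk _⟩, Subtype.ext p.source,
    Subtype.ext p.target⟩ : Path (⟨y, hy⟩ : S) ⟨z, hz⟩) p fun _ => rfl

/-- A path whose image stays in `S` can be read in both simply connected models, so the two classes
agree. -/
theorem push_val_eq {S : Set Y} [SimplyConnectedSpace S] (f : C(A, Y)) {u u' : A} (p : Path u u')
    (h : ∀ t, f (p t) ∈ S) {y z : Y} (hyS : y ∈ S) (hzS : z ∈ S) (hy : y = f u) (hz : z = f u') :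
    push (⟨Subtype.val, continuous_subtype_val⟩ : C(S, Y)) ⟨y, hyS⟩ ⟨z, hzS⟩ rfl rfl =
      push f u u' hy hz := by
  subst hy hz
  rw [push_val_eq_mk (p.map f.continuous) h, push_eq_mk f p (p.map f.continuous) fun _ => rfl]

theorem push_congr_points (f : C(A, Y)) {u u' v v' : A} (h : u = v) (h' : u' = v') {y z : Y}
    (hy : y = f u) (hz : z = f u') : push f u u' hy hz = push f v v' (h ▸ hy) (h' ▸ hz) := by
  subst h h'
  rfl

theorem cast_push (f : C(A, Y)) (u u' : A) {y z y' z' : Y} (hy : y = f u) (hz : z = f u')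
    (hy' : y' = y) (hz' : z' = z) :
    (push f u u' hy hz).cast hy' hz' = push f u u' (hy'.trans hy) (hz'.trans hz) := by
  rw [push, push, cast_cast]

end Path.Homotopic.Quotient

/-! ### Staircases in the prisms, the Artin relation and the homomorphism -/

namespace RegularPolygon

open Path.Homotopic.Quotient

variable {m : ℕ}

instance : ContractibleSpace (polygon m) :=
  (convex_polygon m).contractibleSpace ⟨_, vertex_mem m 0⟩

/-- The inclusion of a prism over the polygon into the product of the double of the polygon
and of a line. -/
noncomputable def strip (k : ZMod 2) : C(polygon m × ℝ, Tower m) :=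
  ⟨fun u => pt k u.1 u.2, continuous_pt k⟩

/-- The projection to the complex. -/
noncomputable def project : C(Tower m, ArtinComplex m) := ⟨ScrewSpace.orbit, ScrewSpace.continuous_orbit⟩

/-- The map of a prism over the polygon to the complex. -/
noncomputable def cstrip (k : ZMod 2) : C(polygon m × ℝ, ArtinComplex m) := project.comp (strip k)

/-- The points of the prism which are mapped to the base point. -/
noncomputable def node (m : ℕ) (i : ℤ) : polygon m × ℝ := (corner m i, i * (7 / 25))

theorem basePoint_eq (k : ZMod 2) (i : ℤ) : basePoint m = cstrip k (node m i) :=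
  (cpt_corner_eq_basePoint k i).symm

/-- The screw motion of the prism. -/
noncomputable def prismScrew (n : ℤ) : C(polygon m × ℝ, polygon m × ℝ) :=
  ⟨fun u => (rotate n u.1, u.2 + n * (7 / 25)),
    ((Isometry.of_dist_eq (dist_rotate n)).continuous.comp continuous_fst).prodMk
      (continuous_snd.add continuous_const)⟩

theorem prismScrew_node (n i : ℤ) : prismScrew n (node m i) = node m (i + n) := by
  refine Prod.ext ?_ ?_
  · change rotate n (corner m i) = corner m (i + n)
    rw [rotate_corner, add_comm]
  · change (i : ℝ) * (7 / 25) + n * (7 / 25) = ((i + n : ℤ) : ℝ) * (7 / 25)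
    push_cast
    ring

/-- The class of the straight paths between nodes. -/
noncomputable def nodeClass (k : ZMod 2) (i j : ℤ) :
    FundamentalGroup (ArtinComplex m) (basePoint m) :=
  push (cstrip k) (node m i) (node m j) (basePoint_eq k i) (basePoint_eq k j)

/-- In a product of the fundamental group the path travelled first stands on the right. -/
theorem nodeClass_mul (k : ZMod 2) (i j l : ℤ) :
    nodeClass k j l * nodeClass k i j = nodeClass (m := m) k i l :=
  push_trans (cstrip k) _ _ _ _ _ _

theorem nodeClass_self (k : ZMod 2) (i : ℤ) : nodeClass (m := m) k i i = 1 :=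
  push_self (cstrip k) _ _

/-- The screw motion changes nothing in the complex, but shifts both the nodes and the sheet. -/
theorem nodeClass_add (n : ℤ) (k : ZMod 2) (i j : ℤ) :
    nodeClass (k + n) (i + n) (j + n) = nodeClass (m := m) k i j := by
  have h : ∀ u, (cstrip (k + n)).comp (prismScrew n) u = cstrip (m := m) k u := fun u =>
    cpt_screw n k u.1 u.2
  rw [nodeClass, push_congr_points _ (prismScrew_node n i).symm (prismScrew_node n j).symm,
    push_comp, push_congr h, nodeClass]

/-- The class of the loop along an edge. -/
noncomputable def edgeClass (k : ZMod 2) : FundamentalGroup (ArtinComplex m) (basePoint m) :=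
  FundamentalGroup.fromPath (mk (edgeLoop k))

/-- The path along a side of the prism. -/
noncomputable def sidePath : Path (node m 0) (node m 1) where
  toFun t := (side 0 1 t, t * (7 / 25))
  continuous_toFun := ((continuous_side 0 1).comp continuous_subtype_val).prodMk
    (continuous_subtype_val.mul continuous_const)
  source' := by simp [node, side_zero]
  target' := by simp [node, side_one]

theorem nodeClass_zero_one (k : ZMod 2) : nodeClass k 0 1 = edgeClass (m := m) k :=
  push_eq_mk (cstrip k) sidePath (edgeLoop k) fun _ => rfl

/-- Translated back by `n` screws, the last step is the edge from node 0 to node 1 in the sheet `k -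
n`; this is the source of the alternation. -/
theorem nodeClass_succ (k : ZMod 2) (i n : ℤ) :
    nodeClass k i (n + 1) = edgeClass (k - n) * nodeClass (m := m) k i n := by
  rw [← nodeClass_mul k i n, ← nodeClass_zero_one, ← nodeClass_add n (k - n) 0 1]
  congr 2
  · ring
  · ring
  · ring

theorem nodeClass_eq_altWord (k : ZMod 2) (n : ℕ) : nodeClass (m := m) k 0 n =
    altWord (edgeClass (k - n + 1)) (edgeClass (k - n)) n := by
  induction n with
  | zero => exact nodeClass_self k 0
  | succ n ih =>
    have h1 : k - ((n + 1 : ℕ) : ZMod 2) + 1 = k - n := by push_cast; ring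
    have h2 : k - ((n + 1 : ℕ) : ZMod 2) = k - n + 1 := by
      rw [← h1, add_assoc, one_add_one_eq_two, show (2 : ZMod 2) = 0 from rfl, add_zero]
    rw [altWord, h1, h2, ← ih, Nat.cast_succ, nodeClass_succ, Int.cast_natCast]

/-- The inclusion of a vertical line. -/
noncomputable def verticalLine (z : polygon m) : C(ℝ, polygon m × ℝ) :=
  ⟨fun t => (z, t), continuous_const.prodMk continuous_id⟩

/-- The vertical lines over the vertices belong to both prisms. -/
theorem push_cstrip_corner (k k' : ZMod 2) (i : ℤ) (t t' : ℝ) {y z : ArtinComplex m}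
    (hy : y = cstrip k (corner m i, t)) (hz : z = cstrip k (corner m i, t'))
    (hy' : y = cstrip k' (corner m i, t)) (hz' : z = cstrip k' (corner m i, t')) :
    push (cstrip k) (corner m i, t) (corner m i, t') hy hz =
      push (cstrip k') (corner m i, t) (corner m i, t') hy' hz' := by
  have h : ∀ s, (cstrip k).comp (verticalLine (corner m i)) s =
      (cstrip k').comp (verticalLine (corner m i)) s := fun s => cpt_corner k k' i s
  have h1 := push_comp (cstrip k) (verticalLine (corner m i)) t t' hy hz
  have h2 := push_comp (cstrip k') (verticalLine (corner m i)) t t' hy' hz'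
  exact h1.trans ((push_congr h _ _ _ _).trans h2.symm)

section

variable [hm : Fact (5 ≤ m)]

/-- After m steps the node is again over vertex 0, so the staircase is homotopic in its prism to the
vertical line over that vertex, which both sheets contain. -/
theorem nodeClass_period (k k' : ZMod 2) : nodeClass k 0 m = nodeClass (m := m) k' 0 m := by
  have h : corner m m = corner m 0 := by
    simpa using corner_add_m (m := m) 0
  have h1 : node m m = (corner m 0, ((m : ℤ) : ℝ) * (7 / 25)) := by
    rw [← h]
    rfl
  rw [nodeClass, nodeClass, push_congr_points _ rfl h1, push_congr_points (cstrip k') rfl h1]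
  exact push_cstrip_corner k k' 0 _ _ _ _ _ _

/-- The staircases in the two sheets spell the two words; the parity of m decides which sheet gives
which. -/
theorem edgeClass_relation :
    altWord (edgeClass 0) (edgeClass 1) m = altWord (edgeClass (m := m) 1) (edgeClass 0) m := by
  have h0 := nodeClass_eq_altWord (m := m) 0 m
  have h1 := nodeClass_eq_altWord (m := m) 1 m
  have h := nodeClass_period (m := m) 0 1
  rcases (by decide : ∀ k : ZMod 2, k = 0 ∨ k = 1) (m : ZMod 2) with hk | hk
  · rw [hk, sub_zero, zero_add] at h0
    rw [hk, sub_zero, show (1 + 1 : ZMod 2) = 0 by decide] at h1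
    exact h1.symm.trans (h.symm.trans h0)
  · rw [hk, show (0 - 1 + 1 : ZMod 2) = 0 by decide, show (0 - 1 : ZMod 2) = 1 by decide] at h0
    rw [hk, sub_self, zero_add] at h1
    exact h0.symm.trans (h.trans h1)

/-- The homomorphism from the dihedral Artin group to the fundamental group. -/
noncomputable def artinHom (m : ℕ) [Fact (5 ≤ m)] :
    DihedralArtinGroup m →* FundamentalGroup (ArtinComplex m) (basePoint m) :=
  PresentedGroup.toGroup (f := ![edgeClass 0, edgeClass 1]) (by
    rintro _ rfl
    rw [map_mul, map_inv, map_altWord, map_altWord, FreeGroup.lift_apply_of,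
      FreeGroup.lift_apply_of, mul_inv_eq_one]
    exact edgeClass_relation)

theorem artinHom_a : artinHom m (DihedralArtinGroup.a m) = edgeClass 0 :=
  PresentedGroup.toGroup.of _

theorem artinHom_b : artinHom m (DihedralArtinGroup.b m) = edgeClass 1 :=
  PresentedGroup.toGroup.of _

theorem edgeClass_mem_range (k : ZMod 2) : edgeClass k ∈ (artinHom m).range := by
  rcases (by decide : ∀ k : ZMod 2, k = 0 ∨ k = 1) k with rfl | rfl
  exacts [⟨_, artinHom_a⟩, ⟨_, artinHom_b⟩]

theorem nodeClass_mem_range (k : ZMod 2) (n : ℤ) : nodeClass k 0 n ∈ (artinHom m).range := by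
  induction n using Int.induction_on with
  | zero => rw [nodeClass_self]; exact one_mem _
  | succ n ih => rw [nodeClass_succ]; exact mul_mem (edgeClass_mem_range _) ih
  | pred n ih =>
    have h := nodeClass_succ (m := m) k 0 (-n - 1)
    rw [sub_add_cancel] at h
    exact (Subgroup.mul_mem_cancel_left _ (edgeClass_mem_range _)).1 (h ▸ ih)

/-! ### Surjectivity -/

omit hm in
/-- A point of a prism over the given point. -/
theorem exists_strip (y : Tower m) : ∃ ku : ZMod 2 × (polygon m × ℝ), y = strip ku.1 ku.2 := by
  obtain ⟨k, z, t, h⟩ := exists_pt y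
  exact ⟨(k, z, t), h⟩

theorem strip_eq_strip_iff {k k' : ZMod 2} {u u' : polygon m × ℝ} :
    strip k u = strip k' u' ↔ u = u' ∧ (k = k' ∨ ∃ i, u.1 = corner m i) := by
  refine pt_eq_pt_iff.trans ?_
  rw [Prod.ext_iff]
  tauto

open CategoryTheory

/-- The class of the straight paths in a prism which issue from the base point. -/
noncomputable def ascent (k : ZMod 2) (u : polygon m × ℝ) {y : ArtinComplex m}
    (hy : y = cstrip k u) :
    FundamentalGroupoid.mk (basePoint m) ⟶ FundamentalGroupoid.mk y :=
  push (cstrip k) (node m 0) u (basePoint_eq k 0) hy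

omit hm in
theorem ascent_comp (k : ZMod 2) (u u' : polygon m × ℝ) {y z : ArtinComplex m}
    (hy : y = cstrip k u) (hz : z = cstrip k u') :
    ascent k u hy ≫ FundamentalGroupoid.fromPath (push (cstrip k) u u' hy hz) =
      ascent k u' hz :=
  push_trans _ _ _ _ _ _ _

/-- A point has two descriptions only over a vertex. Both ascents may then be routed through the
node over that vertex and continued along the common vertical line, so they differ by node classes.
-/
theorem ascent_comp_inv_mem {k k' : ZMod 2} {u u' : polygon m × ℝ} {y : Tower m}
    (hy : y = strip k u) (hy' : y = strip k' u') :
    ((ascent k u (congrArg project hy) ≫ inv (ascent k' u' (congrArg project hy')) :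
      FundamentalGroupoid.mk (basePoint m) ⟶ FundamentalGroupoid.mk (basePoint m)) :
      FundamentalGroup (ArtinComplex m) (basePoint m)) ∈ (artinHom m).range := by
  obtain ⟨rfl, rfl | ⟨i, hi⟩⟩ := strip_eq_strip_iff.1 (hy.symm.trans hy')
  · rw [IsIso.hom_inv_id]
    exact one_mem _
  · obtain ⟨z, t⟩ := u
    obtain rfl : z = corner m i := hi
    have h : push (cstrip k) (node m i) (corner m i, t) (basePoint_eq k i) (congrArg project hy) =
        push (cstrip k') (node m i) (corner m i, t) (basePoint_eq k' i) (congrArg project hy') :=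
      push_cstrip_corner k k' i _ _ _ _ _ _
    rw [← ascent_comp k (node m i) _ (basePoint_eq k i) (congrArg project hy),
      ← ascent_comp k' (node m i) _ (basePoint_eq k' i) (congrArg project hy'), h]
    simp only [IsIso.inv_comp, Category.assoc, IsIso.hom_inv_id_assoc]
    rw [← Groupoid.inv_eq_inv]
    exact mul_mem (inv_mem (nodeClass_mem_range k' i)) (nodeClass_mem_range k i)

/-- The class of a path which joins the base point to the given point. -/
noncomputable def access (y : Tower m) :
    FundamentalGroupoid.mk (basePoint m) ⟶ FundamentalGroupoid.mk (project y) :=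
  ascent (exists_strip y).choose.1 (exists_strip y).choose.2
    (congrArg project (exists_strip y).choose_spec)

/-- The class of paths `p` defines an element of the image of the Artin group, when its end points
are joined to the base point. -/
def IsGenerated ⦃y z : Tower m⦄ (p : Path.Homotopic.Quotient y z) : Prop :=
  ((access y ≫ FundamentalGroupoid.fromPath (p.map project) ≫ inv (access z) :
      FundamentalGroupoid.mk (basePoint m) ⟶ FundamentalGroupoid.mk (basePoint m)) :
      FundamentalGroup (ArtinComplex m) (basePoint m)) ∈ (artinHom m).range

theorem IsGenerated.trans {x y z : Tower m} {p : Path.Homotopic.Quotient x y}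
    {q : Path.Homotopic.Quotient y z} (hp : IsGenerated p) (hq : IsGenerated q) :
    IsGenerated (p.trans q) := by
  have h := mul_mem hq hp
  rw [End.mul_def] at h
  simp only [Category.assoc, IsIso.inv_hom_id_assoc] at h
  have h1 : FundamentalGroupoid.fromPath ((p.trans q).map project) =
      FundamentalGroupoid.fromPath (p.map project) ≫
        FundamentalGroupoid.fromPath (q.map project) := map_trans p q project
  rw [IsGenerated, h1, Category.assoc]
  exact h

/-- With ascents taken in the prism that contains the path, the conjugated class is trivial; the
chosen access paths differ from these ascents by elements of the range. -/
theorem isGenerated_push (k : ZMod 2) (u u' : polygon m × ℝ) {y z : Tower m} (hy : y = strip k u)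
    (hz : z = strip k u') : IsGenerated (push (strip k) u u' hy hz) := by
  have h1 := ascent_comp_inv_mem hy (exists_strip y).choose_spec
  have h2 := ascent_comp_inv_mem hz (exists_strip z).choose_spec
  have h3 := mul_mem h2 (inv_mem h1)
  have h4 : (push (strip k) u u' hy hz).map project =
      push (cstrip k) u u' (congrArg project hy) (congrArg project hz) :=
    map_push (strip k) project u u' hy hz
  rw [IsGenerated, h4]
  rw [← ascent_comp k u u' (congrArg project hy) (congrArg project hz)] at h3
  have h5 : ∀ x y : FundamentalGroup (ArtinComplex m) (basePoint m), x * y⁻¹ = y⁻¹ ≫ x :=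
    fun _ _ => rfl
  have h6 : ∀ x : FundamentalGroup (ArtinComplex m) (basePoint m), x⁻¹ = inv x :=
    fun x => Groupoid.inv_eq_inv x
  rw [h5, h6, IsIso.inv_comp, IsIso.inv_inv] at h3
  simp only [Category.assoc, IsIso.inv_hom_id_assoc] at h3
  exact h3

/-- Contractibility makes short paths unique up to homotopy, and every point of the ball shares a
prism with the centre, though two points of the ball need not share one. -/
theorem exists_contractible_ball (x : Tower m) : ∃ r > 0, ContractibleSpace (Metric.ball x r) ∧
    ∀ y ∈ Metric.ball x r, ∃ k u u₀, y = strip k u ∧ x = strip k u₀ := by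
  obtain ⟨k, z, t, rfl⟩ := exists_pt x
  obtain ⟨r, hr, h1, h2⟩ := exists_isCNOn_ball k z t
  obtain ⟨g, hg⟩ := h1 r le_rfl
  refine ⟨r, hr, hg.contractibleSpace_ball SeparationQuotient.dist_mk
    SeparationQuotient.surjective_mk hr, fun y hy => ?_⟩
  obtain ⟨k', z', t', rfl⟩ := exists_pt y
  obtain rfl | ⟨i, rfl⟩ := h2 k' z' t' hy
  · exact ⟨k', (z', t'), (z, t), rfl, rfl⟩
  · exact ⟨k', (z', t'), (corner m i, t), rfl, pt_corner _ _ _ _⟩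

/-- The straight paths in the prism. -/
noncomputable def prismPath (u u' : polygon m × ℝ) : Path u u' where
  toFun t := ((convex_polygon m).seg u.1 u'.1 t, AffineMap.lineMap u.2 u'.2 (t : ℝ))
  continuous_toFun := by
    refine Continuous.prodMk (Continuous.subtype_mk ?_ _) ?_
    · exact AffineMap.lineMap_continuous.comp (continuous_subtype_val.comp
        (continuous_projIcc.comp continuous_subtype_val))
    · exact AffineMap.lineMap_continuous.comp continuous_subtype_val
  source' := by simp [Convex.seg_zero]
  target' := by simp [Convex.seg_one]

omit hm in
theorem dist_strip_prismPath_le (k : ZMod 2) (u u' : polygon m × ℝ) (t : unitInterval) :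
    dist (strip k (prismPath u u' t)) (strip k u) ≤ dist (strip k u') (strip k u) := by
  have h1 : dist (prismPath u u' t).1 u.1 = t * dist u.1 u'.1 :=
    (convex_polygon m).dist_seg_left t.2
  have h2 : (prismPath u u' t).2 - u.2 = t * (u'.2 - u.2) := by
    change AffineMap.lineMap u.2 u'.2 (t : ℝ) - u.2 = _
    rw [AffineMap.lineMap_apply_ring']
    ring
  have h3 : (t : ℝ) ^ 2 ≤ 1 := pow_le_one₀ t.2.1 t.2.2
  change dist (pt k _ _) (pt k _ _) ≤ dist (pt k _ _) (pt k _ _)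
  rw [dist_pt_same, dist_pt_same, h1, h2, dist_comm u'.1]
  refine Real.sqrt_le_sqrt ?_
  rw [mul_pow, mul_pow, ← mul_add]
  exact mul_le_of_le_one_left (by positivity) h3

/-- A short path is homotopic, in a contractible ball, to a path through the centre of the ball,
each half of which runs straight in one prism. -/
theorem isGenerated (y z : Tower m) (p : Path.Homotopic.Quotient y z) : IsGenerated p := by
  refine induction_of_local (Q := IsGenerated) (fun _ _ _ _ _ hp hq => hp.trans hq) (fun x => ?_) p
  obtain ⟨r, hr, hc, h⟩ := exists_contractible_ball x
  refine ⟨Metric.ball x r, Metric.ball_mem_nhds x hr, fun y z p hp => ?_⟩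
  have : SimplyConnectedSpace (Metric.ball x r) := inferInstance
  have hcv : Continuous (Subtype.val : Metric.ball x r → Tower m) := continuous_subtype_val
  have hy : y ∈ Metric.ball x r := hp ⟨0, p.source⟩
  have hz : z ∈ Metric.ball x r := hp ⟨1, p.target⟩
  have hx : x ∈ Metric.ball x r := Metric.mem_ball_self hr
  have h1 : mk p = (push (⟨Subtype.val, hcv⟩ : C(Metric.ball x r, Tower m)) ⟨y, hy⟩ ⟨x, hx⟩ (y := y) (z := x) rfl rfl).trans (push (⟨Subtype.val, hcv⟩ : C(Metric.ball x r, Tower m)) ⟨x, hx⟩ ⟨z, hz⟩ (y := x) (z := z) rfl rfl) := by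
    rw [push_trans]
    exact (push_val_eq_mk p (fun t => hp ⟨t, rfl⟩) hy hz).symm
  obtain ⟨k, u, u₀, hu, hu₀⟩ := h y hy
  obtain ⟨k', u', u₀', hu', hu₀'⟩ := h z hz
  have h2 : push (⟨Subtype.val, hcv⟩ : C(Metric.ball x r, Tower m)) ⟨y, hy⟩ ⟨x, hx⟩ (y := y) (z := x) rfl rfl = push (strip k) u u₀ hu hu₀ := by
    -- Along a straight path from the centre the distance to the centre is at most that of the end,
    -- so the path stays in the ball and can replace the given half.
    refine push_val_eq (strip k) (prismPath u₀ u).symm (fun t => ?_) hy hx hu hu₀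
    have h3 := dist_strip_prismPath_le k u₀ u (unitInterval.symm t)
    rw [← hu, ← hu₀] at h3
    exact h3.trans_lt hy
  have h3 : push (⟨Subtype.val, hcv⟩ : C(Metric.ball x r, Tower m)) ⟨x, hx⟩ ⟨z, hz⟩ (y := x) (z := z) rfl rfl = push (strip k') u₀' u' hu₀' hu' := by
    refine push_val_eq (strip k') (prismPath u₀' u') (fun t => ?_) hx hz hu₀' hu'
    have h3 := dist_strip_prismPath_le k' u₀' u' t
    rw [← hu', ← hu₀'] at h3
    exact h3.trans_lt hz
  rw [h1, h2, h3]
  exact (isGenerated_push _ _ _ _ _).trans (isGenerated_push _ _ _ _ _)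

theorem conj_cast {X : Type*} [TopologicalSpace X] {b y z : X}
    (c : FundamentalGroupoid.mk b ⟶ FundamentalGroupoid.mk y)
    (d : FundamentalGroupoid.mk b ⟶ FundamentalGroupoid.mk z)
    (γ : Path.Homotopic.Quotient b b) (hy : y = b) (hz : z = b) :
    c ≫ FundamentalGroupoid.fromPath (γ.cast hy hz) ≫ inv d =
      FundamentalGroupoid.fromPath (Path.Homotopic.Quotient.cast c rfl hy.symm) ≫
      FundamentalGroupoid.fromPath γ ≫
      inv (FundamentalGroupoid.fromPath (Path.Homotopic.Quotient.cast d rfl hz.symm)) := by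
  subst hy hz
  simp only [cast_rfl_rfl]

/-- A point of the tower over the base point is a node, so its access path is a node class. -/
theorem access_mem {y : Tower m} (hy : project y = basePoint m) :
    (FundamentalGroup.fromPath (Path.Homotopic.Quotient.cast (access y) rfl hy.symm)) ∈
      (artinHom m).range := by
  have h := (exists_strip y).choose_spec
  have hcast : Path.Homotopic.Quotient.cast (access y) rfl hy.symm =
      push (cstrip (exists_strip y).choose.1) (node m 0) (exists_strip y).choose.2
        (basePoint_eq _ 0) (hy.symm.trans (congrArg project h)) := cast_push _ _ _ _ _ _ _
  rw [hcast]
  generalize hku : (exists_strip y).choose = ku at *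
  obtain ⟨k, z, t⟩ := ku
  have h1 : cpt k z t = cpt 0 (corner m 0) 0 := (congrArg project h).symm.trans hy
  obtain ⟨n, h2, h3, -⟩ := cpt_eq_cpt_iff.1 h1
  rw [rotate_corner, add_zero] at h3
  rw [zero_add] at h2
  subst h2 h3
  exact nodeClass_mem_range k n

/-- The loop is lifted to the tower. Conjugated by the access paths of the ends of the lift it lies
in the range, and these access paths, now loops, lie there too. -/
theorem artinHom_surjective : Function.Surjective (artinHom m) := by
  rw [← MonoidHom.range_eq_top, eq_top_iff]
  intro γ _
  have cov : IsCoveringMap (project (m := m)) := ScrewSpace.isCoveringMap_orbit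
  let e : project (m := m) ⁻¹' {basePoint m} := ⟨strip 0 (node m 0), (basePoint_eq 0 0).symm⟩
  have h1 := isGenerated _ _ (cov.liftPathQuotient γ e)
  have h2 := cov.map_liftPathQuotient γ e
  have h3 : (cov.liftPathQuotient γ e).map project =
      Path.Homotopic.Quotient.cast γ e.2 (cov.monodromy γ e).2 := h2
  rw [IsGenerated, h3] at h1
  have h6 := conj_cast (access e.1) (access (cov.monodromy γ e).1) γ e.2 (cov.monodromy γ e).2
  replace h1 := h6 ▸ h1
  have h4 := access_mem e.2
  have h5 := access_mem (cov.monodromy γ e).2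
  rw [← Groupoid.inv_eq_inv] at h1
  exact (Subgroup.mul_mem_cancel_left _ (inv_mem h5)).1
    ((Subgroup.mul_mem_cancel_right _ h4).1 h1)

end

end RegularPolygon

/-! ### Coverings of the tower -/

namespace RegularPolygon

open Path.Homotopic.Quotient

variable {m : ℕ} [hm : Fact (5 ≤ m)]

/-- Half of the smallest distance of distinct vertices. -/
noncomputable def separation (m : ℕ) [Fact (5 ≤ m)] : ℝ := (exists_separation (m := m)).choose

theorem separation_pos : 0 < separation m := (exists_separation (m := m)).choose_spec.1

theorem two_mul_separation_le {i j : ℤ} (h : corner m j ≠ corner m i) :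
    2 * separation m ≤ dist (corner m j) (corner m i) :=
  (exists_separation (m := m)).choose_spec.2 i j h

/-- A neighbourhood of the vertical line over a vertex. -/
def star (m : ℕ) [Fact (5 ≤ m)] (i : ℤ) : Set (Tower m) :=
  {x | ∃ k z t, x = pt k z t ∧ dist z (corner m i) < separation m}

theorem isOpen_star (i : ℤ) : IsOpen (star m i) := by
  rw [Metric.isOpen_iff]
  rintro _ ⟨k, z, t, rfl, h⟩
  refine ⟨separation m - dist z (corner m i), sub_pos.2 h, fun y hy => ?_⟩
  obtain ⟨k', z', t', rfl⟩ := exists_pt y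
  refine ⟨k', z', t', rfl, ?_⟩
  have h1 := dist_pt_le_dist k' k z' z t' t
  have h2 := Metric.mem_ball.1 hy
  linarith [dist_triangle z' z (corner m i)]

theorem pt_corner_mem_star (k : ZMod 2) (i : ℤ) (t : ℝ) : pt k (corner m i) t ∈ star m i :=
  ⟨k, _, t, rfl, by rw [dist_self]; exact separation_pos⟩

theorem corner_eq_of_mem_star {x : Tower m} {i j : ℤ} (hi : x ∈ star m i) (hj : x ∈ star m j) :
    corner m i = corner m j := by
  obtain ⟨k, z, t, rfl, h⟩ := hi
  obtain ⟨k', z', t', h1, h'⟩ := hj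
  obtain rfl : z = z' := (pt_eq_pt_iff.1 h1).2.1
  by_contra hne
  have := two_mul_separation_le hne
  linarith [dist_triangle_left (corner m i) (corner m j) z]

/-- A neighbourhood of a sheet. -/
def sheetNhd (m : ℕ) [Fact (5 ≤ m)] (k : ZMod 2) : Set (Tower m) :=
  {x | (∃ z t, x = pt k z t) ∨ ∃ i, x ∈ star m i}

/-- A point of the sheet that is not over a vertex has a ball inside the sheet; the other points lie
in an open star. -/
theorem isOpen_sheetNhd (k : ZMod 2) : IsOpen (sheetNhd m k) := by
  rw [isOpen_iff_mem_nhds]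
  have hstar : ∀ i, ∀ x ∈ star m i, sheetNhd m k ∈ 𝓝 x := fun i x hx =>
    mem_of_superset ((isOpen_star i).mem_nhds hx) fun y hy => Or.inr ⟨i, hy⟩
  rintro x (⟨z, t, rfl⟩ | ⟨i, hi⟩)
  · by_cases hz : ∃ i, z = corner m i
    · obtain ⟨i, rfl⟩ := hz
      exact hstar i _ (pt_corner_mem_star k i t)
    · obtain ⟨r, hr, -, h⟩ := exists_isCNOn_ball k z t
      refine mem_of_superset (Metric.ball_mem_nhds _ hr) fun y hy => Or.inl ?_
      obtain ⟨k', z', t', rfl⟩ := exists_pt y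
      obtain rfl := (h k' z' t' hy).resolve_right hz
      exact ⟨z', t', rfl⟩
  · exact hstar i x hi

theorem strip_mem_sheetNhd (k : ZMod 2) (u : polygon m × ℝ) : strip k u ∈ sheetNhd m k :=
  Or.inl ⟨u.1, u.2, rfl⟩

/-- Neighbourhoods of different sheets overlap only in the stars, where the transition functions
will be constant. -/
theorem exists_mem_star {k k' : ZMod 2} (hk : k ≠ k') {x : Tower m} (hx : x ∈ sheetNhd m k)
    (hx' : x ∈ sheetNhd m k') : ∃ i, x ∈ star m i := by
  obtain ⟨z, t, rfl⟩ | h := hx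
  · obtain ⟨z', t', h1⟩ | h := hx'
    · obtain ⟨i, rfl⟩ := (pt_eq_pt_iff.1 h1).2.2.resolve_left hk
      exact ⟨i, pt_corner_mem_star k i t⟩
    · exact h
  · exact h

/-- A family of elements of a group, indexed by the vertices of the polygon. -/
structure Gluing (m : ℕ) (G : Type*) where
  val : ℤ → G
  periodic : ∀ i, val (i + m) = val i

/-! ### The covering of the tower attached to a gluing family -/

namespace Gluing

variable {G : Type*} [Group G] (c : Gluing m G)

omit hm [Group G] in
theorem val_add_mul (i j : ℤ) : c.val (i + m * j) = c.val i := by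
  induction j using Int.induction_on with
  | zero => rw [mul_zero, add_zero]
  | succ j ih => rw [mul_add_one, ← add_assoc, c.periodic, ih]
  | pred j ih => rw [← c.periodic, add_assoc, ← mul_add_one, sub_add_cancel, ih]

omit [Group G] in
theorem val_eq_of_corner_eq {i j : ℤ} (h : corner m i = corner m j) : c.val i = c.val j := by
  obtain ⟨l, hl⟩ := corner_eq_iff.1 h
  rw [← c.val_add_mul j l, ← hl, add_sub_cancel]

open Classical in
/-- The value of the family at the nearest vertex. -/
noncomputable def label (x : Tower m) : G :=
  if h : ∃ i, x ∈ star m i then c.val h.choose else 1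

/-- Stars of distinct vertices are disjoint, and periodicity removes the dependence on the index of
the vertex. -/
theorem label_eq {x : Tower m} {i : ℤ} (h : x ∈ star m i) : c.label x = c.val i := by
  have h' : ∃ i, x ∈ star m i := ⟨i, h⟩
  rw [label, dif_pos h']
  exact c.val_eq_of_corner_eq (corner_eq_of_mem_star h'.choose_spec h)

/-- The gauge transformations. -/
noncomputable def gauge (k : ZMod 2) (x : Tower m) : G := if k = 0 then 1 else c.label x

theorem gauge_eq (k : ZMod 2) {x : Tower m} {i : ℤ} (h : x ∈ star m i) :
    c.gauge k x = if k = 0 then 1 else c.val i := by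
  rw [gauge, c.label_eq h]

variable [TopologicalSpace G] [DiscreteTopology G]

open Classical in
/-- The covering of the tower obtained by gluing copies of the sheets. -/
noncomputable def core : FiberBundleCore (ZMod 2) (Tower m) G where
  baseSet := sheetNhd m
  isOpen_baseSet := isOpen_sheetNhd
  -- Sheet 0 is preferred. In particular points over the vertices, which lie in both sheets, get the
  -- coordinate of sheet 0.
  indexAt x := if ∃ u, x = strip 0 u then 0 else 1
  mem_baseSet_at x := by
    split_ifs with h
    · obtain ⟨u, rfl⟩ := h
      exact strip_mem_sheetNhd 0 u
    · obtain ⟨k, z, t, rfl⟩ := exists_pt x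
      rcases (by decide : ∀ k : ZMod 2, k = 0 ∨ k = 1) k with rfl | rfl
      · exact absurd ⟨(z, t), rfl⟩ h
      · exact Or.inl ⟨z, t, rfl⟩
  -- Written as a quotient of gauges, the transition satisfies the cocycle identities automatically;
  -- left multiplication by the value at the vertex leads from sheet 0 to sheet 1.
  coordChange k k' x g := c.gauge k' x * (c.gauge k x)⁻¹ * g
  coordChange_self k x _ g := by rw [mul_inv_cancel, one_mul]
  continuousOn_coordChange k k' := by
    rintro ⟨x, g⟩ ⟨⟨hx, hx'⟩, -⟩
    refine ContinuousAt.continuousWithinAt ?_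
    by_cases hk : k = k'
    · subst hk
      simp only [mul_inv_cancel, one_mul]
      exact continuousAt_snd
    · obtain ⟨i, hi⟩ := exists_mem_star hk hx hx'
      have h : ContinuousAt (fun p : Tower m × G => c.gauge k' x * (c.gauge k x)⁻¹ * p.2) (x, g) :=
        ((continuous_of_discreteTopology (f := fun g : G =>
          c.gauge k' x * (c.gauge k x)⁻¹ * g)).comp continuous_snd).continuousAt
      refine h.congr ?_
      filter_upwards [prod_mem_nhds ((isOpen_star i).mem_nhds hi) (univ_mem (f := 𝓝 g))] with p hp
      rw [c.gauge_eq k hi, c.gauge_eq k' hi, c.gauge_eq k hp.1, c.gauge_eq k' hp.1]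
  coordChange_comp k k' k'' x _ g := by group

/-- The total space of the covering. -/
abbrev Total : Type _ := Bundle.TotalSpace G c.core.Fiber

theorem isCoveringMap_proj : IsCoveringMap (Bundle.TotalSpace.proj : c.Total → Tower m) :=
  FiberBundle.isCoveringMap

/-- The projection from the covering to the tower. -/
def proj : C(c.Total, Tower m) := ⟨Bundle.TotalSpace.proj, c.core.continuous_proj⟩

/-- The lifts of the prisms. -/
noncomputable def lift (k : ZMod 2) (g : G) : C(polygon m × ℝ, c.Total) where
  toFun u := (c.core.localTriv k).toOpenPartialHomeomorph.symm (strip k u, g)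
  continuous_toFun := by
    refine (c.core.localTriv k).toOpenPartialHomeomorph.continuousOn_symm.comp_continuous
      ((strip k).continuous.prodMk continuous_const) fun u => ?_
    exact (c.core.localTriv k).mem_target.2 (strip_mem_sheetNhd k u)

/-- The points over the base point. -/
noncomputable def above (n : ℤ) (g : G) : c.Total := ⟨strip 0 (node m n), g⟩

/-- The gauge transformations at the vertices. -/
def jump (k : ZMod 2) (n : ℤ) : G := if k = 0 then 1 else c.val n

omit hm in
theorem strip_node (k k' : ZMod 2) (n : ℤ) : strip k (node m n) = strip k' (node m n) :=
  pt_corner _ _ _ _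

/-- Points over nodes carry the coordinate of sheet 0; read in sheet `k`, this coordinate is
multiplied by the jump. -/
theorem above_eq_lift (k : ZMod 2) (n : ℤ) (g : G) :
    c.above n g = c.lift k (c.jump k n * g) (node m n) := by
  have h1 : c.lift k (c.jump k n * g) (node m n) = ⟨strip k (node m n), c.core.coordChange k
    (c.core.indexAt (strip k (node m n))) (strip k (node m n)) (c.jump k n * g)⟩ := rfl
  have h2 : c.core.indexAt (strip k (node m n)) = 0 :=
    if_pos ⟨node m n, strip_node k 0 n⟩
  have h3 : c.gauge k (strip k (node m n)) = c.jump k n := c.gauge_eq k (pt_corner_mem_star k n _)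
  have h4 : c.core.coordChange k 0 (strip k (node m n)) (c.jump k n * g) = g := by
    change c.gauge 0 _ * (c.gauge k _)⁻¹ * _ = g
    rw [h3, gauge, if_pos rfl, one_mul, inv_mul_cancel_left]
  rw [h1, h2, h4, above, strip_node k 0]

/-- The projection from the covering to the complex. -/
noncomputable def toComplex : C(c.Total, ArtinComplex m) := project.comp c.proj

theorem toComplex_above (n : ℤ) (g : G) : c.toComplex (c.above n g) = basePoint m :=
  (basePoint_eq 0 n).symm

/-- The given element of the fundamental group lifts to a path which ends at the given point. -/
def Reaches (n : ℤ) (g : G) (γ : FundamentalGroup (ArtinComplex m) (basePoint m)) : Prop :=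
  ∃ Γ : Path.Homotopic.Quotient (c.above 0 1) (c.above n g), Γ.map c.toComplex =
    Path.Homotopic.Quotient.cast γ (c.toComplex_above 0 1) (c.toComplex_above n g)

theorem reaches_zero : c.Reaches 0 1 1 := by
  refine ⟨refl _, ?_⟩
  have h : ∀ {X : Type} [TopologicalSpace X] {x y : X} (h : y = x),
      refl y = (refl x).cast h h := by
    rintro X _ x _ rfl
    rw [cast_rfl_rfl]
  exact h _

/-- A path in the prism `k` lifts with constant coordinate in that sheet: convert into sheet `k` at
node `n`, move, and convert back at node `l`. -/
theorem Reaches.step {n : ℤ} {g : G} {γ : FundamentalGroup (ArtinComplex m) (basePoint m)}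
    (h : c.Reaches n g γ) (k : ZMod 2) (l : ℤ) :
    c.Reaches l ((c.jump k l)⁻¹ * (c.jump k n * g)) (nodeClass k n l * γ) := by
  obtain ⟨Γ, hΓ⟩ := h
  have h1 := c.above_eq_lift k l ((c.jump k l)⁻¹ * (c.jump k n * g))
  rw [mul_inv_cancel_left] at h1
  refine ⟨Γ.trans (push (c.lift k (c.jump k n * g)) (node m n) (node m l)
    (c.above_eq_lift k n g) h1), ?_⟩
  have h2 : (push (c.lift k (c.jump k n * g)) (node m n) (node m l)
      (c.above_eq_lift k n g) h1).map c.toComplex = Path.Homotopic.Quotient.cast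
      (nodeClass k n l) (c.toComplex_above n g) (c.toComplex_above l _) := by
    rw [map_push, nodeClass, cast_push]
    exact push_congr (fun u => rfl) _ _ _ _
  rw [map_trans, hΓ, h2, cast_trans, FundamentalGroup.mul_def]

/-- Unique lifting is used twice. From the complex to the tower it shows that the projected path is
a trivial loop, whence `n = 0` by the height; from the tower to its covering it gives `g = 1`. -/
theorem eq_of_reaches_one {n : ℤ} {g : G} (h : c.Reaches n g 1) : n = 0 ∧ g = 1 := by
  obtain ⟨Γ, hΓ⟩ := h
  have cov : IsCoveringMap (project (m := m)) := ScrewSpace.isCoveringMap_orbit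
  have hΓ' : (Γ.map c.proj).map project =
    (Path.Homotopic.Quotient.refl (basePoint m)).cast (c.toComplex_above 0 1) (c.toComplex_above n g) :=
    map_comp.symm.trans hΓ
  have h1 := cov.monodromy_eq_of_map_eq (γ := Path.Homotopic.Quotient.refl (basePoint m))
    (ex := ⟨strip 0 (node m 0), c.toComplex_above 0 1⟩)
    (ey := ⟨strip 0 (node m n), c.toComplex_above n g⟩) (Γ.map c.proj) hΓ'
  rw [cov.monodromy_refl] at h1
  have h2 := (strip_eq_strip_iff.1 (congrArg Subtype.val h1)).1
  have h3 : ((0 : ℤ) : ℝ) * (7 / 25) = n * (7 / 25) := congrArg Prod.snd h2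
  obtain rfl : n = 0 := by
    have : ((0 : ℤ) : ℝ) = n := mul_right_cancel₀ (by norm_num) h3
    exact_mod_cast this.symm
  refine ⟨rfl, ?_⟩
  have h4 : Γ.map c.proj = Path.Homotopic.Quotient.refl (strip 0 (node m 0)) := by
    refine cov.injective_path_homotopic_map _ _ (hΓ'.trans ?_)
    have h : ∀ {X : Type} [TopologicalSpace X] {x y : X} (h : y = x),
        (Path.Homotopic.Quotient.refl x).cast h h = Path.Homotopic.Quotient.refl y := by
      rintro X _ x _ rfl
      rw [cast_rfl_rfl]
    exact h _
  have h5 := c.isCoveringMap_proj.monodromy_eq_of_map_eq (γ := Path.Homotopic.Quotient.refl (strip 0 (node m 0)))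
    (ex := ⟨c.above 0 1, rfl⟩) (ey := ⟨c.above 0 g, rfl⟩) Γ
    (h4.trans (cast_rfl_rfl _).symm)
  rw [c.isCoveringMap_proj.monodromy_refl] at h5
  have h6 : c.above 0 1 = c.above 0 g := congrArg Subtype.val h5
  exact (eq_of_heq (Bundle.TotalSpace.mk.inj h6).2).symm

end Gluing

end RegularPolygon

/-! ### The dihedral Artin groups -/

theorem altWord_two_mul {G : Type*} [Monoid G] (x y : G) (n : ℕ) :
    altWord x y (2 * n) = (x * y) ^ n := by
  induction n with
  | zero => rw [mul_zero, altWord, pow_zero]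
  | succ n ih => rw [mul_add_one, altWord, altWord, ih, pow_succ', mul_assoc]

theorem altWord_two_mul_add_one {G : Type*} [Monoid G] (x y : G) (n : ℕ) :
    altWord x y (2 * n + 1) = x * (y * x) ^ n := by
  rw [altWord, altWord_two_mul]

theorem mul_pow_mul_comm {G : Type*} [Monoid G] (x y : G) (n : ℕ) :
    x * (y * x) ^ n = (x * y) ^ n * x := by
  induction n with
  | zero => rw [pow_zero, pow_zero, mul_one, one_mul]
  | succ n ih => rw [pow_succ, ← mul_assoc, ih, pow_succ]; simp only [mul_assoc]

namespace DihedralArtinGroup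

variable (m : ℕ)

theorem relation : altWord (a m) (b m) m = altWord (b m) (a m) m := by
  rw [← mul_inv_eq_one]
  have h := PresentedGroup.one_of_mem (rels := ({altWord (FreeGroup.of 0) (FreeGroup.of 1) m *
      (altWord (FreeGroup.of 1) (FreeGroup.of 0) m)⁻¹} : Set (FreeGroup (Fin 2)))) rfl
  rw [map_mul, map_inv, map_altWord, map_altWord] at h
  exact h

/-- The homomorphism to `ℤ` which maps the generators to `1`. -/
def degree : DihedralArtinGroup m →* Multiplicative ℤ :=
  PresentedGroup.toGroup (f := fun _ => Multiplicative.ofAdd 1) (by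
    rintro _ rfl
    rw [map_mul, map_inv, map_altWord, map_altWord, FreeGroup.lift_apply_of,
      FreeGroup.lift_apply_of, mul_inv_cancel])

theorem zpow_injective {g : DihedralArtinGroup m} (h : degree m g = Multiplicative.ofAdd 1) {n : ℤ}
    (hn : g ^ n = 1) : n = 0 := by
  have h1 := congrArg (fun x => Multiplicative.toAdd (degree m x)) hn
  simpa [h] using h1

theorem degree_a : degree m (a m) = Multiplicative.ofAdd 1 := PresentedGroup.toGroup.of _

theorem degree_b : degree m (b m) = Multiplicative.ofAdd 1 := PresentedGroup.toGroup.of _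

/-- The conjugates of the generators under the powers of `b a`. -/
def conjugate (n : ℤ) : DihedralArtinGroup m :=
  (b m * a m) ^ (-(n / 2)) * (if Even n then b m else a m) * (b m * a m) ^ (n / 2)

/-- Representatives of the cosets of the free subgroup generated by loops in the polygons. -/
def transversal (n : ℤ) : DihedralArtinGroup m :=
  (if Even n then 1 else a m) * (b m * a m) ^ (n / 2)

theorem conjugate_two_mul (n : ℤ) :
    conjugate m (2 * n) = (b m * a m) ^ (-n) * b m * (b m * a m) ^ n := by
  rw [conjugate, if_pos (even_two_mul n), Int.mul_ediv_cancel_left _ two_ne_zero]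

theorem conjugate_two_mul_add_one (n : ℤ) :
    conjugate m (2 * n + 1) = (b m * a m) ^ (-n) * a m * (b m * a m) ^ n := by
  rw [conjugate, if_neg (Int.not_even_two_mul_add_one n), show (2 * n + 1) / 2 = n by omega]

theorem transversal_two_mul (n : ℤ) : transversal m (2 * n) = (b m * a m) ^ n := by
  rw [transversal, if_pos (even_two_mul n), Int.mul_ediv_cancel_left _ two_ne_zero, one_mul]

theorem transversal_two_mul_add_one (n : ℤ) :
    transversal m (2 * n + 1) = a m * (b m * a m) ^ n := by
  rw [transversal, if_neg (Int.not_even_two_mul_add_one n), show (2 * n + 1) / 2 = n by omega]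

theorem transversal_zero : transversal m 0 = 1 := by
  rw [transversal, if_pos Even.zero, one_mul, Int.zero_ediv, zpow_zero]

/-- With the values b at 0 and a at 1, this recursion determines the whole sequence. These are the
dual generators of the Artin group. -/
theorem conjugate_mul_conjugate_succ (n : ℤ) :
    conjugate m n * conjugate m (n + 1) = b m * a m := by
  obtain ⟨n, rfl | rfl⟩ := Int.even_or_odd' n
  · rw [conjugate_two_mul, conjugate_two_mul_add_one]
    have h : ∀ x y : DihedralArtinGroup m,
        (x * y) ^ (-n) * x * (x * y) ^ n * ((x * y) ^ (-n) * y * (x * y) ^ n) = x * y := by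
      intro x y
      rw [zpow_neg]
      have : ((x * y) ^ n)⁻¹ * (x * y) * (x * y) ^ n = x * y := by
        rw [mul_assoc, (Commute.self_zpow (x * y) n).eq, inv_mul_cancel_left]
      refine Eq.trans ?_ this
      generalize (x * y) ^ n = z
      group
    exact h _ _
  · rw [conjugate_two_mul_add_one, show 2 * n + 1 + 1 = 2 * (n + 1) by ring, conjugate_two_mul]
    have h : ∀ x y : DihedralArtinGroup m,
        (x * y) ^ (-n) * y * (x * y) ^ n * ((x * y) ^ (-(n + 1)) * x * (x * y) ^ (n + 1)) =
          x * y := by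
      intro x y
      rw [zpow_neg, zpow_neg, zpow_add_one]
      have h1 : ((x * y) ^ n * (x * y))⁻¹ = (x * y * (x * y) ^ n)⁻¹ := by
        rw [(Commute.self_zpow (x * y) n).eq]
      rw [h1]
      generalize (x * y) ^ n = z
      group
    exact h _ _

/-- Here the defining relation enters. For m = 2n it makes b commute with (ba)ⁿ; for m = 2n + 1 it
reads a (ba)ⁿ = (ba)ⁿ b. -/
theorem conjugate_natCast : conjugate m m = b m := by
  have hr := relation m
  obtain ⟨n, hn | hn⟩ := Nat.even_or_odd' m
  · have h1 : (m : ℤ) = 2 * n := by exact_mod_cast hn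
    rw [h1, conjugate_two_mul, zpow_neg, zpow_natCast, mul_assoc, inv_mul_eq_iff_eq_mul]
    have h2 : ∀ x y : DihedralArtinGroup m, altWord x y m = (x * y) ^ n := fun x y =>
      (congrArg (altWord x y) hn).trans (altWord_two_mul x y n)
    rw [h2, h2] at hr
    rw [← hr, mul_pow_mul_comm (b m), hr]
  · have h1 : (m : ℤ) = 2 * n + 1 := by exact_mod_cast hn
    rw [h1, conjugate_two_mul_add_one, zpow_neg, zpow_natCast, mul_assoc, inv_mul_eq_iff_eq_mul]
    have h2 : ∀ x y : DihedralArtinGroup m, altWord x y m = x * (y * x) ^ n := fun x y =>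
      (congrArg (altWord x y) hn).trans (altWord_two_mul_add_one x y n)
    rw [h2, h2, mul_pow_mul_comm (b m)] at hr
    rw [hr, ← mul_pow_mul_comm, mul_pow_mul_comm]

/-- The period at index 0 spreads to all indices because consecutive products are constant. -/
theorem conjugate_add (i : ℤ) : conjugate m (i + m) = conjugate m i := by
  have h := conjugate_mul_conjugate_succ m
  induction i using Int.induction_on with
  | zero =>
    rw [zero_add, conjugate_natCast]
    simp [conjugate]
  | succ i ih =>
    have h1 := h (i + m)
    rw [ih, ← h i, mul_right_inj] at h1
    rw [← h1]
    congr 1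
    ring
  | pred i ih =>
    have h1 := h (-i - 1 + m)
    rw [show -i - 1 + m + 1 = -i + (m : ℤ) by ring, ih, ← h (-i - 1), sub_add_cancel,
      mul_left_inj] at h1
    exact h1

/-- The standard generators, indexed by the sheets. -/
def gen (k : ZMod 2) : DihedralArtinGroup m := if k = 0 then a m else b m

end DihedralArtinGroup

/-! ### Injectivity of the homomorphism -/

namespace RegularPolygon

open DihedralArtinGroup

variable {m : ℕ} [hm : Fact (5 ≤ m)]

/-- The gluing of sheets which yields the universal covering. -/
def universalGluing (m : ℕ) : Gluing m (DihedralArtinGroup m) := ⟨conjugate m, conjugate_add m⟩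

theorem artinHom_gen (k : ZMod 2) : artinHom m (gen m k) = edgeClass k := by
  rcases (by decide : ∀ k : ZMod 2, k = 0 ∨ k = 1) k with rfl | rfl
  · exact artinHom_a
  · exact artinHom_b

-- This identity makes a step of the lift from node `n` to node `n + 1` in sheet `k` correspond to
-- left multiplication by the generator of the sheet `k - n`.
omit hm in
theorem transversal_succ (k : ZMod 2) (n : ℤ) :
    transversal m (n + 1) * ((universalGluing m).jump k (n + 1))⁻¹ =
      gen m (k - n) * (transversal m n * ((universalGluing m).jump k n)⁻¹) := by
  have h2 : (2 : ZMod 2) = 0 := rfl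
  obtain ⟨n, rfl | rfl⟩ := Int.even_or_odd' n <;>
    rcases (by decide : ∀ k : ZMod 2, k = 0 ∨ k = 1) k with rfl | rfl <;>
    push_cast <;> simp only [h2, zero_mul, Gluing.jump, gen, universalGluing]
  · rw [transversal_two_mul, transversal_two_mul_add_one]
    simp
  · rw [transversal_two_mul, transversal_two_mul_add_one, conjugate_two_mul,
      conjugate_two_mul_add_one]
    simp [mul_assoc]
  · rw [transversal_two_mul_add_one, show 2 * n + 1 + 1 = 2 * (n + 1) by ring,
      transversal_two_mul]
    have : (b m * a m) ^ (n + 1) = b m * a m * (b m * a m) ^ n := by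
      rw [add_comm, zpow_add, zpow_one]
    simp [this, mul_assoc]
  · rw [transversal_two_mul_add_one, show 2 * n + 1 + 1 = 2 * (n + 1) by ring,
      transversal_two_mul, conjugate_two_mul, conjugate_two_mul_add_one]
    have : (b m * a m) ^ (n + 1) = b m * a m * (b m * a m) ^ n := by
      rw [add_comm, zpow_add, zpow_one]
    simp only [zpow_neg, this]
    simp [mul_assoc]

section

variable [TopologicalSpace (DihedralArtinGroup m)] [DiscreteTopology (DihedralArtinGroup m)]

theorem exists_reaches_mul {g : DihedralArtinGroup m} (k : ZMod 2)
    (h : ∃ n, (universalGluing m).Reaches n ((transversal m n)⁻¹ * g) (artinHom m g)) :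
    ∃ n, (universalGluing m).Reaches n ((transversal m n)⁻¹ * (gen m k * g))
      (artinHom m (gen m k * g)) := by
  obtain ⟨n, h⟩ := h
  refine ⟨n + 1, ?_⟩
  -- The sheet `k + n` is chosen so that the step from node `n` to node `n + 1` projects to the edge
  -- of sheet `k`.
  have h1 := Gluing.Reaches.step (universalGluing m) h (k + n : ZMod 2) (n + 1)
  have h2 := transversal_succ (m := m) (k + n : ZMod 2) n
  rw [nodeClass_succ, nodeClass_self, mul_one, add_sub_cancel_right, ← artinHom_gen,
    ← map_mul] at h1
  rw [add_sub_cancel_right] at h2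
  convert h1 using 1
  have h3 : gen m k = transversal m (n + 1) * ((universalGluing m).jump (k + n : ZMod 2) (n + 1))⁻¹ *
      (transversal m n * ((universalGluing m).jump (k + n : ZMod 2) n)⁻¹)⁻¹ := by
    rw [h2, mul_inv_cancel_right]
  rw [h3]
  group

theorem exists_reaches_inv_mul {g : DihedralArtinGroup m} (k : ZMod 2)
    (h : ∃ n, (universalGluing m).Reaches n ((transversal m n)⁻¹ * g) (artinHom m g)) :
    ∃ n, (universalGluing m).Reaches n ((transversal m n)⁻¹ * ((gen m k)⁻¹ * g))
      (artinHom m ((gen m k)⁻¹ * g)) := by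
  obtain ⟨n, h⟩ := h
  refine ⟨n - 1, ?_⟩
  have h1 := Gluing.Reaches.step (universalGluing m) h (k + (n - 1 : ℤ) : ZMod 2) (n - 1)
  have h2 := transversal_succ (m := m) (k + (n - 1 : ℤ) : ZMod 2) (n - 1)
  have h4 : nodeClass (k + (n - 1 : ℤ) : ZMod 2) n (n - 1) = (artinHom m (gen m k))⁻¹ := by
    rw [eq_inv_iff_mul_eq_one, artinHom_gen]
    have h5 := nodeClass_succ (m := m) (k + (n - 1 : ℤ) : ZMod 2) (n - 1) (n - 1)
    rw [nodeClass_self, mul_one, add_sub_cancel_right, sub_add_cancel] at h5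
    rw [← h5, nodeClass_mul, nodeClass_self]
  rw [h4, ← map_inv, ← map_mul] at h1
  rw [add_sub_cancel_right, sub_add_cancel] at h2
  convert h1 using 1
  have h3 : gen m k = transversal m n * ((universalGluing m).jump (k + (n - 1 : ℤ) : ZMod 2) n)⁻¹ *
      (transversal m (n - 1) * ((universalGluing m).jump (k + (n - 1 : ℤ) : ZMod 2) (n - 1))⁻¹)⁻¹ := by
    rw [h2, mul_inv_cancel_right]
  rw [h3]
  group

/-- Induction on a word for `g`: each letter or inverse letter moves the end of the lift by one
node. The transversal accounts for the node reached, so the end of the lift recovers `g`. -/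
theorem exists_reaches (g : DihedralArtinGroup m) :
    ∃ n, (universalGluing m).Reaches n ((transversal m n)⁻¹ * g) (artinHom m g) := by
  have hg : g ∈ Subgroup.closure (range (PresentedGroup.of (rels :=
    ({altWord (FreeGroup.of 0) (FreeGroup.of 1) m *
      (altWord (FreeGroup.of 1) (FreeGroup.of 0) m)⁻¹} : Set (FreeGroup (Fin 2)))))) := by
    rw [PresentedGroup.closure_range_of]
    trivial
  have hgen : ∀ i : Fin 2, ∃ k, PresentedGroup.of i = gen m k := by
    intro i
    fin_cases i
    exacts [⟨0, rfl⟩, ⟨1, rfl⟩]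
  induction hg using Subgroup.closure_induction_left with
  | one =>
    refine ⟨0, ?_⟩
    have h := (universalGluing m).reaches_zero
    rw [map_one, mul_one, transversal_zero, inv_one]
    exact h
  | mul_left x hx y hy ih =>
    obtain ⟨i, rfl⟩ := hx
    obtain ⟨k, hk⟩ := hgen i
    rw [hk]
    exact exists_reaches_mul k ih
  | inv_mul_cancel x hx y hy ih =>
    obtain ⟨i, rfl⟩ := hx
    obtain ⟨k, hk⟩ := hgen i
    rw [hk]
    exact exists_reaches_inv_mul k ih

end

theorem artinHom_injective : Function.Injective (artinHom m) := by
  let _ : TopologicalSpace (DihedralArtinGroup m) := ⊥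
  have : DiscreteTopology (DihedralArtinGroup m) := ⟨rfl⟩
  rw [injective_iff_map_eq_one]
  intro g hg
  obtain ⟨n, h⟩ := exists_reaches g
  rw [hg] at h
  obtain ⟨rfl, h1⟩ := Gluing.eq_of_reaches_one _ h
  rwa [transversal_zero, inv_one, one_mul] at h1

/-- The fundamental group of the complex is the dihedral Artin group. -/
noncomputable def artinEquiv (m : ℕ) [Fact (5 ≤ m)] :
    DihedralArtinGroup m ≃* FundamentalGroup (ArtinComplex m) (basePoint m) :=
  MulEquiv.ofBijective (artinHom m) ⟨artinHom_injective, artinHom_surjective⟩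

end RegularPolygon

/-! ### The fundamental group of a simple loop -/

theorem Path.Homotopic.Quotient.push_eq_of_map_eq {A Y : Type*} [TopologicalSpace A]
    [TopologicalSpace Y] [SimplyConnectedSpace A] (f : C(A, Y)) {u u' : A}
    (p : Path.Homotopic.Quotient u u') {y z : Y} (q : Path.Homotopic.Quotient y z) (hy : y = f u)
    (hz : z = f u') (h : p.map f = q.cast hy.symm hz.symm) : push f u u' hy hz = q := by
  subst hy hz
  rw [push_eq f p, h, cast_rfl_rfl, cast_rfl_rfl]

namespace Path

open Path.Homotopic.Quotient

variable {X : Type*} [MetricSpace X] {x : X} (γ : Path x x)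

/-- A loop, as a map from a circle to its range. -/
noncomputable def circleMap : AddCircle (1 : ℝ) → range γ :=
  AddCircle.liftIco 1 0 fun t => ⟨γ.extend t, γ.extend_range ▸ mem_range_self t⟩

theorem circleMap_coe (t : ℝ) : (γ.circleMap t : X) = γ.around t := by
  have h : ((Int.fract t : ℝ) : AddCircle (1 : ℝ)) = t := by
    rw [← sub_eq_zero, ← AddCircle.coe_sub, AddCircle.coe_eq_zero_iff]
    refine ⟨-⌊t⌋, ?_⟩
    rw [← Int.self_sub_floor, zsmul_one]
    push_cast
    ring
  rw [← h, circleMap, AddCircle.liftIco_zero_coe_apply ⟨Int.fract_nonneg t, Int.fract_lt_one t⟩]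
  rfl

theorem continuous_circleMap : Continuous γ.circleMap := by
  refine AddCircle.liftIco_continuous ?_ (γ.continuous_extend.subtype_mk _).continuousOn
  refine Subtype.ext ?_
  change γ.extend 0 = γ.extend (0 + 1)
  rw [zero_add, Path.extend_zero, Path.extend_one]

theorem surjective_circleMap : Function.Surjective γ.circleMap := by
  rintro ⟨_, t, rfl⟩
  refine ⟨(t : ℝ), Subtype.ext ?_⟩
  rw [circleMap_coe, around_eq γ t.2, Path.extend_apply _ t.2]

variable {γ} (hγ : InjOn γ.around (Ico 0 1))
include hγ

theorem injective_circleMap : Function.Injective γ.circleMap := by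
  have key : ∀ y : AddCircle (1 : ℝ), ∃ t ∈ Ico (0 : ℝ) 1, y = t := fun y =>
    ⟨AddCircle.equivIco 1 0 y, by simpa using (AddCircle.equivIco 1 0 y).2,
      (AddCircle.equivIco 1 0).symm_apply_apply y |>.symm⟩
  intro y z h
  obtain ⟨s, hs, rfl⟩ := key y
  obtain ⟨t, ht, rfl⟩ := key z
  have h1 := congrArg Subtype.val h
  rw [circleMap_coe, circleMap_coe] at h1
  rw [hγ hs ht h1]

/-- A continuous bijection from the compact circle to a Hausdorff space is a homeomorphism, so the
covering of the circle by the line carries over. -/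
theorem isCoveringMap_circleMap :
    IsCoveringMap (γ.circleMap ∘ ((↑) : ℝ → AddCircle (1 : ℝ))) := by
  let e := Continuous.homeoOfEquivCompactToT2
    (f := Equiv.ofBijective γ.circleMap ⟨injective_circleMap hγ, surjective_circleMap γ⟩)
    (continuous_circleMap γ)
  exact (AddCircle.isCoveringMap_coe (1 : ℝ)).homeomorph_comp e

/-- The fundamental group of a simple loop is generated by the loop. -/
theorem exists_zpow_eq (h : x ∈ range γ) :
    ∃ δ : FundamentalGroup (range γ) ⟨x, h⟩,
      fundamentalGroupInclusion (range γ) x h δ =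
        FundamentalGroup.fromPath (Path.Homotopic.Quotient.mk γ) ∧
      ∀ α, ∃ n : ℤ, α = δ ^ n := by
  have cov := isCoveringMap_circleMap hγ
  let q : C(ℝ, range γ) := ⟨γ.circleMap ∘ ((↑) : ℝ → AddCircle (1 : ℝ)), cov.continuous⟩
  have hq : ∀ t, (q t : X) = γ.around t := circleMap_coe γ
  have hint : ∀ n : ℤ, (⟨x, h⟩ : range γ) = q n := by
    intro n
    refine Subtype.ext ?_
    rw [hq, ← zero_add (n : ℝ), around_add_intCast, around_eq γ ⟨le_rfl, zero_le_one⟩,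
      Path.extend_zero]
  let P : ℤ → ℤ → FundamentalGroup (range γ) ⟨x, h⟩ := fun i j =>
    push q (i : ℝ) (j : ℝ) (hint i) (hint j)
  have hmul : ∀ i j l, P j l * P i j = P i l := fun i j l => push_trans q _ _ _ _ _ _
  have hself : ∀ i, P i i = 1 := fun i => push_self q _ _
  have hshift : ∀ n : ℤ, P n (n + 1) = P 0 1 := by
    intro n
    let e : C(ℝ, ℝ) := ⟨fun t => t + n, continuous_id.add continuous_const⟩
    have he : ∀ t, q.comp e t = q t := fun t => Subtype.ext (by
      rw [ContinuousMap.comp_apply, hq, hq]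
      exact around_add_intCast γ t n)
    have h0 : (n : ℝ) = e ((0 : ℤ) : ℝ) := by simp [e]
    have h1 : ((n + 1 : ℤ) : ℝ) = e ((1 : ℤ) : ℝ) := by simp [e, add_comm]
    change push q _ _ _ _ = push q _ _ _ _
    rw [push_congr_points q h0 h1, push_comp, push_congr he]
  have hpow : ∀ n : ℤ, P 0 n = P 0 1 ^ n := by
    intro n
    induction n using Int.induction_on with
    | zero => rw [hself, zpow_zero]
    | succ n ih => rw [← hmul 0 n, hshift, ih, add_comm, zpow_add, zpow_one]
    | pred n ih =>
      have h1 := hmul 0 (-n - 1) (-n)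
      have h2 := hshift (-n - 1)
      rw [sub_add_cancel] at h2
      rw [h2, ih] at h1
      rw [eq_inv_mul_of_mul_eq h1, ← zpow_neg_one, ← zpow_add, neg_add_eq_sub]
  refine ⟨P 0 1, ?_, fun α => ?_⟩
  · let p : Path ((0 : ℤ) : ℝ) ((1 : ℤ) : ℝ) :=
      ⟨⟨Subtype.val, continuous_subtype_val⟩, by simp, by simp⟩
    have h1 : (push q ((0 : ℤ) : ℝ) ((1 : ℤ) : ℝ) (hint 0) (hint 1)).map
        (⟨Subtype.val, continuous_subtype_val⟩ : C(range γ, X)) = Path.Homotopic.Quotient.mk γ := by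
      rw [map_push]
      refine push_eq_mk _ p γ fun t => ?_
      refine Eq.trans ?_ (hq t).symm
      rw [around_eq γ t.2, Path.extend_apply _ t.2]
    exact h1
  -- An arbitrary class is lifted to the line from 0; its end is an integer, and the line being
  -- simply connected, this integer determines the class.
  · let e : (γ.circleMap ∘ ((↑) : ℝ → AddCircle (1 : ℝ))) ⁻¹' {(⟨x, h⟩ : range γ)} :=
      ⟨((0 : ℤ) : ℝ), (hint 0).symm⟩
    have h1 := cov.map_liftPathQuotient α e
    have h2 := (cov.monodromy α e).2
    obtain ⟨n, hn⟩ : ∃ n : ℤ, (n : ℝ) = (cov.monodromy α e : ℝ) := by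
      have h3 : γ.circleMap ((cov.monodromy α e : ℝ) : AddCircle (1 : ℝ)) =
        γ.circleMap (((0 : ℤ) : ℝ) : AddCircle (1 : ℝ)) := h2.trans (hint 0)
      have h4 := injective_circleMap hγ h3
      rw [Int.cast_zero, AddCircle.coe_zero, AddCircle.coe_eq_zero_iff] at h4
      obtain ⟨n, hn⟩ := h4
      exact ⟨n, by rw [← hn, zsmul_one]⟩
    refine ⟨n, ?_⟩
    rw [← hpow]
    have h3 : push q _ _ (hint 0) h2.symm = α :=
      push_eq_of_map_eq q (cov.liftPathQuotient α e) α (hint 0) h2.symm h1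
    refine h3.symm.trans ?_
    change push q _ _ _ _ = push q _ _ _ _
    rw [push_congr_points q rfl hn.symm]

/-- The fundamental group of the image is cyclic with a generator mapping to the loop, and the loop
has infinite order in the ambient group. -/
theorem fundamentalGroupInclusion_range
    (hinf : ∀ n : ℤ, (FundamentalGroup.fromPath (Path.Homotopic.Quotient.mk γ)) ^ n = 1 → n = 0)
    (h : x ∈ range γ) :
    Function.Injective (fundamentalGroupInclusion (range γ) x h) ∧
    (fundamentalGroupInclusion (range γ) x h).range =
      Subgroup.zpowers (FundamentalGroup.fromPath (Path.Homotopic.Quotient.mk γ)) := by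
  obtain ⟨δ, h1, h2⟩ := exists_zpow_eq hγ h
  constructor
  · rw [injective_iff_map_eq_one]
    intro α hα
    obtain ⟨n, rfl⟩ := h2 α
    rw [map_zpow, h1] at hα
    rw [hinf n hα, zpow_zero]
  · ext β
    rw [MonoidHom.mem_range, Subgroup.mem_zpowers_iff]
    constructor
    · rintro ⟨α, rfl⟩
      obtain ⟨n, rfl⟩ := h2 α
      exact ⟨n, by rw [map_zpow, h1]⟩
    · rintro ⟨n, rfl⟩
      exact ⟨δ ^ n, by rw [map_zpow, h1]⟩

end Path

/-! ### The piecewise Euclidean structure -/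

/-- The segment from `v` to the relatively interior point `u` can be prolonged slightly beyond `u`
within the affine span while staying in `F`. -/
theorem exists_mem_openSegment {V : Type*} [NormedAddCommGroup V] [NormedSpace ℝ V] {F : Set V}
    {u v : V} (hu : u ∈ intrinsicInterior ℝ F) (hv : v ∈ F) :
    ∃ v' ∈ F, u ∈ openSegment ℝ v v' := by
  obtain ⟨y, hy, rfl⟩ := mem_intrinsicInterior.1 hu
  let f : ℝ → affineSpan ℝ F := fun t =>
    ⟨AffineMap.lineMap v (y : V) t, AffineMap.lineMap_mem t (subset_affineSpan ℝ F hv) y.2⟩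
  have hf : Continuous f := AffineMap.lineMap_continuous.subtype_mk _
  have h1 : f 1 = y := Subtype.ext (AffineMap.lineMap_apply_one _ _)
  have h2 : ∀ᶠ t in 𝓝[>] (1 : ℝ), f t ∈ interior ((↑) ⁻¹' F : Set (affineSpan ℝ F)) :=
    nhdsWithin_le_nhds (hf.continuousAt.eventually_mem (by
      rw [h1]
      exact isOpen_interior.mem_nhds hy))
  obtain ⟨t, ht, ht1⟩ := (h2.and self_mem_nhdsWithin).exists
  have ht1 : 1 < t := ht1
  refine ⟨f t, interior_subset (s := ((↑) ⁻¹' F : Set (affineSpan ℝ F))) ht, 1 - 1 / t, 1 / t,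
    sub_pos.2 ((div_lt_one (by linarith)).2 ht1), by positivity, by ring, ?_⟩
  change (1 - 1 / t) • v + (1 / t) • (AffineMap.lineMap v (y : V) t) = (y : V)
  rw [AffineMap.lineMap_apply_module, smul_add, smul_smul, smul_smul, ← add_assoc, ← add_smul,
    one_div, inv_mul_cancel₀ (by linarith), one_smul, mul_sub, inv_mul_cancel₀ (by linarith)]
  simp

namespace CellData

variable {X : Type*} (K : CellData X)

theorem IsString.append {K : CellData X} {x y z : X} {L L' : ℝ} (h : K.IsString x y L)
    (h' : K.IsString y z L') : K.IsString x z (L + L') := by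
  induction h with
  | nil x => rwa [zero_add]
  | cons i u v hu hv y L h ih =>
    rw [add_assoc]
    exact .cons i u v hu hv _ _ (ih h')

theorem isString_single (i : K.ι) {u v : EuclideanSpace ℝ (Fin (K.ambient i))} (hu : u ∈ K.cell i)
    (hv : v ∈ K.cell i) : K.IsString (K.chart i u) (K.chart i v) (dist u v) := by
  simpa using IsString.cons i u v hu hv _ 0 (.nil _)

theorem IsString.symm {K : CellData X} {x y : X} {L : ℝ} (h : K.IsString x y L) :
    K.IsString y x L := by
  induction h with
  | nil x => exact .nil x
  | cons i u v hu hv y L h ih =>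
    rw [add_comm, dist_comm]
    exact ih.append (K.isString_single i hv hu)

theorem IsString.dist_le {X : Type*} [MetricSpace X] {K : CellData X}
    (hK : ∀ i, ∀ u ∈ K.cell i, ∀ v ∈ K.cell i, dist (K.chart i u) (K.chart i v) ≤ dist u v)
    {x y : X} {L : ℝ} (h : K.IsString x y L) : dist x y ≤ L := by
  induction h with
  | nil x => rw [dist_self]
  | cons i u v hu hv y L h ih =>
    have := hK i u hu v hv
    have := dist_triangle (K.chart i u) (K.chart i v) y
    linarith

end CellData

namespace RegularPolygon

/-- Euclidean space as a product of a plane and a line. -/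
noncomputable def prismEquiv : (ℂ × ℝ) ≃ₗ[ℝ] EuclideanSpace ℝ (Fin 3) where
  toFun p := !₂[p.1.re, p.1.im, p.2]
  invFun u := (⟨u 0, u 1⟩, u 2)
  map_add' p q := by ext i; fin_cases i <;> simp
  map_smul' r p := by ext i; fin_cases i <;> simp
  left_inv p := by simp
  right_inv u := by ext i; fin_cases i <;> simp

theorem dist_prismEquiv (p q : ℂ × ℝ) :
    dist (prismEquiv p) (prismEquiv q) = √(dist p.1 q.1 ^ 2 + (p.2 - q.2) ^ 2) := by
  have h : dist p.1 q.1 ^ 2 = (p.1.re - q.1.re) ^ 2 + (p.1.im - q.1.im) ^ 2 := by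
    rw [Complex.dist_eq, Complex.sq_norm, Complex.normSq_apply, Complex.sub_re, Complex.sub_im]
    ring
  rw [EuclideanSpace.dist_eq, Fin.sum_univ_three, h]
  simp [prismEquiv, Real.dist_eq, sq_abs]

variable (m : ℕ)

/-- The prism. -/
def prism : Set (EuclideanSpace ℝ (Fin 3)) := prismEquiv '' (polygon m ×ˢ Icc (0 : ℝ) (7 / 25))

variable {m}

theorem prismEquiv_mem_prism {p : ℂ × ℝ} :
    prismEquiv p ∈ prism m ↔ p.1 ∈ polygon m ∧ p.2 ∈ Icc (0 : ℝ) (7 / 25) :=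
  prismEquiv.injective.mem_set_image

open Classical in
/-- The characteristic map of a prism. -/
noncomputable def prismChart (k : ZMod 2) (u : EuclideanSpace ℝ (Fin 3)) : ArtinComplex m :=
  if h : (prismEquiv.symm u).1 ∈ polygon m then cpt k ⟨_, h⟩ (prismEquiv.symm u).2
  else basePoint m

theorem prismChart_apply (k : ZMod 2) (z : polygon m) (t : ℝ) :
    prismChart k (prismEquiv (z, t)) = cpt k z t := by
  have h : (prismEquiv.symm (prismEquiv ((z : ℂ), t))).1 ∈ polygon m := by
    rw [LinearEquiv.symm_apply_apply]
    exact z.2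
  rw [prismChart, dif_pos h]
  congr 1

theorem exists_of_mem_prism {u : EuclideanSpace ℝ (Fin 3)} (hu : u ∈ prism m) :
    ∃ (z : polygon m) (t : ℝ), t ∈ Icc (0 : ℝ) (7 / 25) ∧ u = prismEquiv (z, t) := by
  obtain ⟨⟨z, t⟩, ⟨hz, ht⟩, rfl⟩ := hu
  exact ⟨⟨z, hz⟩, t, ht, rfl⟩

/-- The screw motion of Euclidean space. -/
noncomputable def euclideanScrew (m : ℕ) (n : ℤ) (u : EuclideanSpace ℝ (Fin 3)) :
    EuclideanSpace ℝ (Fin 3) :=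
  prismEquiv (root m ^ n * (prismEquiv.symm u).1, (prismEquiv.symm u).2 + n * (7 / 25))

theorem euclideanScrew_apply (n : ℤ) (z : polygon m) (t : ℝ) :
    euclideanScrew m n (prismEquiv (z, t)) =
      prismEquiv ((rotate n z : polygon m), t + n * (7 / 25)) := by
  simp [euclideanScrew, rotate]

theorem euclideanScrew_neg (n : ℤ) (u : EuclideanSpace ℝ (Fin 3)) :
    euclideanScrew m (-n) (euclideanScrew m n u) = u := by
  have := zpow_ne_zero n (root_ne_zero m)
  simp [euclideanScrew, zpow_neg, inv_mul_cancel_left₀ this]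

theorem isometry_euclideanScrew (n : ℤ) : Isometry (euclideanScrew m n) := by
  refine Isometry.of_dist_eq fun u v => ?_
  obtain ⟨p, rfl⟩ := prismEquiv.surjective u
  obtain ⟨q, rfl⟩ := prismEquiv.surjective v
  rw [euclideanScrew, euclideanScrew, dist_prismEquiv, dist_prismEquiv]
  simp only [LinearEquiv.symm_apply_apply, add_sub_add_right_eq_sub, Complex.dist_eq, ← mul_sub,
    norm_mul, norm_zpow, norm_root, one_zpow, one_mul]

theorem euclideanScrew_mem_openSegment (n : ℤ) {u v v' : EuclideanSpace ℝ (Fin 3)}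
    (h : u ∈ openSegment ℝ v v') :
    euclideanScrew m n u ∈ openSegment ℝ (euclideanScrew m n v) (euclideanScrew m n v') := by
  obtain ⟨a, b, ha, hb, hab, rfl⟩ := h
  refine ⟨a, b, ha, hb, hab, ?_⟩
  rw [euclideanScrew, euclideanScrew, euclideanScrew, ← map_smul, ← map_smul, ← map_add]
  congr 1
  refine Prod.ext ?_ ?_
  · simp
    ring
  · simp
    linear_combination ((n : ℝ) * (7 / 25)) * hab

/-- `u` lies in the relative interior of the set `F`, in a weak sense. -/
def IsInner (u : EuclideanSpace ℝ (Fin 3)) (F : Set (EuclideanSpace ℝ (Fin 3))) : Prop :=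
  ∀ v ∈ F, ∃ v' ∈ F, u ∈ openSegment ℝ v v'

/-- Each point of `G` is an end of a segment in `C` passing through `u`, and an extreme set
containing `u` contains the ends of such segments. -/
theorem IsInner.subset {C F G : Set (EuclideanSpace ℝ (Fin 3))} {u : EuclideanSpace ℝ (Fin 3)}
    (hG : IsInner u G) (hGC : G ⊆ C) (hF : IsExtreme ℝ C F) (hu : u ∈ F) : G ⊆ F := by
  intro v hv
  obtain ⟨v', hv', h⟩ := hG v hv
  exact hF.left_mem_of_mem_openSegment (hGC hv) (hGC hv') hu h

theorem IsInner.screw {G : Set (EuclideanSpace ℝ (Fin 3))} {u : EuclideanSpace ℝ (Fin 3)}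
    (hG : IsInner u G) (n : ℤ) : IsInner (euclideanScrew m n u) (euclideanScrew m n '' G) := by
  rintro _ ⟨v, hv, rfl⟩
  obtain ⟨v', hv', h⟩ := hG v hv
  exact ⟨_, ⟨v', hv', rfl⟩, euclideanScrew_mem_openSegment n h⟩

theorem height_of_mem_openSegment {p q r : ℂ × ℝ}
    (h : prismEquiv p ∈ openSegment ℝ (prismEquiv q) (prismEquiv r)) :
    ∃ b ∈ Ioo (0 : ℝ) 1, p.1 = AffineMap.lineMap q.1 r.1 b ∧ p.2 = (1 - b) * q.2 + b * r.2 := by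
  obtain ⟨a, b, ha, hb, hab, h⟩ := h
  rw [← map_smul, ← map_smul, ← map_add] at h
  have h1 := prismEquiv.injective h
  obtain rfl : a = 1 - b := by linarith
  refine ⟨b, ⟨hb, by linarith⟩, ?_, ?_⟩
  · rw [AffineMap.lineMap_apply_module, ← h1]
    rfl
  · rw [← h1]
    rfl

/-- The height is constant on a set, if it is extremal at an inner point. -/
theorem IsInner.height_eq {F : Set (EuclideanSpace ℝ (Fin 3))} {z : polygon m} {t : ℝ}
    (hF : IsInner (prismEquiv (z, t)) F) (hFC : F ⊆ prism m) (ht : t = 0 ∨ t = 7 / 25)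
    {w : polygon m} {s : ℝ} (hw : prismEquiv (w, s) ∈ F) : s = t := by
  obtain ⟨v', hv', h⟩ := hF _ hw
  obtain ⟨w', s', hs', rfl⟩ := exists_of_mem_prism (hFC hv')
  obtain ⟨b, hb, -, h1⟩ := height_of_mem_openSegment h
  have hs := (prismEquiv_mem_prism.1 (hFC hw)).2
  dsimp only at h1 hs
  have hb0 := hb.1
  have hb1 : 0 < 1 - b := sub_pos.2 hb.2
  rcases ht with rfl | rfl
  · have := mul_nonneg hb0.le hs'.1
    have := mul_nonneg hb1.le hs.1
    have h2 : (1 - b) * s = 0 := by linarith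
    exact (mul_eq_zero.1 h2).resolve_left hb1.ne'
  · have := mul_nonneg hb0.le (sub_nonneg.2 hs'.2)
    have := mul_nonneg hb1.le (sub_nonneg.2 hs.2)
    have h2 : (1 - b) * (7 / 25 - s) = 0 := by linarith
    have := (mul_eq_zero.1 h2).resolve_left hb1.ne'
    linarith

variable [hm : Fact (5 ≤ m)]

theorem IsInner.eq_corner {F : Set (EuclideanSpace ℝ (Fin 3))} {i : ℤ} {t : ℝ}
    (hF : IsInner (prismEquiv (corner m i, t)) F) (hFC : F ⊆ prism m)
    {w : polygon m} {s : ℝ} (hw : prismEquiv (w, s) ∈ F) : w = corner m i := by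
  obtain ⟨v', hv', h⟩ := hF _ hw
  obtain ⟨w', s', hs', rfl⟩ := exists_of_mem_prism (hFC hv')
  obtain ⟨b, hb, h1, -⟩ := height_of_mem_openSegment h
  exact (eq_of_lineMap_eq_corner hb h1.symm).1

/-- Points of prisms which are identified. -/
theorem prism_identification {k k' : ZMod 2} {z z' : polygon m} {t t' : ℝ}
    (ht : t ∈ Icc (0 : ℝ) (7 / 25)) (ht' : t' ∈ Icc (0 : ℝ) (7 / 25))
    (h : cpt k z t = cpt k' z' t') : ∃ n : ℤ, t' + n * (7 / 25) = t ∧ rotate n z' = z ∧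
      (k' + n = k ∨ ∃ i, z = corner m i) ∧
      (n = 0 ∨ n = 1 ∧ t = 7 / 25 ∧ t' = 0 ∨ n = -1 ∧ t = 0 ∧ t' = 7 / 25) := by
  obtain ⟨n, h1, h2, h3⟩ := cpt_eq_cpt_iff.1 h
  refine ⟨n, h1, h2, h3, ?_⟩
  have h4 : (n : ℝ) < 2 := by linarith [ht.2, ht'.1]
  have h5 : (-2 : ℝ) < n := by linarith [ht.1, ht'.2]
  have h6 : n < 2 := by exact_mod_cast h4
  have h7 : -2 < n := by exact_mod_cast h5
  obtain rfl | rfl | rfl : n = 0 ∨ n = 1 ∨ n = -1 := by omega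
  · exact Or.inl rfl
  · refine Or.inr (Or.inl ⟨rfl, ?_, ?_⟩) <;> push_cast at h1 <;> linarith [ht.2, ht'.1]
  · refine Or.inr (Or.inr ⟨rfl, ?_, ?_⟩) <;> push_cast at h1 <;> linarith [ht.1, ht'.2]

/-- Distinct identified points of one prism lie one on the top and one on the bottom. A face with a
relatively interior point at an extreme height is horizontal, so it cannot contain both. -/
theorem injOn_prismChart (k : ZMod 2) {F : Set (EuclideanSpace ℝ (Fin 3))} (hF : F ⊆ prism m) :
    InjOn (prismChart (m := m) k) (intrinsicInterior ℝ F) := by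
  intro u hu v hv h
  have hu' : IsInner u F := fun w hw => exists_mem_openSegment hu hw
  have huF := intrinsicInterior_subset hu
  have hvF := intrinsicInterior_subset hv
  obtain ⟨z, t, ht, rfl⟩ := exists_of_mem_prism (hF huF)
  obtain ⟨z', t', ht', rfl⟩ := exists_of_mem_prism (hF hvF)
  rw [prismChart_apply, prismChart_apply] at h
  obtain ⟨n, h1, h2, -, h3⟩ := prism_identification ht ht' h
  rcases h3 with rfl | ⟨-, h4, h5⟩ | ⟨-, h4, h5⟩
  · rw [rotate_zero] at h2
    rw [h2, ← h1]
    simp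
  · have := hu'.height_eq hF (Or.inr h4) hvF
    rw [h4, h5] at this
    norm_num at this
  · have := hu'.height_eq hF (Or.inl h4) hvF
    rw [h4, h5] at this
    norm_num at this

omit hm in
/-- The screw motions identify the supports of identified points. -/
theorem screw_subset {F G : Set (EuclideanSpace ℝ (Fin 3))} {z z' : polygon m} {t t' : ℝ}
    (hF : IsExtreme ℝ (prism m) F) (hG : G ⊆ prism m) (hu : prismEquiv (z, t) ∈ F)
    (hv' : IsInner (prismEquiv (z', t')) G) {n : ℤ} (h1 : t' + n * (7 / 25) = t)
    (h2 : rotate n z' = z)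
    (h3 : n = 0 ∨ n = 1 ∧ t = 7 / 25 ∧ t' = 0 ∨ n = -1 ∧ t = 0 ∧ t' = 7 / 25) :
    euclideanScrew m n '' G ⊆ F := by
  have h4 := hv'.screw (m := m) n
  rw [euclideanScrew_apply, h1, h2] at h4
  refine h4.subset ?_ hF hu
  rintro _ ⟨v, hv, rfl⟩
  obtain ⟨w, s, hs, rfl⟩ := exists_of_mem_prism (hG hv)
  rw [euclideanScrew_apply]
  refine prismEquiv_mem_prism.2 ⟨(rotate n w).2, ?_⟩
  rcases h3 with rfl | ⟨rfl, rfl, rfl⟩ | ⟨rfl, rfl, rfl⟩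
  · simpa using hs
  · obtain rfl := hv'.height_eq hG (Or.inl rfl) hv
    norm_num
  · obtain rfl := hv'.height_eq hG (Or.inr rfl) hv
    norm_num

/-- The screw motion relating the two points carries each support into the other by extremality,
hence restricts to an isometry between them. -/
theorem exists_glue (k k' : ZMod 2) {u v : EuclideanSpace ℝ (Fin 3)} {F G : Set _}
    (hF : IsExtreme ℝ (prism m) F) (hG : IsExtreme ℝ (prism m) G)
    (huF : u ∈ intrinsicInterior ℝ F) (hvG : v ∈ intrinsicInterior ℝ G)
    (h : prismChart (m := m) k u = prismChart k' v) :
    ∃ e : F ≃ᵢ G, ∀ x : F, prismChart (m := m) k x = prismChart k' (e x) := by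
  have hu' : IsInner u F := fun w hw => exists_mem_openSegment huF hw
  have hv' : IsInner v G := fun w hw => exists_mem_openSegment hvG hw
  have hu := intrinsicInterior_subset huF
  have hv := intrinsicInterior_subset hvG
  obtain ⟨z, t, ht, rfl⟩ := exists_of_mem_prism (hF.subset hu)
  obtain ⟨z', t', ht', rfl⟩ := exists_of_mem_prism (hG.subset hv)
  rw [prismChart_apply, prismChart_apply] at h
  obtain ⟨n, h1, h2, h3, h4⟩ := prism_identification ht ht' h
  have hGF := screw_subset hF hG.subset hu hv' h1 h2 h4
  have hFG : euclideanScrew m (-n) '' F ⊆ G := by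
    refine screw_subset hG hF.subset hv hu' ?_ (by rw [← h2, rotate_neg_rotate]) ?_
    · push_cast
      linarith
    · rcases h4 with h4 | h4 | h4
      · exact Or.inl (by omega)
      · exact Or.inr (Or.inr ⟨by omega, h4.2.2, h4.2.1⟩)
      · exact Or.inr (Or.inl ⟨by omega, h4.2.2, h4.2.1⟩)
  refine ⟨⟨⟨fun x => ⟨_, hFG ⟨x, x.2, rfl⟩⟩, fun y => ⟨_, hGF ⟨y, y.2, rfl⟩⟩, fun x => ?_,
    fun y => ?_⟩, ?_⟩, ?_⟩
  · have := euclideanScrew_neg (m := m) (-n) x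
    rw [neg_neg] at this
    exact Subtype.ext this
  · exact Subtype.ext (euclideanScrew_neg (m := m) n y)
  · exact Isometry.of_dist_eq fun x y => (isometry_euclideanScrew (m := m) (-n)).dist_eq x y
  · rintro ⟨x, hx⟩
    obtain ⟨w, s, hs, rfl⟩ := exists_of_mem_prism (hF.subset hx)
    change prismChart k _ = prismChart k' (euclideanScrew m (-n) _)
    rw [euclideanScrew_apply, prismChart_apply, prismChart_apply]
    have h5 : k' = k' + n + (-n : ℤ) := by
      push_cast
      ring
    rw [h5, cpt_screw]
    -- If the sheets do not match, the point lies over a vertex; its whole support then does too,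
    -- and there the sheets agree.
    rcases h3 with h3 | ⟨i, rfl⟩
    · rw [h3]
    · obtain rfl := hu'.eq_corner hF.subset hx
      exact cpt_corner _ _ _ _

/-- The prisms. -/
noncomputable def cellData (m : ℕ) [Fact (5 ≤ m)] : CellData (ArtinComplex m) where
  ι := ZMod 2
  ambient _ := 3
  vertices _ := ((finite_range_vertex (m := m)).prod
    (toFinite {(0 : ℝ), 7 / 25})).image prismEquiv |>.toFinset
  vertices_nonempty _ := by
    rw [Finite.toFinset_nonempty]
    exact ⟨prismEquiv (vertex m 0, 0), (vertex m 0, 0), ⟨⟨0, rfl⟩, Or.inl rfl⟩, rfl⟩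
  chart := prismChart

theorem cell_cellData (k : (cellData m).ι) : (cellData m).cell k = prism m := by
  change convexHull ℝ (((((finite_range_vertex (m := m)).prod
    (toFinite {(0 : ℝ), 7 / 25})).image prismEquiv).toFinset :
      Finset (EuclideanSpace ℝ (Fin 3))) : Set (EuclideanSpace ℝ (Fin 3))) = prism m
  rw [Finite.coe_toFinset]
  have h : ((prismEquiv : (ℂ × ℝ) ≃ₗ[ℝ] EuclideanSpace ℝ (Fin 3)) :
      (ℂ × ℝ) → EuclideanSpace ℝ (Fin 3)) = (prismEquiv : (ℂ × ℝ) →ₗ[ℝ] _) := rfl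
  rw [h, ← LinearMap.image_convexHull, convexHull_prod, convexHull_pair,
    segment_eq_Icc (by norm_num)]
  rfl

omit hm in
theorem dist_prismChart_le (k : ZMod 2) {u v : EuclideanSpace ℝ (Fin 3)} (hu : u ∈ prism m)
    (hv : v ∈ prism m) : dist (prismChart (m := m) k u) (prismChart k v) ≤ dist u v := by
  obtain ⟨z, t, -, rfl⟩ := exists_of_mem_prism hu
  obtain ⟨z', t', -, rfl⟩ := exists_of_mem_prism hv
  rw [prismChart_apply, prismChart_apply, dist_prismEquiv]
  exact (ScrewSpace.dist_orbit_le _ _).trans_eq (dist_pt_same _ _ _ _ _)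

theorem sqrt_mul_sq_add {r : ℝ} (hr : 0 ≤ r) (d e : ℝ) :
    √((r * d) ^ 2 + (r * e) ^ 2) = r * √(d ^ 2 + e ^ 2) := by
  rw [mul_pow, mul_pow, ← mul_add, Real.sqrt_mul (sq_nonneg r), Real.sqrt_sq hr]

/-- A slab of height 7/25 starting at an integral multiple of the pitch is a screw translate of one
prism, so a segment in it is a string with one step. -/
theorem isString_slab (k : ZMod 2) (j : ℤ) (z z' : polygon m) {t t' : ℝ}
    (ht : t - j * (7 / 25) ∈ Icc (0 : ℝ) (7 / 25)) (ht' : t' - j * (7 / 25) ∈ Icc (0 : ℝ) (7 / 25)) :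
    (cellData m).IsString (cpt k z t) (cpt k z' t') √(dist z z' ^ 2 + (t - t') ^ 2) := by
  have h : ∀ (w : polygon m) (s : ℝ), cpt k w s =
      prismChart (k + (-j : ℤ)) (prismEquiv ((rotate (-j) w : polygon m), s - j * (7 / 25))) := by
    intro w s
    rw [prismChart_apply, ← cpt_screw (-j) k w s]
    congr 1
    push_cast
    ring
  have h1 := (cellData m).isString_single (k + (-j : ℤ) : ZMod 2)
    (u := prismEquiv ((rotate (-j) z : polygon m), t - j * (7 / 25)))
    (v := prismEquiv ((rotate (-j) z' : polygon m), t' - j * (7 / 25)))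
    ((cell_cellData _).superset (prismEquiv_mem_prism.2 ⟨(rotate _ _).2, ht⟩))
    ((cell_cellData _).superset (prismEquiv_mem_prism.2 ⟨(rotate _ _).2, ht'⟩))
  have h2 : dist (prismEquiv ((rotate (-j) z : polygon m), t - j * (7 / 25)))
      (prismEquiv ((rotate (-j) z' : polygon m), t' - j * (7 / 25))) =
        √(dist z z' ^ 2 + (t - t') ^ 2) := by
    refine (dist_prismEquiv _ _).trans ?_
    dsimp only
    rw [← Subtype.dist_eq, dist_rotate, sub_sub_sub_cancel_right]
  rw [h z, h z', ← h2]
  exact h1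

/-- The segment is cut where it crosses the levels between slabs; the lengths of the collinear
pieces add up. -/
theorem isString_sheet_of_le (k : ZMod 2) (N : ℕ) (j : ℤ) (z z' : polygon m) {t t' : ℝ}
    (ht : j * (7 / 25) ≤ t) (htt' : t ≤ t') (ht' : t' ≤ (j + N + 1) * (7 / 25)) :
    (cellData m).IsString (cpt k z t) (cpt k z' t') √(dist z z' ^ 2 + (t - t') ^ 2) := by
  induction N generalizing j z t with
  | zero =>
    rw [Nat.cast_zero, add_zero] at ht'
    exact isString_slab k j z z' ⟨by linarith, by linarith⟩ ⟨by linarith, by linarith⟩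
  | succ N ih =>
    rcases le_or_gt ((j + 1) * (7 / 25) : ℝ) t with h1 | h1
    · exact ih (j + 1) z (by push_cast; exact h1) htt' (by push_cast at ht' ⊢; linarith)
    rcases le_or_gt t' ((j + 1) * (7 / 25) : ℝ) with h2 | h2
    · exact isString_slab k j z z' ⟨by linarith, by linarith⟩ ⟨by linarith, by linarith⟩
    · obtain ⟨r, hr, hr'⟩ : ∃ r ∈ Icc (0 : ℝ) 1, r * (t' - t) = (j + 1) * (7 / 25) - t := by
        have h3 : 0 < t' - t := by linarith
        exact ⟨((j + 1) * (7 / 25) - t) / (t' - t), ⟨div_nonneg (by linarith) h3.le,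
          (div_le_one h3).2 (by linarith)⟩, div_mul_cancel₀ _ h3.ne'⟩
      have h3 := isString_slab k j z ((convex_polygon m).seg z z' r) (t := t)
        (t' := (j + 1) * (7 / 25)) ⟨by linarith, by linarith⟩ ⟨by linarith, by linarith⟩
      have h4 := ih (j + 1) ((convex_polygon m).seg z z' r) (t := (j + 1) * (7 / 25))
        (by push_cast; rfl) h2.le (by push_cast at ht' ⊢; linarith)
      have h5 := h3.append h4
      rw [dist_comm z, Convex.dist_seg_left _ hr, Convex.dist_seg_right _ hr,
        show t - (j + 1) * (7 / 25) = r * (t - t') by linarith,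
        show (j + 1) * (7 / 25) - t' = (1 - r) * (t - t') by linarith, sqrt_mul_sq_add hr.1,
        sqrt_mul_sq_add (by linarith [hr.2]), ← add_mul, add_sub_cancel, one_mul] at h5
      exact h5

theorem isString_sheet (k : ZMod 2) (z z' : polygon m) (t t' : ℝ) :
    (cellData m).IsString (cpt k z t) (cpt k z' t') √(dist z z' ^ 2 + (t - t') ^ 2) := by
  wlog h : t ≤ t' generalizing z z' t t'
  · have h1 := (this z' z t' t (le_of_not_ge h)).symm
    rwa [dist_comm z', show (t' - t) ^ 2 = (t - t') ^ 2 by ring] at h1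
  have h7 : (0 : ℝ) < 7 / 25 := by norm_num
  obtain ⟨N, hN⟩ := exists_nat_ge (t' / (7 / 25) - ⌊t / (7 / 25)⌋ - 1)
  refine isString_sheet_of_le k N ⌊t / (7 / 25)⌋ z z' ?_ h ?_
  · rw [← le_div_iff₀ h7]
    exact Int.floor_le _
  · rw [← div_le_iff₀ h7]
    linarith

theorem exists_bridge_eq (z z' : polygon m) :
    ∃ i, Double.bridge (corner m) z z' = dist z (corner m i) + dist (corner m i) z' := by
  have hfin : (range fun i => dist z (corner m i) + dist (corner m i) z').Finite := by
    have : (range fun i => dist z (corner m i) + dist (corner m i) z') =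
        (fun w => dist z w + dist w z') '' range (corner m) := by
      rw [← range_comp]
      rfl
    rw [this]
    exact finite_range_corner.image _
  obtain ⟨i, hi⟩ := (range_nonempty _).csInf_mem hfin
  exact ⟨i, hi.symm⟩

/-- For different sheets, the broken line through the nearest crossing vertex is straight after
unfolding, provided that it meets the vertical line over this vertex at the proportional height. -/
theorem isString_pt (p q : Tower m) :
    (cellData m).IsString (ScrewSpace.orbit p) (ScrewSpace.orbit q) (dist p q) := by
  obtain ⟨k, z, t, rfl⟩ := exists_pt p
  obtain ⟨k', z', t', rfl⟩ := exists_pt q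
  by_cases hk : k = k'
  · subst hk
    rw [dist_pt_same]
    exact isString_sheet k z z' t t'
  · obtain ⟨i, hi⟩ := exists_bridge_eq z z'
    rw [dist_pt_ne hk, hi]
    have h1 := dist_nonneg (x := z) (y := corner m i)
    have h2 := dist_nonneg (x := corner m i) (y := z')
    obtain ⟨r, hr, h3⟩ : ∃ r ∈ Icc (0 : ℝ) 1, dist z (corner m i) =
        r * (dist z (corner m i) + dist (corner m i) z') := by
      rcases (add_nonneg h1 h2).eq_or_lt with h4 | h4
      · exact ⟨0, ⟨le_rfl, zero_le_one⟩, by linarith⟩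
      · exact ⟨dist z (corner m i) / (dist z (corner m i) + dist (corner m i) z'),
          ⟨by positivity, (div_le_one h4).2 (by linarith)⟩, (div_mul_cancel₀ _ h4.ne').symm⟩
    have h4 : dist (corner m i) z' = (1 - r) * (dist z (corner m i) + dist (corner m i) z') := by
      linarith
    have h5 := isString_sheet k z (corner m i) t (t + r * (t' - t))
    have h6 := isString_sheet k' (corner m i) z' (t + r * (t' - t)) t'
    rw [cpt_corner k k'] at h5
    have h7 := h5.append h6
    have h8 : √(dist z (corner m i) ^ 2 + (t - (t + r * (t' - t))) ^ 2) =
        r * √((dist z (corner m i) + dist (corner m i) z') ^ 2 + (t - t') ^ 2) := by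
      rw [← sqrt_mul_sq_add hr.1, ← h3]
      congr 2
      ring
    have h9 : √(dist (corner m i) z' ^ 2 + (t + r * (t' - t) - t') ^ 2) =
        (1 - r) * √((dist z (corner m i) + dist (corner m i) z') ^ 2 + (t - t') ^ 2) := by
      rw [← sqrt_mul_sq_add (by linarith [hr.2]), ← h4]
      congr 2
      ring
    rw [h8, h9, ← add_mul, add_sub_cancel, one_mul] at h7
    exact h7

/-- The structure of piecewise Euclidean complex. -/
noncomputable def piecewiseEuclideanComplex (m : ℕ) [Fact (5 ≤ m)] :
    PiecewiseEuclideanComplex (ArtinComplex m) where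
  toCellData := cellData m
  covers x := by
    obtain ⟨k, z, t, ht, rfl⟩ := exists_cpt_mem_Ico x
    exact ⟨k, prismEquiv (z, t), (cell_cellData k).superset
      (prismEquiv_mem_prism.2 ⟨z.2, Ico_subset_Icc_self ht⟩), prismChart_apply k z t⟩
  injOn_face k F hF :=
    injOn_prismChart k (hF.isExtreme.subset.trans (cell_cellData k).subset)
  glue k k' u hu v hv h F G hF hG := by
    have h1 : IsExtreme ℝ (prism m) F :=
      (congrArg (fun S => IsExtreme ℝ S F) (cell_cellData k)).mp hF.1.isExtreme
    have h2 : IsExtreme ℝ (prism m) G :=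
      (congrArg (fun S => IsExtreme ℝ S G) (cell_cellData k')).mp hG.1.isExtreme
    exact exists_glue k k' h1 h2 hF.2 hG.2 h
  isGLB_dist x y := by
    constructor
    · intro L hL
      exact CellData.IsString.dist_le (fun k u hu v hv => dist_prismChart_le k
        ((cell_cellData k).subset hu) ((cell_cellData k).subset hv)) hL
    -- The orbit distance is an infimum over translates, and the distance to each translate is the
    -- length of a string.
    · intro b hb
      obtain ⟨p, rfl⟩ := ScrewSpace.orbit_surjective x
      obtain ⟨q, rfl⟩ := ScrewSpace.orbit_surjective y
      rw [ScrewSpace.dist_orbit]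
      refine le_ciInf fun n => hb ?_
      have h := isString_pt p (n +ᵥ q)
      rwa [ScrewSpace.orbit_vadd] at h

theorem im_root_pos : 0 < (root m).im := by
  have h5 : (5 : ℝ) ≤ m := by exact_mod_cast hm.out
  have : root m = Complex.exp ((2 * Real.pi / m : ℝ) * Complex.I) := by
    rw [root]; congr 1; push_cast; ring
  rw [this, Complex.exp_ofReal_mul_I_im]
  refine Real.sin_pos_of_pos_of_lt_pi (by have := Real.pi_pos; positivity) ?_
  rw [div_lt_iff₀ (by linarith)]
  nlinarith [Real.pi_pos]

theorem vectorSpan_prism : vectorSpan ℝ (prism m) = ⊤ := by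
  set V := vectorSpan ℝ (prism m)
  have hmem : ∀ {z z' : ℂ} {t t' : ℝ}, z ∈ polygon m → z' ∈ polygon m →
      t ∈ Icc (0 : ℝ) (7 / 25) → t' ∈ Icc (0 : ℝ) (7 / 25) →
      prismEquiv (z - z', t - t') ∈ V := by
    intro z z' t t' hz hz' ht ht'
    have h := vsub_mem_vectorSpan ℝ (s := prism m) (p₁ := prismEquiv (z, t))
      (p₂ := prismEquiv (z', t')) (prismEquiv_mem_prism.2 ⟨hz, ht⟩)
      (prismEquiv_mem_prism.2 ⟨hz', ht'⟩)
    rwa [vsub_eq_sub, ← map_sub] at h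
  have h0 : (0 : ℝ) ∈ Icc (0 : ℝ) (7 / 25) := ⟨le_rfl, by norm_num⟩
  have h7 : (7 / 25 : ℝ) ∈ Icc (0 : ℝ) (7 / 25) := ⟨by norm_num, le_rfl⟩
  have ha := hmem (vertex_mem m 1) (vertex_mem m 0) h0 h0
  have hb := hmem (vertex_mem m 2) (vertex_mem m 1) h0 h0
  have hc := hmem (vertex_mem m 0) (vertex_mem m 0) h7 h0
  rw [sub_self, sub_zero] at hc
  rw [sub_self] at ha hb
  have hp : vertex m 1 - vertex m 0 ≠ 0 := fun h => corner_ne_corner_succ (m := m) 0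
    (Subtype.ext (sub_eq_zero.1 h).symm)
  have hroot : vertex m 2 - vertex m 1 = root m * (vertex m 1 - vertex m 0) := by
    have h1 := root_pow_mul_vertex (m := m) 1 1
    have h2 := root_pow_mul_vertex (m := m) 1 0
    rw [zpow_one] at h1 h2
    rw [mul_sub, h1, h2]
    norm_num
  rw [eq_top_iff]
  intro u _
  obtain ⟨⟨w, t⟩, rfl⟩ := prismEquiv.surjective u
  have him := (im_root_pos (m := m)).ne'
  obtain ⟨q, hq⟩ : ∃ q, w = q * (vertex m 1 - vertex m 0) := ⟨_, (div_mul_cancel₀ w hp).symm⟩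
  -- The root of unity is not real, so it forms with 1 a real basis of the plane; hence two
  -- consecutive sides span the horizontal directions.
  have hq2 : q = ((q.re - q.im / (root m).im * (root m).re : ℝ) : ℂ) +
      ((q.im / (root m).im : ℝ) : ℂ) * root m := by
    refine Complex.ext ?_ ?_
    · rw [Complex.add_re, Complex.ofReal_re, Complex.re_ofReal_mul]
      ring
    · rw [Complex.add_im, Complex.ofReal_im, Complex.im_ofReal_mul, div_mul_cancel₀ _ him, zero_add]
  have h : (w, t) = (q.re - q.im / (root m).im * (root m).re) • (vertex m 1 - vertex m 0, (0 : ℝ)) +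
      (q.im / (root m).im) • (vertex m 2 - vertex m 1, (0 : ℝ)) +
      (t / (7 / 25)) • ((0 : ℂ), (7 / 25 : ℝ)) := by
    refine Prod.ext ?_ ?_
    · simp only [Prod.fst_add, Prod.smul_fst, Complex.real_smul, mul_zero, add_zero]
      rw [hq, hroot, ← mul_assoc, ← add_mul, ← hq2]
    · simp only [Prod.snd_add, Prod.smul_snd, smul_eq_mul, mul_zero, zero_add]
      exact (div_mul_cancel₀ _ (by norm_num)).symm
  rw [h, map_add, map_add, map_smul, map_smul, map_smul]
  exact V.add_mem (V.add_mem (V.smul_mem _ ha) (V.smul_mem _ hb)) (V.smul_mem _ hc)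

theorem hasDimension_three : (piecewiseEuclideanComplex m).HasDimension 3 := by
  have h : ∀ k : ZMod 2, (cellData m).cellDim k = 3 := by
    intro k
    refine (congrArg (fun S : Set (EuclideanSpace ℝ (Fin 3)) =>
      Module.finrank ℝ (vectorSpan ℝ S)) (cell_cellData k)).trans ?_
    refine (congrArg (fun V : Submodule ℝ (EuclideanSpace ℝ (Fin 3)) => Module.finrank ℝ V)
      (vectorSpan_prism (m := m))).trans ?_
    rw [finrank_top, finrank_euclideanSpace_fin]
  exact ⟨fun k => (h k).le, (0 : ZMod 2), h 0⟩

end RegularPolygon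

/-! ### Loop subgroups, angles and the conclusion -/

namespace RegularPolygon

variable {m : ℕ} [Fact (5 ≤ m)]

theorem loopSubgroup_eq (k : ZMod 2) {g : DihedralArtinGroup m}
    (hg : artinEquiv m g = FundamentalGroup.fromPath (Path.Homotopic.Quotient.mk (edgeLoop k)))
    (hinf : ∀ n : ℤ, g ^ n = 1 → n = 0) (h : basePoint m ∈ range (edgeLoop (m := m) k)) :
    Function.Injective (fundamentalGroupInclusion (range (edgeLoop (m := m) k)) (basePoint m) h) ∧
    (fundamentalGroupInclusion (range (edgeLoop (m := m) k)) (basePoint m) h).range =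
      (Subgroup.zpowers g).map (artinEquiv m).toMonoidHom := by
  rw [MonoidHom.map_zpowers]
  change _ ∧ _ = Subgroup.zpowers (artinEquiv m g)
  rw [hg]
  refine Path.fundamentalGroupInclusion_range (isSimpleLocalGeodesicLoop_edgeLoop k).simple
    (fun n hn => hinf n ?_) h
  rwa [← hg, ← map_zpow, EmbeddingLike.map_eq_one_iff] at hn

theorem exists_angle_of_ne :
    ∃ θ : ℝ, HasAngle (basePoint m) (edgeLoop 0).posSide (edgeLoop 1).posSide θ ∧
      HasAngle (basePoint m) (edgeLoop 0).negSide (edgeLoop 1).negSide θ ∧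
      4 * Real.pi / 5 < θ :=
  ⟨_, hasAngle_ray_of_ne (k := 0) (k' := 1) (by decide) (Or.inl rfl)
      (fun _ ht => posSide_edgeLoop 0 ht) (fun _ ht => posSide_edgeLoop 1 ht),
    hasAngle_ray_of_ne (k := 0 + 1) (k' := 1 + 1) (by decide) (Or.inr rfl)
      (fun _ ht => negSide_edgeLoop 0 ht) (fun _ ht => negSide_edgeLoop 1 ht),
    four_pi_div_five_lt_arccos⟩

theorem exists_angle_of_eq (hm : 5 ≤ m) :
    ∃ θ : ℝ, HasAngle (basePoint m) (edgeLoop 0).posSide (edgeLoop 1).negSide θ ∧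
      HasAngle (basePoint m) (edgeLoop 0).negSide (edgeLoop 1).posSide θ ∧
      3 * Real.pi / 5 < θ ∧ (6 ≤ m → 2 * Real.pi / 3 < θ) := by
  refine ⟨_, hasAngle_ray_of_eq (m := m) 0 (ε := 1) (Or.inl rfl)
      (fun _ ht => posSide_edgeLoop 0 ht) (fun _ ht => negSide_edgeLoop 1 ht),
    hasAngle_ray_of_eq 1 (ε := -1) (Or.inr rfl)
      (fun _ ht => negSide_edgeLoop 0 ht) (fun _ ht => posSide_edgeLoop 1 ht), ?_, fun h6 => ?_⟩
  · refine lt_of_eq_of_lt ?_ (lt_arccos_interior_angle (m := m) le_rfl hm)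
    push_cast
    ring
  · refine lt_of_eq_of_lt ?_ (lt_arccos_interior_angle (m := m) (N := 6) (by norm_num) h6)
    push_cast
    ring

end RegularPolygon

theorem lemma1p1 (m : ℕ) (hm : 5 ≤ m) :
    ∃ (X : Type) (_ : MetricSpace X) (K : PiecewiseEuclideanComplex X) (x₀ : X)
      (φ : DihedralArtinGroup m ≃* FundamentalGroup X x₀) (γa γb : Path x₀ x₀),
      -- `X` is a compact, locally CAT(0), 3-dimensional piecewise Euclidean complex
      CompactSpace X ∧ Finite K.ι ∧ K.HasDimension 3 ∧ IsLocallyCAT0 X ∧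
      -- the loops are simple, locally geodesic, of length 1, and represent `a` and `b`
      γa.IsSimpleLocalGeodesicLoop ∧ γb.IsSimpleLocalGeodesicLoop ∧
      φ (DihedralArtinGroup.a m) = FundamentalGroup.fromPath (Path.Homotopic.Quotient.mk γa) ∧
      φ (DihedralArtinGroup.b m) = FundamentalGroup.fromPath (Path.Homotopic.Quotient.mk γb) ∧
      -- the fundamental group of the image of each loop is the subgroup `⟨a⟩`, resp. `⟨b⟩`
      (∀ h : x₀ ∈ Set.range γa,
        Function.Injective (fundamentalGroupInclusion (Set.range γa) x₀ h) ∧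
        (fundamentalGroupInclusion (Set.range γa) x₀ h).range =
          (Subgroup.zpowers (DihedralArtinGroup.a m)).map φ.toMonoidHom) ∧
      (∀ h : x₀ ∈ Set.range γb,
        Function.Injective (fundamentalGroupInclusion (Set.range γb) x₀ h) ∧
        (fundamentalGroupInclusion (Set.range γb) x₀ h).range =
          (Subgroup.zpowers (DihedralArtinGroup.b m)).map φ.toMonoidHom) ∧
      -- the loops meet only at `x₀`
      Set.range γa ∩ Set.range γb = {x₀} ∧
      -- the angles between `a⁺` and `b⁺`, and between `a⁻` and `b⁻`
      (∃ θ : ℝ, HasAngle x₀ γa.posSide γb.posSide θ ∧ HasAngle x₀ γa.negSide γb.negSide θ ∧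
        4 * Real.pi / 5 < θ) ∧
      -- the angles between `a⁺` and `b⁻`, and between `a⁻` and `b⁺`
      (∃ θ : ℝ, HasAngle x₀ γa.posSide γb.negSide θ ∧ HasAngle x₀ γa.negSide γb.posSide θ ∧
        3 * Real.pi / 5 < θ ∧ (6 ≤ m → 2 * Real.pi / 3 < θ)) := by
  have : Fact (5 ≤ m) := ⟨hm⟩
  open RegularPolygon in
  exact ⟨ArtinComplex m, inferInstance, piecewiseEuclideanComplex m, basePoint m, artinEquiv m,
    edgeLoop 0, edgeLoop 1, compactSpace_artinComplex, inferInstanceAs (Finite (ZMod 2)),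
    hasDimension_three, isLocallyCAT0, isSimpleLocalGeodesicLoop_edgeLoop 0,
    isSimpleLocalGeodesicLoop_edgeLoop 1, artinHom_a, artinHom_b,
    loopSubgroup_eq 0 artinHom_a fun n => DihedralArtinGroup.zpow_injective m
      (DihedralArtinGroup.degree_a m),
    loopSubgroup_eq 1 artinHom_b fun n => DihedralArtinGroup.zpow_injective m
      (DihedralArtinGroup.degree_b m),
    range_edgeLoop_inter (by decide), exists_angle_of_ne, exists_angle_of_eq hm⟩
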